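/- Let $d\ge 3$, let $\mathbb D\subset\mathbb R^d$ be the open unit ball with the flat metric $g$, and write $L=-\sum_i\partial_i^2$. **Setup.** A *conformal embedding* is a smooth open embedding $\phi:\mathbb D\to\mathbb D$ that preserves orientation and satisfies $\phi^*g=\Omega_\phi^2 g$ with $\Omega_\phi:\mathbb D\to(0,\infty)$ smooth. For $n\ge0$ let $\mathbb{CE}_d^{\mathrm{emb}}(n)$ be the set of conformal open embeddings $\bigsqcup_n\mathbb D\to\mathbb D$, i.e. of $n$-tuples of conformal embeddings with pairwise disjoint images; this is an operad under $(\phi_1,\dots,\phi_n)\circ_i(\psi_1,\dots,\psi_m)=(\phi_1,\dots,\phi_i\psi_1,\dots,\phi_i\psi_m,\dots,\phi_n)$, with unit $\mathrm{id}_{\mathbb D}$ and with $S_n$ permuting the disks. For a real vector space $V$ let $P(V)=\bigoplus_n\mathrm{Sym}^nV$. Let $\mathrm F(\mathbb D)$ be the cokernel of the map $P(C_c^\infty(\mathbb D))\otimes C_c^\infty(\mathbb D)\to P(C_c^\infty(\mathbb D))$, $$f_1\cdots f_n\otimes h\mapsto -f_1\cdots f_n\cdot Lh+\sum_i\Big(\int_{\mathbb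 D} f_ih\Big)f_1\cdots\widehat{f_i}\cdots f_n .$$ For $(\phi_1,\dots,\phi_n)\in\mathbb{CE}_d^{\mathrm{emb}}(n)$ let $\mathrm F(\mathbb D)^{\otimes n}\to\mathrm F(\mathbb D)$ be the map $[F_1]\otimes\cdots\otimes[F_n]\mapsto[W_{\phi_1}(F_1)\cdots W_{\phi_n}(F_n)]$, where $W_\phi$ is multiplicative and, on $f\in C_c^\infty(\mathbb D)$, $W_\phi f=\Omega_\phi(\phi^{-1}(\cdot))^{-(d+2)/2}\,f\circ\phi^{-1}$ on $\phi(\mathbb D)$ and $W_\phi f=0$ elsewhere. Let $$G_d(x,y)=\frac1{(d-2)\,\omega_d\,\|x-y\|^{d-2}},\qquad \omega_d=\mathrm{vol}(S^{d-1}),$$ let $\partial_{G_d}(f,h)=\int_{\mathbb D\times\mathbb D}G_d(x,y)f(x)h(y)\,dx\,dy$, extended to $P(C_c^\infty(\mathbb D))$ by $\partial_{G_d}(f_1\cdots f_n)=\sum_{i<j}\partial_{G_d}(f_i,f_j)f_1\cdots\widehat{f_i}\cdots\widehat{f_j}\cdots f_n$. Let $H(\mathbb D)$ be the space of harmonic functions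 on $\mathbb D$ with the topology of locally uniform convergence of all derivatives, and $H'(\mathbb D)$ its topological dual. For $a\in\mathbb D$ and $\alpha\in\mathbb N^d$ let $\partial^\alpha\delta_a\in H'(\mathbb D)$ be $u\mapsto(-1)^{|\alpha|}(\partial^\alpha u)(a)$, and $\delta_a=\partial^0\delta_a$. **Theorem.** The above operations on $\mathrm F(\mathbb D)$ are well defined; $\exp(\partial_{G_d})$ induces a linear isomorphism $\mathrm F(\mathbb D)\cong P\big(C_c^\infty(\mathbb D)/LC_c^\infty(\mathbb D)\big)$; the pairing $f\mapsto(u\mapsto\int_{\mathbb D}fu)$ induces a linear isomorphism $C_c^\infty(\mathbb D)/LC_c^\infty(\mathbb D)\cong H'(\mathbb D)$; and the operations $\rho^H$ on $P(H'(\mathbb D))$ obtained from those on $\mathrm F(\mathbb D)$ by transport along the resulting isomorphism $\mathrm F(\mathbb D)\cong P(H'(\mathbb D))$ make $P(H'(\mathbb D))$ a $\mathbb{CE}_d^{\mathrm{emb}}$-algebra, with the following properties. 1. For $\phi\in\mathbb{CE}_d^{\mathrm{emb}}(1)$, the formula $u^\phi(x)=\Omega_\phi(x)^{\frac{d-2}2}u(\phi(x))$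 defines a continuous linear operator on $H(\mathbb D)$, and $\rho^H_\phi$ is the algebra endomorphism of $P(H'(\mathbb D))$ induced by the linear map $T\mapsto\phi.T$, $(\phi.T)(u)=T(u^\phi)$. In particular, for $a\in\mathbb D$, $$\rho^H_\phi(\delta_a)=\Omega_\phi(a)^{\frac{d-2}2}\,\delta_{\phi(a)}.$$ 2. For $(\phi,\psi)\in\mathbb{CE}_d^{\mathrm{emb}}(2)$ and $a,b\in\mathbb D$, $$\rho^H_{\phi,\psi}(\delta_a,\delta_b)=\Omega_\phi(a)^{\frac{d-2}2}\Omega_\psi(b)^{\frac{d-2}2}\,\delta_{\phi(a)}\cdot\delta_{\psi(b)}+\frac{\Omega_\phi(a)^{\frac{d-2}2}\Omega_\psi(b)^{\frac{d-2}2}}{(d-2)\,\omega_d\,\|\phi(a)-\psi(b)\|^{d-2}}.$$ 3. Let $0<r,s<1$ and $a,b\in\mathbb D$ be such that the open balls $B_r(a),B_s(b)$ are disjoint and contained in $\mathbb D$, and put $B_{a,r}(x)=rx+a$, $B_{b,s}(x)=sx+b$. Then $(B_{a,r},B_{b,s})\in\mathbb{CE}_d^{\mathrm{emb}}(2)$,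 and for all $\alpha,\beta\in\mathbb N^d$ $$\rho^H_{B_{a,r},B_{b,s}}(\partial^\alpha\delta_0,\partial^\beta\delta_0)=r^{|\alpha|+\frac{d-2}2}s^{|\beta|+\frac{d-2}2}\left((\partial^\alpha\delta_a)\cdot(\partial^\beta\delta_b)+(-1)^{|\alpha|+|\beta|}\,\partial_x^\alpha\partial_y^\beta\frac1{(d-2)\,\omega_d\,\|x-y\|^{d-2}}\bigg|_{x=a,\,y=b}\right).$$ -/

import Mathlib

open MeasureTheory Topology TensorProduct Laplacian InnerProductSpace
open scoped ContDiff Distributions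

namespace ConformalDisk

noncomputable section

/-! ### Polynomial algebras: derivations and second order contractions -/

section SymAlg

variable {V V' : Type*} [AddCommGroup V] [Module ℝ V] [AddCommGroup V'] [Module ℝ V']

/-- The polynomial algebra `P(V) = ⨁ₙ Symⁿ V`. -/
abbrev PolyAlg (V : Type*) [AddCommGroup V] [Module ℝ V] := SymmetricAlgebra ℝ V

/-- The algebra homomorphism `P(f) : P(V) → P(V')`, `v₁ ⋯ vₙ ↦ f(v₁) ⋯ f(vₙ)`. -/
def polyMap (f : V →ₗ[ℝ] V') : PolyAlg V →ₐ[ℝ] PolyAlg V' :=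
  SymmetricAlgebra.lift (SymmetricAlgebra.ι ℝ V' ∘ₗ f)

lemma polyMap_comp_apply {V'' : Type*} [AddCommGroup V''] [Module ℝ V'']
    (g : V' →ₗ[ℝ] V'') (f : V →ₗ[ℝ] V') (x : PolyAlg V) :
    polyMap g (polyMap f x) = polyMap (g ∘ₗ f) x := by
  have h : (polyMap g).comp (polyMap f) = polyMap (g ∘ₗ f) := by
    apply SymmetricAlgebra.algHom_ext
    ext v
    simp [polyMap]
  exact congrArg (fun F => F x) h

lemma polyMap_id_apply (x : PolyAlg V) : polyMap (LinearMap.id : V →ₗ[ℝ] V) x = x := by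
  have h : polyMap (LinearMap.id : V →ₗ[ℝ] V) = AlgHom.id ℝ (PolyAlg V) := by
    apply SymmetricAlgebra.algHom_ext
    ext v
    simp [polyMap]
  exact congrArg (fun F => F x) h

/-- The isomorphism `P(V) ≅ P(V')` induced by a linear isomorphism `V ≅ V'`. -/
def polyEquiv (e : V ≃ₗ[ℝ] V') : PolyAlg V ≃ₗ[ℝ] PolyAlg V' :=
  { (polyMap e.toLinearMap).toLinearMap with
    invFun := polyMap e.symm.toLinearMap
    left_inv := fun x => by
      change polyMap e.symm.toLinearMap (polyMap e.toLinearMap x) = x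
      rw [polyMap_comp_apply]
      simpa using polyMap_id_apply x
    right_inv := fun x => by
      change polyMap e.toLinearMap (polyMap e.symm.toLinearMap x) = x
      rw [polyMap_comp_apply]
      simpa using polyMap_id_apply x }

/-- The unique derivation of `P(V)` with values in a `P(V)`-module which is `f` on `V`. -/
def polyDerivation {M : Type*} [AddCommGroup M] [Module ℝ M] [Module (PolyAlg V) M]
    [IsScalarTower ℝ (PolyAlg V) M] (f : V →ₗ[ℝ] M) : Derivation ℝ (PolyAlg V) M :=
  letI : Module (PolyAlg V)ᵐᵒᵖ M :=
    Module.compHom M ((RingHom.id (PolyAlg V)).fromOpposite mul_comm)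
  haveI : IsCentralScalar (PolyAlg V) M := ⟨fun _ _ => rfl⟩
  letI F : PolyAlg V →ₐ[ℝ] TrivSqZeroExt (PolyAlg V) M :=
    SymmetricAlgebra.lift
      ((TrivSqZeroExt.inlAlgHom ℝ (PolyAlg V) M).toLinearMap ∘ₗ SymmetricAlgebra.ι ℝ V +
        ((TrivSqZeroExt.inrHom (PolyAlg V) M).restrictScalars ℝ) ∘ₗ f)
  haveI hF : ∀ x, (F x).fst = x := fun x => by
    have h : (TrivSqZeroExt.fstHom ℝ (PolyAlg V) M).comp F = AlgHom.id ℝ (PolyAlg V) := by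
      apply SymmetricAlgebra.algHom_ext
      ext v
      simp [F]
    exact congrArg (fun G => G x) h
  Derivation.mk'
    { toFun := fun x => (F x).snd
      map_add' := fun x y => by simp
      map_smul' := fun c x => by simp }
    (fun x y => by
      change (F (x * y)).snd = x • (F y).snd + y • (F x).snd
      rw [map_mul, TrivSqZeroExt.snd_mul, hF, hF]
      simp)

lemma polyDerivation_ι {M : Type*} [AddCommGroup M] [Module ℝ M] [Module (PolyAlg V) M]
    [IsScalarTower ℝ (PolyAlg V) M] (f : V →ₗ[ℝ] M) (v : V) :
    polyDerivation f (SymmetricAlgebra.ι ℝ V v) = f v := by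
  simp [polyDerivation]

lemma poly_derivation_ext {M : Type*} [AddCommGroup M] [Module ℝ M] [Module (PolyAlg V) M]
    [IsScalarTower ℝ (PolyAlg V) M] {D₁ D₂ : Derivation ℝ (PolyAlg V) M}
    (h : ∀ v, D₁ (SymmetricAlgebra.ι ℝ V v) = D₂ (SymmetricAlgebra.ι ℝ V v)) : D₁ = D₂ := by
  ext x
  induction x using SymmetricAlgebra.induction with
  | algebraMap r => simp
  | ι v => exact h v
  | mul a b ha hb => simp [Derivation.leibniz, ha, hb]
  | add a b ha hb => simp [ha, hb]

/-- For a linear functional `ℓ` on `V`, the operator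
`v₁ ⋯ vₙ ↦ ∑ᵢ ℓ(vᵢ) v₁ ⋯ v̂ᵢ ⋯ vₙ` on `P(V)`; it depends linearly on `ℓ`. -/
def contract : (V →ₗ[ℝ] ℝ) →ₗ[ℝ] (PolyAlg V →ₗ[ℝ] PolyAlg V) where
  toFun ℓ := (polyDerivation (Algebra.linearMap ℝ (PolyAlg V) ∘ₗ ℓ)).toLinearMap
  map_add' ℓ ℓ' := by
    rw [← Derivation.coe_add_linearMap]
    congr 1
    apply poly_derivation_ext
    intro v
    simp [polyDerivation_ι]
  map_smul' c ℓ := by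
    rw [RingHom.id_apply, ← Derivation.coe_smul_linearMap]
    congr 1
    apply poly_derivation_ext
    intro v
    simp [polyDerivation_ι, Algebra.smul_def]

lemma contract_ι_mul (ℓ : V →ₗ[ℝ] ℝ) (v : V) (x : PolyAlg V) :
    contract ℓ (SymmetricAlgebra.ι ℝ V v * x) =
      SymmetricAlgebra.ι ℝ V v * contract ℓ x + ℓ v • x := by
  change polyDerivation _ _ = _ * polyDerivation _ _ + _
  rw [Derivation.leibniz, polyDerivation_ι]
  simp [Algebra.smul_def, mul_comm]

lemma contract_algebraMap (ℓ : V →ₗ[ℝ] ℝ) (r : ℝ) :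
    contract ℓ (algebraMap ℝ (PolyAlg V) r) = 0 := by
  change polyDerivation _ _ = 0
  simp

lemma contract_one (ℓ : V →ₗ[ℝ] ℝ) : contract ℓ (1 : PolyAlg V) = 0 := by
  have h := contract_algebraMap ℓ 1
  rwa [map_one] at h

/-- For a symmetric bilinear form `B` on `V`, the operator
`∂_B (v₁ ⋯ vₙ) = ∑_{i<j} B(vᵢ, vⱼ) v₁ ⋯ v̂ᵢ ⋯ v̂ⱼ ⋯ vₙ` on `P(V)`. It is one half of the composite
of the differential `P(V) → P(V) ⊗ V`, `v₁ ⋯ vₙ ↦ ∑ᵢ v₁ ⋯ v̂ᵢ ⋯ vₙ ⊗ vᵢ`, with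
`F ⊗ v ↦ contract (B v) F`. -/
def contract₂ (B : V →ₗ[ℝ] V →ₗ[ℝ] ℝ) : PolyAlg V →ₗ[ℝ] PolyAlg V :=
  (2⁻¹ : ℝ) • (TensorProduct.lift (contract ∘ₗ B).flip ∘ₗ
    (polyDerivation (TensorProduct.mk ℝ (PolyAlg V) V 1)).toLinearMap)

lemma contract₂_algebraMap (B : V →ₗ[ℝ] V →ₗ[ℝ] ℝ) (r : ℝ) :
    contract₂ B (algebraMap ℝ (PolyAlg V) r) = 0 := by
  simp [contract₂]

lemma contract₂_one (B : V →ₗ[ℝ] V →ₗ[ℝ] ℝ) : contract₂ B (1 : PolyAlg V) = 0 := by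
  have h := contract₂_algebraMap B 1
  rwa [map_one] at h

lemma contract₂_apply (B : V →ₗ[ℝ] V →ₗ[ℝ] ℝ) (x : PolyAlg V) :
    contract₂ B x = (2⁻¹ : ℝ) • TensorProduct.lift (contract ∘ₗ B).flip
      (polyDerivation (TensorProduct.mk ℝ (PolyAlg V) V 1) x) := rfl

/-- The recursion which determines `∂_B`. -/
lemma contract₂_ι_mul (B : V →ₗ[ℝ] V →ₗ[ℝ] ℝ) (hB : ∀ v w, B v w = B w v) (v : V)
    (x : PolyAlg V) :
    contract₂ B (SymmetricAlgebra.ι ℝ V v * x) =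
      SymmetricAlgebra.ι ℝ V v * contract₂ B x + contract (B v) x := by
  have key : ∀ t : PolyAlg V ⊗[ℝ] V, TensorProduct.lift (contract ∘ₗ B).flip
      (SymmetricAlgebra.ι ℝ V v • t) =
      SymmetricAlgebra.ι ℝ V v * TensorProduct.lift (contract ∘ₗ B).flip t +
        TensorProduct.lift ((LinearMap.lsmul ℝ (PolyAlg V)).flip.compl₂ (B v)) t := by
    intro t
    induction t using TensorProduct.induction_on with
    | zero => simp
    | tmul y w =>
      rw [TensorProduct.smul_tmul', smul_eq_mul]
      simp [contract_ι_mul, hB v w]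
    | add a b ha hb => rw [smul_add, map_add, map_add, map_add, ha, hb]; ring
  have key2 : ∀ y : PolyAlg V,
      TensorProduct.lift ((LinearMap.lsmul ℝ (PolyAlg V)).flip.compl₂ (B v))
        (polyDerivation (TensorProduct.mk ℝ (PolyAlg V) V 1) y) = contract (B v) y := by
    intro y
    induction y using SymmetricAlgebra.induction with
    | algebraMap r => simp [contract_algebraMap]
    | ι w =>
      have := contract_ι_mul (B v) w 1
      rw [mul_one, ← map_one (algebraMap ℝ (PolyAlg V)), contract_algebraMap] at this
      rw [this, polyDerivation_ι]
      simp
    | mul a b ha hb =>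
      have hm : ∀ (c : PolyAlg V) (t : PolyAlg V ⊗[ℝ] V),
          TensorProduct.lift ((LinearMap.lsmul ℝ (PolyAlg V)).flip.compl₂ (B v)) (c • t) =
          c * TensorProduct.lift ((LinearMap.lsmul ℝ (PolyAlg V)).flip.compl₂ (B v)) t := by
        intro c t
        induction t using TensorProduct.induction_on with
        | zero => simp
        | tmul y w => rw [TensorProduct.smul_tmul', smul_eq_mul]; simp
        | add a b ha hb => rw [smul_add, map_add, map_add, ha, hb, mul_add]
      rw [Derivation.leibniz, map_add, hm, hm, ha, hb]
      change _ = polyDerivation _ _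
      rw [Derivation.leibniz]
      rfl
    | add a b ha hb => rw [map_add, map_add, map_add, ha, hb]
  rw [contract₂_apply, contract₂_apply]
  rw [Derivation.leibniz, map_add, key, key2, polyDerivation_ι]
  simp only [TensorProduct.mk_apply, TensorProduct.smul_tmul', smul_eq_mul, mul_one,
    TensorProduct.lift.tmul, LinearMap.flip_apply, LinearMap.comp_apply]
  rw [mul_smul_comm, add_assoc, smul_add, ← two_smul ℝ (contract (B v) x), smul_smul]
  norm_num

/-- Induction on products `v₁ ⋯ vₙ`. -/
lemma poly_induction {p : PolyAlg V → Prop} (h1 : p 1) (hs : ∀ (c : ℝ) x, p x → p (c • x))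
    (ha : ∀ x y, p x → p y → p (x + y))
    (hm : ∀ v x, p x → p (SymmetricAlgebra.ι ℝ V v * x)) (x : PolyAlg V) : p x := by
  have h : ∀ y, p y → p (x * y) := by
    induction x using SymmetricAlgebra.induction with
    | algebraMap r => intro y hy; rw [← Algebra.smul_def]; exact hs r y hy
    | ι v => exact hm v
    | mul a b ha' hb' => intro y hy; rw [mul_assoc]; exact ha' _ (hb' _ hy)
    | add a b ha' hb' => intro y hy; rw [add_mul]; exact ha _ _ (ha' _ hy) (hb' _ hy)
  simpa using h 1 h1

lemma contract_comm (ℓ m : V →ₗ[ℝ] ℝ) (x : PolyAlg V) :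
    contract ℓ (contract m x) = contract m (contract ℓ x) := by
  induction x using poly_induction with
  | h1 => simp [contract_one]
  | hs c x hx => simp [hx]
  | ha x y hx hy => simp [hx, hy]
  | hm v x hx => simp only [contract_ι_mul, map_add, map_smul, hx]; abel

lemma contract₂_comm (B : V →ₗ[ℝ] V →ₗ[ℝ] ℝ) (hB : ∀ v w, B v w = B w v) (ℓ : V →ₗ[ℝ] ℝ)
    (x : PolyAlg V) : contract₂ B (contract ℓ x) = contract ℓ (contract₂ B x) := by
  induction x using poly_induction with
  | h1 => simp [contract_one, contract₂_one]
  | hs c x hx => simp [hx]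
  | ha x y hx hy => simp [hx, hy]
  | hm v x hx =>
    simp only [contract_ι_mul, contract₂_ι_mul B hB, map_add, map_smul, hx,
      contract_comm ℓ (B v)]
    abel

/-- `∂_B` is locally nilpotent. -/
lemma contract₂_locally_nilpotent (B : V →ₗ[ℝ] V →ₗ[ℝ] ℝ) (hB : ∀ v w, B v w = B w v)
    (x : PolyAlg V) : ∃ N : ℕ, ∀ k ≥ N, (contract₂ B)^[k] x = 0 := by
  have hadd : ∀ (k : ℕ) (x y : PolyAlg V),
      (contract₂ B)^[k] (x + y) = (contract₂ B)^[k] x + (contract₂ B)^[k] y :=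
    fun k x y => iterate_map_add (contract₂ B) k x y
  have hsmul : ∀ (k : ℕ) (c : ℝ) (x : PolyAlg V),
      (contract₂ B)^[k] (c • x) = c • (contract₂ B)^[k] x := by
    intro k c x
    induction k generalizing x with
    | zero => rfl
    | succ k ih => rw [Function.iterate_succ_apply, map_smul, ih, Function.iterate_succ_apply]
  induction x using poly_induction with
  | h1 =>
    refine ⟨1, fun k hk => ?_⟩
    obtain ⟨j, rfl⟩ := Nat.exists_eq_add_of_le' hk
    rw [Function.iterate_succ_apply, contract₂_one]
    exact iterate_map_zero (contract₂ B) j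
  | hs c x hx =>
    obtain ⟨N, hN⟩ := hx
    refine ⟨N, fun k hk => ?_⟩
    rw [hsmul, hN k hk, smul_zero]
  | ha x y hx hy =>
    obtain ⟨N, hN⟩ := hx
    obtain ⟨M, hM⟩ := hy
    refine ⟨max N M, fun k hk => ?_⟩
    rw [hadd, hN k (le_of_max_le_left hk), hM k (le_of_max_le_right hk), add_zero]
  | hm v x hx =>
    obtain ⟨N, hN⟩ := hx
    have hk : ∀ k : ℕ, (contract₂ B)^[k + 1] (SymmetricAlgebra.ι ℝ V v * x) =
        SymmetricAlgebra.ι ℝ V v * (contract₂ B)^[k + 1] x +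
          ((k : ℝ) + 1) • contract (B v) ((contract₂ B)^[k] x) := by
      intro k
      induction k with
      | zero => simp [contract₂_ι_mul B hB]
      | succ k ih =>
        rw [Function.iterate_succ_apply', ih, map_add, map_smul, contract₂_ι_mul B hB,
          contract₂_comm B hB, ← Function.iterate_succ_apply' (contract₂ B),
          ← Function.iterate_succ_apply' (contract₂ B)]
        push_cast
        module
    refine ⟨N + 1, fun k hkN => ?_⟩
    obtain ⟨j, rfl⟩ := Nat.exists_eq_add_of_le' (Nat.one_le_of_lt hkN)
    rw [hk, hN _ (by omega), hN _ (by omega)]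
    simp

/-- `exp(∂_B) = ∑ₖ ∂_Bᵏ / k!`; for every argument only finitely many terms are nonzero. -/
def expContract₂ (B : V →ₗ[ℝ] V →ₗ[ℝ] ℝ) (x : PolyAlg V) : PolyAlg V :=
  ∑ᶠ k : ℕ, ((k.factorial : ℝ)⁻¹) • (contract₂ B)^[k] x

end SymAlg

/-! ### The disk, test functions and harmonic functions -/

/-- Euclidean space `ℝᵈ`. -/
abbrev Eu (d : ℕ) := EuclideanSpace ℝ (Fin d)

/-- The open unit disk `𝔻 ⊆ ℝᵈ`. -/
def disk (d : ℕ) : TopologicalSpace.Opens (Eu d) := ⟨Metric.ball 0 1, Metric.isOpen_ball⟩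

/-- The centre of the disk. -/
def diskZero (d : ℕ) : disk d := ⟨0, Metric.mem_ball_self one_pos⟩

/-- `C_c^∞(𝔻)`. -/
abbrev Test (d : ℕ) := 𝓓(disk d, ℝ)

/-- The extension by zero to `ℝᵈ` of a function on the disk. All derivatives of functions on the
disk are taken, at points of the disk, through this extension. -/
def zeroExt {d : ℕ} {F : Type*} [Zero F] (u : disk d → F) : Eu d → F :=
  Function.extend Subtype.val u 0

lemma zeroExt_apply {d : ℕ} {F : Type*} [Zero F] (u : disk d → F) (x : disk d) :
    zeroExt u (x : Eu d) = u x :=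
  Subtype.val_injective.extend_apply u 0 x

lemma zeroExt_add {d : ℕ} (u v : disk d → ℝ) : zeroExt (u + v) = zeroExt u + zeroExt v := by
  have h := Function.extend_add (Subtype.val : disk d → Eu d) u v (0 : Eu d → ℝ) 0
  rw [add_zero] at h
  exact h

lemma zeroExt_smul {d : ℕ} (c : ℝ) (u : disk d → ℝ) : zeroExt (c • u) = c • zeroExt u := by
  have h := Function.extend_smul c (Subtype.val : disk d → Eu d) u (0 : Eu d → ℝ)
  rw [smul_zero] at h
  exact h

lemma zeroExt_zero {d : ℕ} : zeroExt (0 : disk d → ℝ) = 0 := by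
  simpa using zeroExt_smul (0 : ℝ) (0 : disk d → ℝ)

/-- The operator `L = -∑ᵢ ∂ᵢ²` on `C_c^∞(𝔻)`: the conformal Laplacian of the flat disk. -/
def testL (d : ℕ) : Test d →ₗ[ℝ] Test d :=
  -∑ i : Fin d,
    (TestFunction.lineDerivCLM ℝ (EuclideanSpace.single i (1 : ℝ))).toLinearMap ∘ₗ
      (TestFunction.lineDerivCLM ℝ (EuclideanSpace.single i (1 : ℝ)) :
        Test d →L[ℝ] Test d).toLinearMap

/-- The partial derivative `∂^α = ∂₁^{α₁} ⋯ ∂_d^{α_d}`. -/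
def multiDeriv {d : ℕ} (α : Fin d → ℕ) (f : Eu d → ℝ) : Eu d → ℝ :=
  (List.finRange d).foldr
    (fun i g => (fun h x => fderiv ℝ h x (EuclideanSpace.single i (1 : ℝ)))^[α i] g) f

/-- The harmonic functions on the disk, as a subspace of all functions on the disk. -/
def harmonicSubmodule (d : ℕ) : Submodule ℝ (disk d → ℝ) where
  carrier := {u | ContDiffOn ℝ ∞ (zeroExt u) (disk d) ∧ ∀ x ∈ disk d, Δ (zeroExt u) x = 0}
  zero_mem' := by
    simp only [Set.mem_ofPred_eq, zeroExt_zero]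
    refine ⟨contDiffOn_const, fun x _ => ?_⟩
    exact congrFun (laplacian_const (E := Eu d) (c := (0 : ℝ))) x
  add_mem' := by
    rintro u v ⟨hu, hu'⟩ ⟨hv, hv'⟩
    simp only [Set.mem_ofPred_eq, zeroExt_add]
    refine ⟨hu.add hv, fun x hx => ?_⟩
    have hn := (disk d).isOpen.mem_nhds hx
    have h2 : (2 : WithTop ℕ∞) ≤ ∞ := 
      WithTop.coe_le_coe.2 (le_top : (2 : ℕ∞) ≤ ⊤)
    rw [((hu.contDiffAt hn).of_le h2).laplacian_add ((hv.contDiffAt hn).of_le h2), hu' x hx,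
      hv' x hx, add_zero]
  smul_mem' := by
    rintro c u ⟨hu, hu'⟩
    simp only [Set.mem_ofPred_eq, zeroExt_smul]
    refine ⟨hu.const_smul c, fun x hx => ?_⟩
    have hn := (disk d).isOpen.mem_nhds hx
    have h2 : (2 : WithTop ℕ∞) ≤ ∞ := 
      WithTop.coe_le_coe.2 (le_top : (2 : ℕ∞) ≤ ⊤)
    rw [laplacian_smul c ((hu.contDiffAt hn).of_le h2), hu' x hx, smul_zero]

/-- `H(𝔻)`, the space of harmonic functions on the disk; its topology is defined below. -/
def Harm (d : ℕ) : Type := harmonicSubmodule d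

instance (d : ℕ) : AddCommGroup (Harm d) := inferInstanceAs (AddCommGroup (harmonicSubmodule d))
instance (d : ℕ) : Module ℝ (Harm d) := inferInstanceAs (Module ℝ (harmonicSubmodule d))
instance (d : ℕ) : CoeFun (Harm d) (fun _ => disk d → ℝ) := ⟨fun u => u.1⟩

lemma multiDeriv_contDiffOn_add_smul {d : ℕ} (α : Fin d → ℕ) (s : Set (Eu d)) (hs : IsOpen s) :
    (∀ f : Eu d → ℝ, ContDiffOn ℝ ∞ f s → ContDiffOn ℝ ∞ (multiDeriv α f) s) ∧
    (∀ f g : Eu d → ℝ, ContDiffOn ℝ ∞ f s → ContDiffOn ℝ ∞ g s → ∀ x ∈ s,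
      multiDeriv α (f + g) x = multiDeriv α f x + multiDeriv α g x) ∧
    (∀ (c : ℝ) (f : Eu d → ℝ), ContDiffOn ℝ ∞ f s → ∀ x ∈ s,
      multiDeriv α (c • f) x = c * multiDeriv α f x) := by
  -- the class of operators which are linear and local on smooth functions
  let P : ((Eu d → ℝ) → (Eu d → ℝ)) → Prop := fun T =>
    (∀ f, ContDiffOn ℝ ∞ f s → ContDiffOn ℝ ∞ (T f) s) ∧
    (∀ f g, ContDiffOn ℝ ∞ f s → ContDiffOn ℝ ∞ g s → Set.EqOn (T (f + g)) (T f + T g) s) ∧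
    (∀ (c : ℝ) f, ContDiffOn ℝ ∞ f s → Set.EqOn (T (c • f)) (c • T f) s) ∧
    (∀ f g, Set.EqOn f g s → Set.EqOn (T f) (T g) s)
  have hid : P id := ⟨fun _ h => h, fun _ _ _ _ _ _ => rfl, fun _ _ _ _ _ => rfl,
    fun _ _ h => h⟩
  have hcomp : ∀ S T, P S → P T → P (S ∘ T) := by
    rintro S T ⟨hS1, hS2, hS3, hS4⟩ ⟨hT1, hT2, hT3, hT4⟩
    refine ⟨fun f hf => hS1 _ (hT1 f hf), fun f g hf hg x hx => ?_, fun c f hf x hx => ?_,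
      fun f g h => hS4 _ _ (hT4 _ _ h)⟩
    · exact (hS4 _ _ (hT2 f g hf hg) hx).trans (hS2 _ _ (hT1 f hf) (hT1 g hg) hx)
    · exact (hS4 _ _ (hT3 c f hf) hx).trans (hS3 c _ (hT1 f hf) hx)
  have hD : ∀ v : Eu d, P (fun h x => fderiv ℝ h x v) := by
    intro v
    have hdiff : ∀ f : Eu d → ℝ, ContDiffOn ℝ ∞ f s → ∀ x ∈ s, DifferentiableAt ℝ f x :=
      fun f hf x hx => (hf.contDiffAt (hs.mem_nhds hx)).differentiableAt (by simp)
    refine ⟨fun f hf => ?_, fun f g hf hg x hx => ?_, fun c f hf x hx => ?_,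
      fun f g h x hx => ?_⟩
    · exact (hf.fderiv_of_isOpen hs (by simp)).clm_apply contDiffOn_const
    · simp [fderiv_add (hdiff f hf x hx) (hdiff g hg x hx)]
    · simp [fderiv_const_smul (hdiff f hf x hx)]
    · have : f =ᶠ[𝓝 x] g := Filter.eventually_of_mem (hs.mem_nhds hx) h
      simp [this.fderiv_eq]
  have hiter : ∀ T (k : ℕ), P T → P (T^[k]) := by
    intro T k hT
    induction k with
    | zero => exact hid
    | succ k ih => rw [Function.iterate_succ]; exact hcomp _ _ ih hT
  have hl : ∀ l : List (Fin d), P (fun f => l.foldr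
      (fun i g => (fun h x => fderiv ℝ h x (EuclideanSpace.single i (1 : ℝ)))^[α i] g) f) := by
    intro l
    induction l with
    | nil => exact hid
    | cons i l ih => exact hcomp _ _ (hiter _ (α i) (hD _)) ih
  obtain ⟨h1, h2, h3, -⟩ := hl (List.finRange d)
  exact ⟨h1, fun f g hf hg x hx => h2 f g hf hg hx, fun c f hf x hx => h3 c f hf hx⟩

/-- The map `u ↦ (∂^α u)|_K` from harmonic functions to continuous functions on a compact set. -/
def restrictDeriv {d : ℕ} (K : TopologicalSpace.Compacts (disk d)) (α : Fin d → ℕ) :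
    Harm d →ₗ[ℝ] C(K, ℝ) where
  toFun u := ⟨fun x => multiDeriv α (zeroExt u) (x : disk d),
    ((multiDeriv_contDiffOn_add_smul α (disk d) (disk d).isOpen).1 _
      u.2.1).continuousOn.comp_continuous (by fun_prop) (fun x => (x : disk d).2)⟩
  map_add' u v := by
    ext x
    have h := (multiDeriv_contDiffOn_add_smul α (disk d) (disk d).isOpen).2.1 _ _ u.2.1 v.2.1 _
      (x : disk d).2
    rw [← zeroExt_add] at h
    exact h
  map_smul' c u := by
    ext x
    have h := (multiDeriv_contDiffOn_add_smul α (disk d) (disk d).isOpen).2.2 c _ u.2.1 _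
      (x : disk d).2
    rw [← zeroExt_smul] at h
    exact h

/-- The seminorms `u ↦ sup_{x ∈ K} |∂^α u(x)|`, for `K ⊆ 𝔻` compact and `α ∈ ℕᵈ`. -/
def harmSeminorm (d : ℕ) :
    SeminormFamily ℝ (Harm d) (TopologicalSpace.Compacts (disk d) × (Fin d → ℕ)) :=
  fun p => (normSeminorm ℝ C(p.1, ℝ)).comp (restrictDeriv p.1 p.2)

/-- The topology of locally uniform convergence of all derivatives. -/
instance (d : ℕ) : TopologicalSpace (Harm d) := (harmSeminorm d).moduleFilterBasis.topology

lemma harm_withSeminorms (d : ℕ) : WithSeminorms (harmSeminorm d) := ⟨rfl⟩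

/-- `H'(𝔻)`, the topological dual of `H(𝔻)`. -/
abbrev HDual (d : ℕ) := Harm d →L[ℝ] ℝ

/-- The linear functional `u ↦ (-1)^{|α|} (∂^α u)(a)`. -/
def diracDerivLin {d : ℕ} (α : Fin d → ℕ) (a : disk d) : Harm d →ₗ[ℝ] ℝ where
  toFun u := (-1) ^ (∑ i, α i) * multiDeriv α (zeroExt u) a
  map_add' u v := by
    have h := congrArg (fun f => f ⟨a, rfl⟩)
      ((restrictDeriv ⟨{a}, isCompact_singleton⟩ α).map_add u v)
    change multiDeriv α (zeroExt (u + v).1) a = multiDeriv α (zeroExt u) a +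
      multiDeriv α (zeroExt v) a at h
    rw [h, mul_add]
  map_smul' c u := by
    have h := congrArg (fun f => f ⟨a, rfl⟩)
      ((restrictDeriv ⟨{a}, isCompact_singleton⟩ α).map_smul c u)
    change multiDeriv α (zeroExt (c • u).1) a = c * multiDeriv α (zeroExt u) a at h
    rw [h, RingHom.id_apply, smul_eq_mul, mul_left_comm]

lemma continuous_diracDerivLin {d : ℕ} (α : Fin d → ℕ) (a : disk d) :
    Continuous (diracDerivLin α a) := by
  refine (harm_withSeminorms d).continuous_normedSpace_rng ℝ (diracDerivLin α a)
    ⟨{(⟨{a}, isCompact_singleton⟩, α)}, 1, fun u => ?_⟩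
  rw [Finset.sup_singleton, one_smul]
  have h := (restrictDeriv (⟨{a}, isCompact_singleton⟩ : TopologicalSpace.Compacts (disk d)) α
    u).norm_coe_le_norm ⟨a, rfl⟩
  change ‖multiDeriv α (zeroExt u) a‖ ≤ _ at h
  change ‖(-1) ^ (∑ i, α i) * multiDeriv α (zeroExt u) a‖ ≤ _
  rw [norm_mul, norm_pow, norm_neg, norm_one, one_pow, one_mul]
  exact h

/-- The harmonic distribution `∂^α δ_a : u ↦ (-1)^{|α|} (∂^α u)(a)`. -/
def diracDeriv {d : ℕ} (α : Fin d → ℕ) (a : disk d) : HDual d :=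
  ⟨diracDerivLin α a, continuous_diracDerivLin α a⟩

/-- The point evaluation `δ_a : u ↦ u(a)`. -/
def dirac {d : ℕ} (a : disk d) : HDual d := diracDeriv 0 a

lemma dirac_apply {d : ℕ} (a : disk d) (u : Harm d) : dirac a u = u a := by
  change (-1) ^ (∑ i : Fin d, 0) * multiDeriv 0 (zeroExt u) a = u a
  have h : ∀ (l : List (Fin d)) (f : Eu d → ℝ), l.foldr
      (fun i g => (fun h x => fderiv ℝ h x (EuclideanSpace.single i (1 : ℝ)))^[0] g) f = f := by
    intro l f
    induction l with
    | nil => rfl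
    | cons i l ih => simp
  rw [Finset.sum_const_zero, pow_zero, one_mul]
  exact (congrFun (h _ _) _).trans (zeroExt_apply _ _)

/-! ### Conformal open embeddings of the disk -/

/-- The orientation-preserving conformal open embeddings `φ : 𝔻 → 𝔻`, that is, the smooth open
embeddings with `φ^* g = Ω² g` for a smooth `Ω > 0`, where `g` is the flat metric. -/
structure ConfEmb (d : ℕ) where
  toFun : disk d → disk d
  isOpenEmbedding : IsOpenEmbedding toFun
  smooth : ContDiffOn ℝ ∞ (zeroExt fun x => (toFun x : Eu d)) (disk d)
  conformal : ∃ Ω : disk d → ℝ, ContDiffOn ℝ ∞ (zeroExt Ω) (disk d) ∧ (∀ x, 0 < Ω x) ∧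
    ∀ (x : disk d) (v w : Eu d),
      inner ℝ (fderiv ℝ (zeroExt fun x => (toFun x : Eu d)) x v)
        (fderiv ℝ (zeroExt fun x => (toFun x : Eu d)) x w) = Ω x ^ 2 * inner ℝ v w
  orientation : ∀ x : disk d, 0 < (fderiv ℝ (zeroExt fun x => (toFun x : Eu d)) x).det

instance (d : ℕ) : CoeFun (ConfEmb d) (fun _ => disk d → disk d) := ⟨ConfEmb.toFun⟩

namespace ConfEmb

variable {d : ℕ}

lemma toFun_injective : Function.Injective (ConfEmb.toFun (d := d)) := by
  rintro ⟨f, _, _, _, _⟩ ⟨g, _, _, _, _⟩ h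
  congr

/-- The map `φ`, extended by zero to `ℝᵈ`. -/
def ext (φ : ConfEmb d) : Eu d → Eu d := zeroExt fun x => (φ x : Eu d)

/-- The conformal factor `Ω_φ`. -/
def factor (φ : ConfEmb d) : disk d → ℝ := φ.conformal.choose

lemma factor_smooth (φ : ConfEmb d) : ContDiffOn ℝ ∞ (zeroExt φ.factor) (disk d) :=
  φ.conformal.choose_spec.1

lemma factor_pos (φ : ConfEmb d) (x : disk d) : 0 < φ.factor x :=
  φ.conformal.choose_spec.2.1 x

lemma inner_fderiv (φ : ConfEmb d) (x : disk d) (v w : Eu d) :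
    inner ℝ (fderiv ℝ φ.ext x v) (fderiv ℝ φ.ext x w) = φ.factor x ^ 2 * inner ℝ v w :=
  φ.conformal.choose_spec.2.2 x v w

/-- For `d ≥ 1` the conformal factor is determined by the map. -/
lemma factor_unique (hd : 1 ≤ d) (φ : ConfEmb d) (x : disk d) (c : ℝ) (hc : 0 < c)
    (h : ∀ v w : Eu d, inner ℝ (fderiv ℝ φ.ext x v) (fderiv ℝ φ.ext x w) = c ^ 2 * inner ℝ v w) :
    c = φ.factor x := by
  have h1 := h (EuclideanSpace.single ⟨0, hd⟩ 1) (EuclideanSpace.single ⟨0, hd⟩ 1)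
  rw [φ.inner_fderiv] at h1
  have h2 : φ.factor x ^ 2 = c ^ 2 := by simpa using h1
  exact ((pow_left_inj₀ (φ.factor_pos x).le hc.le two_ne_zero).1 h2).symm

lemma ext_apply (φ : ConfEmb d) (x : disk d) : φ.ext (x : Eu d) = φ x := zeroExt_apply _ x

lemma contDiffAt_ext (φ : ConfEmb d) (x : disk d) : ContDiffAt ℝ ∞ φ.ext x :=
  φ.smooth.contDiffAt ((disk d).isOpen.mem_nhds x.2)

lemma differentiableAt_ext (φ : ConfEmb d) (x : disk d) : DifferentiableAt ℝ φ.ext x :=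
  (φ.contDiffAt_ext x).differentiableAt (by simp)

lemma coe_injective (φ : ConfEmb d) : Function.Injective fun x => (φ x : Eu d) :=
  Subtype.val_injective.comp φ.isOpenEmbedding.injective

/-- The identity embedding. -/
def id (d : ℕ) : ConfEmb d where
  toFun := fun x => x
  isOpenEmbedding := IsOpenEmbedding.id
  smooth := contDiffOn_id.congr fun x hx => zeroExt_apply _ (⟨x, hx⟩ : disk d)
  conformal := by
    refine ⟨fun _ => 1, contDiffOn_const.congr fun x hx => zeroExt_apply _ (⟨x, hx⟩ : disk d),
      fun _ => one_pos, fun x v w => ?_⟩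
    have h : (zeroExt fun x : disk d => (x : Eu d)) =ᶠ[𝓝 (x : Eu d)] _root_.id :=
      Filter.eventually_of_mem ((disk d).isOpen.mem_nhds x.2)
        fun y hy => zeroExt_apply _ (⟨y, hy⟩ : disk d)
    rw [h.fderiv_eq]
    simp
  orientation x := by
    have h : (zeroExt fun x : disk d => (x : Eu d)) =ᶠ[𝓝 (x : Eu d)] _root_.id :=
      Filter.eventually_of_mem ((disk d).isOpen.mem_nhds x.2)
        fun y hy => zeroExt_apply _ (⟨y, hy⟩ : disk d)
    rw [h.fderiv_eq, fderiv_id]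
    simp [ContinuousLinearMap.det]

lemma ext_comp_eventuallyEq (φ ψ : ConfEmb d) (x : disk d) :
    (zeroExt fun x => (φ (ψ x) : Eu d)) =ᶠ[𝓝 (x : Eu d)] φ.ext ∘ ψ.ext :=
  Filter.eventually_of_mem ((disk d).isOpen.mem_nhds x.2) fun y hy => by
    have h := zeroExt_apply (fun x => (φ (ψ x) : Eu d)) (⟨y, hy⟩ : disk d)
    have h2 := ψ.ext_apply ⟨y, hy⟩
    change zeroExt _ y = φ.ext (ψ.ext y)
    change ψ.ext y = _ at h2
    rw [h2, ext_apply]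
    exact h

lemma fderiv_comp_ext (φ ψ : ConfEmb d) (x : disk d) :
    fderiv ℝ (zeroExt fun x => (φ (ψ x) : Eu d)) x =
      (fderiv ℝ φ.ext (ψ x : Eu d)).comp (fderiv ℝ ψ.ext x) := by
  rw [(ext_comp_eventuallyEq φ ψ x).fderiv_eq, fderiv_comp, ext_apply]
  · rw [ext_apply]; exact φ.differentiableAt_ext _
  · exact ψ.differentiableAt_ext _

/-- The composite `φ ∘ ψ`. -/
def comp (φ ψ : ConfEmb d) : ConfEmb d where
  toFun := fun x => φ (ψ x)
  isOpenEmbedding := φ.isOpenEmbedding.comp ψ.isOpenEmbedding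
  smooth := fun x hx => by
    have h2 : ContDiffAt ℝ ∞ φ.ext (ψ.ext (⟨x, hx⟩ : disk d)) := by
      rw [ext_apply]; exact φ.contDiffAt_ext _
    have h := (h2.comp _ (ψ.contDiffAt_ext ⟨x, hx⟩)).congr_of_eventuallyEq
      (ext_comp_eventuallyEq φ ψ ⟨x, hx⟩)
    exact h.contDiffWithinAt
  conformal := by
    refine ⟨fun x => φ.factor (ψ x) * ψ.factor x, fun x hx => ?_,
      fun x => mul_pos (φ.factor_pos _) (ψ.factor_pos _), fun x v w => ?_⟩
    · have h1 : ContDiffAt ℝ ∞ (zeroExt φ.factor) (ψ.ext (⟨x, hx⟩ : disk d)) := by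
        rw [ext_apply]
        exact φ.factor_smooth.contDiffAt ((disk d).isOpen.mem_nhds (ψ _).2)
      have h2 : ContDiffAt ℝ ∞ (fun y => zeroExt φ.factor (ψ.ext y) * zeroExt ψ.factor y) x :=
        (h1.comp x (ψ.contDiffAt_ext ⟨x, hx⟩)).mul
          (ψ.factor_smooth.contDiffAt ((disk d).isOpen.mem_nhds hx))
      refine (h2.congr_of_eventuallyEq ?_).contDiffWithinAt
      refine Filter.eventually_of_mem ((disk d).isOpen.mem_nhds hx) fun y hy => ?_
      have e1 := zeroExt_apply (fun x => φ.factor (ψ x) * ψ.factor x) (⟨y, hy⟩ : disk d)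
      have e2 := ψ.ext_apply ⟨y, hy⟩
      have e3 := zeroExt_apply ψ.factor (⟨y, hy⟩ : disk d)
      dsimp only at e1 e2 e3 ⊢
      rw [e1, e2, e3, zeroExt_apply]
    · rw [fderiv_comp_ext, ContinuousLinearMap.comp_apply, ContinuousLinearMap.comp_apply,
        φ.inner_fderiv, ψ.inner_fderiv]
      ring
  orientation x := by
    rw [fderiv_comp_ext]
    have h := mul_pos (φ.orientation (ψ x)) (ψ.orientation x)
    change 0 < LinearMap.det ((fderiv ℝ φ.ext (ψ x : Eu d)).comp (fderiv ℝ ψ.ext x)).toLinearMap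
    rw [ContinuousLinearMap.toLinearMap_comp, LinearMap.det_comp]
    exact h

/-- The function `W_φ f`, equal to `Ω_φ(φ⁻¹ y)^{-(d+2)/2} f(φ⁻¹ y)` at points `y` of `φ(𝔻)` and
equal to zero elsewhere. -/
def pushFun (φ : ConfEmb d) (f : Eu d → ℝ) : Eu d → ℝ :=
  Function.extend (fun x => (φ x : Eu d))
    (fun x => φ.factor x ^ (-(((d : ℝ) + 2) / 2)) * f x) 0

lemma pushFun_apply (φ : ConfEmb d) (f : Eu d → ℝ) (x : disk d) :
    φ.pushFun f (φ x : Eu d) = φ.factor x ^ (-(((d : ℝ) + 2) / 2)) * f x :=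
  φ.coe_injective.extend_apply _ _ x

lemma contDiffAt_pushFun (φ : ConfEmb d) (f : Eu d → ℝ) (hf : ContDiff ℝ ∞ f) (x : disk d) :
    ContDiffAt ℝ ∞ (φ.pushFun f) (φ x : Eu d) := by
  have hinj : Function.Injective (fderiv ℝ φ.ext x : Eu d →ₗ[ℝ] Eu d) := by
    rw [injective_iff_map_eq_zero]
    intro v hv
    have h := φ.inner_fderiv x v v
    change fderiv ℝ φ.ext x v = 0 at hv
    rw [hv, inner_zero_left, zero_eq_mul] at h
    rcases h with h | h
    · exact absurd h (pow_ne_zero 2 (φ.factor_pos x).ne')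
    · exact inner_self_eq_zero.1 h
  let e : Eu d ≃L[ℝ] Eu d :=
    (LinearEquiv.ofInjectiveEndo (fderiv ℝ φ.ext x : Eu d →ₗ[ℝ] Eu d)
      hinj).toContinuousLinearEquiv
  have he : HasFDerivAt φ.ext (e : Eu d →L[ℝ] Eu d) x := by
    have h : (e : Eu d →L[ℝ] Eu d) = fderiv ℝ φ.ext x := by
      ext1 v
      rfl
    rw [h]
    exact (φ.differentiableAt_ext x).hasFDerivAt
  have hn : (∞ : WithTop ℕ∞) ≠ 0 := by simp
  let P := (φ.contDiffAt_ext x).toOpenPartialHomeomorph φ.ext he hn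
  have hPx : (x : Eu d) ∈ P.source :=
    (φ.contDiffAt_ext x).mem_toOpenPartialHomeomorph_source he hn
  have hPc : ∀ y, P y = φ.ext y := fun y => rfl
  have htarget : (φ x : Eu d) ∈ P.target := by
    rw [← ext_apply, ← hPc]; exact P.map_source hPx
  have hsymm : P.symm (φ x : Eu d) = x := by
    rw [← ext_apply, ← hPc]; exact P.left_inv hPx
  have hsm : ContDiffAt ℝ ∞ P.symm (φ x : Eu d) := by
    have := (φ.contDiffAt_ext x).to_localInverse he hn
    rw [ext_apply] at this
    exact this
  have h1 : ContDiffAt ℝ ∞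
      (fun z => zeroExt φ.factor z ^ (-(((d : ℝ) + 2) / 2)) * f z) (P.symm (φ x : Eu d)) := by
    rw [hsymm]
    refine ((φ.factor_smooth.contDiffAt ((disk d).isOpen.mem_nhds x.2)).rpow_const_of_ne ?_).mul
      hf.contDiffAt
    rw [zeroExt_apply]
    exact (φ.factor_pos x).ne'
  refine (h1.comp _ hsm).congr_of_eventuallyEq ?_
  have hc : P.symm ⁻¹' (disk d : Set (Eu d)) ∈ 𝓝 (φ x : Eu d) := by
    apply hsm.continuousAt
    rw [hsymm]
    exact (disk d).isOpen.mem_nhds x.2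
  filter_upwards [hc, P.open_target.mem_nhds htarget] with y hy hyt
  have h2 : (φ ⟨P.symm y, hy⟩ : Eu d) = y := by
    rw [← ext_apply, ← hPc]; exact P.right_inv hyt
  conv_lhs => rw [← h2]
  rw [pushFun_apply, Function.comp_apply]
  have h3 := zeroExt_apply φ.factor ⟨P.symm y, hy⟩
  dsimp only at h3
  rw [h3]

lemma exists_compact_pushFun (φ : ConfEmb d) (f : Test d) :
    ∃ K : Set (Eu d), IsCompact K ∧ K ⊆ Set.range (fun x => (φ x : Eu d)) ∧
      ∀ y ∉ K, φ.pushFun f y = 0 := by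
  refine ⟨(fun x => (φ x : Eu d)) '' (Subtype.val ⁻¹' tsupport f), ?_, Set.image_subset_range _ _,
    fun y hy => ?_⟩
  · refine IsCompact.image ?_ (continuous_subtype_val.comp φ.isOpenEmbedding.continuous)
    rw [Topology.IsEmbedding.subtypeVal.isCompact_iff, Set.image_preimage_eq_of_subset]
    · exact f.hasCompactSupport
    · rw [Subtype.range_coe_subtype]; exact f.tsupport_subset
  · by_cases h : ∃ x, (φ x : Eu d) = y
    · obtain ⟨x, rfl⟩ := h
      rw [pushFun_apply]
      have : f x = 0 := by
        by_contra hfx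
        exact hy ⟨x, subset_tsupport _ hfx, rfl⟩
      rw [this, mul_zero]
    · exact Function.extend_apply' _ _ _ h

/-- The linear map `W_φ : C_c^∞(𝔻) → C_c^∞(𝔻)`. -/
def push (φ : ConfEmb d) : Test d →ₗ[ℝ] Test d where
  toFun f :=
    { toFun := φ.pushFun f
      contDiff' := by
        obtain ⟨K, hK, hKr, hK0⟩ := φ.exists_compact_pushFun f
        refine contDiff_iff_contDiffAt.2 fun y => ?_
        by_cases hy : y ∈ K
        · obtain ⟨x, rfl⟩ := hKr hy
          exact φ.contDiffAt_pushFun f f.contDiff x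
        · have h : φ.pushFun f =ᶠ[𝓝 y] fun _ => 0 :=
            Filter.eventually_of_mem (hK.isClosed.isOpen_compl.mem_nhds hy) fun z hz => hK0 z hz
          exact contDiffAt_const.congr_of_eventuallyEq h
      hasCompactSupport' := by
        obtain ⟨K, hK, -, hK0⟩ := φ.exists_compact_pushFun f
        exact HasCompactSupport.intro hK hK0
      tsupport_subset' := by
        obtain ⟨K, hK, hKr, hK0⟩ := φ.exists_compact_pushFun f
        have h1 : tsupport (φ.pushFun f) ⊆ K :=
          closure_minimal (fun y hy => by_contra fun h => hy (hK0 y h)) hK.isClosed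
        refine h1.trans (hKr.trans ?_)
        rintro _ ⟨x, rfl⟩
        exact (φ x).2 }
  map_add' f g := by
    ext y
    change φ.pushFun (f + g : Test d) y = φ.pushFun f y + φ.pushFun g y
    by_cases h : ∃ x, (φ x : Eu d) = y
    · obtain ⟨x, rfl⟩ := h
      simp only [pushFun_apply]
      exact mul_add _ _ _
    · simp only [pushFun, Function.extend_apply' _ _ _ h, Pi.zero_apply, add_zero]
  map_smul' c f := by
    ext y
    change φ.pushFun (c • f : Test d) y = c * φ.pushFun f y
    by_cases h : ∃ x, (φ x : Eu d) = y
    · obtain ⟨x, rfl⟩ := h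
      simp only [pushFun_apply]
      exact mul_left_comm _ _ _
    · simp only [pushFun, Function.extend_apply' _ _ _ h, Pi.zero_apply, mul_zero]

end ConfEmb

/-! ### The Green function -/

/-- The volume `ω_d` of the unit sphere `S^{d-1} ⊆ ℝᵈ`. -/
def sphereVol (d : ℕ) : ℝ := (volume : Measure (Eu d)).toSphere.real Set.univ

/-- The Green function `G_d(x, y) = 1 / ((d - 2) ω_d ‖x - y‖^{d-2})`, for `d ≥ 3`. -/
def green (d : ℕ) (x y : Eu d) : ℝ :=
  1 / (((d : ℝ) - 2) * sphereVol d * ‖x - y‖ ^ (d - 2))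

lemma integrableOn_inv_norm_pow {d : ℕ} (hd : 3 ≤ d) :
    IntegrableOn (fun z : Eu d => (‖z‖ ^ (d - 2))⁻¹) (Metric.ball 0 2) := by
  have : Nonempty (Fin d) := ⟨⟨0, by omega⟩⟩
  have h := integrableOn_fun_norm_addHaar (volume : Measure (Eu d))
    (f := fun t : ℝ => (t ^ (d - 2))⁻¹) (r := 2)
  rw [h]
  have h2 : IntegrableOn (fun y : ℝ => y) (Set.Ioo 0 2) :=
    (continuous_id.integrableOn_Icc (a := 0) (b := 2)).mono_set Set.Ioo_subset_Icc_self
  refine h2.congr_fun (fun y hy => ?_) measurableSet_Ioo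
  have hy0 : y ≠ 0 := hy.1.ne'
  simp only [finrank_euclideanSpace, Fintype.card_fin, smul_eq_mul]
  obtain ⟨k, rfl⟩ := Nat.exists_eq_add_of_le hd
  have e1 : 3 + k - 1 = (k + 1) + 1 := by omega
  have e2 : 3 + k - 2 = k + 1 := by omega
  rw [e1, e2, pow_succ]
  field_simp

lemma integrableOn_green (d : ℕ) :
    IntegrableOn (fun p : Eu d × Eu d => green d p.1 p.2)
      ((disk d : Set (Eu d)) ×ˢ (disk d : Set (Eu d))) := by
  have hfin : volume (disk d : Set (Eu d)) < ⊤ := measure_ball_lt_top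
  by_cases hd : 3 ≤ d
  · have hg : Integrable ((Metric.ball (0 : Eu d) 2).indicator
        fun z : Eu d => (‖z‖ ^ (d - 2))⁻¹) :=
      (integrable_indicator_iff measurableSet_ball).2 (integrableOn_inv_norm_pow hd)
    have hf : Integrable ((disk d : Set (Eu d)).indicator fun _ : Eu d => (1 : ℝ)) :=
      (integrable_indicator_iff (disk d).isOpen.measurableSet).2 (integrableOn_const hfin.ne)
    have hc := (hf.convolution_integrand (ContinuousLinearMap.mul ℝ ℝ) hg).integrableOn
      (s := (disk d : Set (Eu d)) ×ˢ (disk d : Set (Eu d)))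
    have hc2 := hc.const_mul ((((d : ℝ) - 2) * sphereVol d)⁻¹)
    refine IntegrableOn.congr_fun hc2 (fun p hp => ?_)
      ((disk d).isOpen.measurableSet.prod (disk d).isOpen.measurableSet)
    have h1 : p.2 ∈ (disk d : Set (Eu d)) := hp.2
    have h2 : p.1 - p.2 ∈ Metric.ball (0 : Eu d) 2 := by
      have a1 : ‖p.1‖ < 1 := mem_ball_zero_iff.1 hp.1
      have a2 : ‖p.2‖ < 1 := mem_ball_zero_iff.1 hp.2
      rw [mem_ball_zero_iff]
      linarith [norm_sub_le p.1 p.2]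
    simp only [ContinuousLinearMap.mul_apply', Set.indicator_of_mem h1, Set.indicator_of_mem h2,
      green]
    rw [one_mul, one_div, mul_inv _ (‖p.1 - p.2‖ ^ (d - 2))]
  · have h0 : d - 2 = 0 := by omega
    simp only [green, h0, pow_zero]
    refine integrableOn_const ?_
    rw [Measure.volume_eq_prod, Measure.prod_prod]
    exact (ENNReal.mul_lt_top hfin hfin).ne

lemma integrableOn_green_mul {d : ℕ} (f g : Test d) :
    IntegrableOn (fun p : Eu d × Eu d => green d p.1 p.2 * f p.1 * g p.2)
      ((disk d : Set (Eu d)) ×ˢ (disk d : Set (Eu d))) := by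
  obtain ⟨A, hA⟩ := f.continuous.bounded_above_of_compact_support f.hasCompactSupport
  obtain ⟨B, hB⟩ := g.continuous.bounded_above_of_compact_support g.hasCompactSupport
  have h1 : Integrable (fun p : Eu d × Eu d => green d p.1 p.2 * f p.1) (volume.restrict _) :=
    (integrableOn_green d).mul_bdd (c := A)
      (f.continuous.comp continuous_fst).aestronglyMeasurable (.of_forall fun p => hA _)
  exact h1.mul_bdd (c := B) (g.continuous.comp continuous_snd).aestronglyMeasurable
    (.of_forall fun p => hB _)

/-- The symmetric bilinear form
`∂_{G_d}(f, g) = ∫_{𝔻 × 𝔻} G_d(x, y) f(x) g(y) dx dy` on `C_c^∞(𝔻)`. -/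
def greenForm (d : ℕ) : Test d →ₗ[ℝ] Test d →ₗ[ℝ] ℝ :=
  LinearMap.mk₂ ℝ
    (fun f g => ∫ p in (disk d : Set (Eu d)) ×ˢ (disk d : Set (Eu d)),
      green d p.1 p.2 * f p.1 * g p.2)
    (fun f f' g => by
      rw [← integral_add (integrableOn_green_mul f g) (integrableOn_green_mul f' g)]
      refine integral_congr_ae (.of_forall fun p => ?_)
      change _ * (f p.1 + f' p.1) * _ = _
      ring)
    (fun c f g => by
      rw [smul_eq_mul, ← integral_const_mul]
      refine integral_congr_ae (.of_forall fun p => ?_)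
      change _ * (c * f p.1) * _ = _
      ring)
    (fun f g g' => by
      rw [← integral_add (integrableOn_green_mul f g) (integrableOn_green_mul f g')]
      refine integral_congr_ae (.of_forall fun p => ?_)
      change _ * (g p.2 + g' p.2) = _
      ring)
    (fun c f g => by
      rw [smul_eq_mul, ← integral_const_mul]
      refine integral_congr_ae (.of_forall fun p => ?_)
      change _ * (c * g p.2) = _
      ring)

lemma integrable_test_mul {d : ℕ} (f g : Test d) : Integrable fun x => f x * g x :=
  (f.continuous.mul g.continuous).integrable_of_hasCompactSupport f.hasCompactSupport.mul_right

/-- The pairing `(f, h) ↦ ∫_𝔻 f h` on `C_c^∞(𝔻)`. -/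
def testPairing (d : ℕ) : Test d →ₗ[ℝ] Test d →ₗ[ℝ] ℝ :=
  LinearMap.mk₂ ℝ (fun h f => ∫ x in (disk d : Set (Eu d)), f x * h x)
    (fun h h' f => by
      rw [← integral_add (integrable_test_mul f h).integrableOn
        (integrable_test_mul f h').integrableOn]
      refine integral_congr_ae (.of_forall fun p => ?_)
      change _ * (h p + h' p) = _
      ring)
    (fun c h f => by
      rw [smul_eq_mul, ← integral_const_mul]
      refine integral_congr_ae (.of_forall fun p => ?_)
      change _ * (c * h p) = _
      ring)
    (fun h f f' => by
      rw [← integral_add (integrable_test_mul f h).integrableOn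
        (integrable_test_mul f' h).integrableOn]
      refine integral_congr_ae (.of_forall fun p => ?_)
      change (f p + f' p) * _ = _
      ring)
    (fun c h f => by
      rw [smul_eq_mul, ← integral_const_mul]
      refine integral_congr_ae (.of_forall fun p => ?_)
      change c * f p * _ = _
      ring)

/-! ### Observables -/

/-- The operator `Δ^BV : P(C_c^∞(𝔻)) ⊗ C_c^∞(𝔻) → P(C_c^∞(𝔻))`,
`f₁ ⋯ fₙ ⊗ h ↦ - f₁ ⋯ fₙ · L h + ∑ᵢ (∫ fᵢ h) f₁ ⋯ f̂ᵢ ⋯ fₙ`. -/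
def bv (d : ℕ) : PolyAlg (Test d) ⊗[ℝ] Test d →ₗ[ℝ] PolyAlg (Test d) :=
  TensorProduct.lift
    (-(LinearMap.mul ℝ (PolyAlg (Test d))).compl₂ (SymmetricAlgebra.ι ℝ (Test d) ∘ₗ testL d) +
      (contract ∘ₗ testPairing d).flip)

lemma bv_tmul (d : ℕ) (F : PolyAlg (Test d)) (h : Test d) :
    bv d (F ⊗ₜ h) =
      -(F * SymmetricAlgebra.ι ℝ (Test d) (testL d h)) + contract (testPairing d h) F := rfl

/-- The quantum observables `F_CL(𝔻) = cok Δ^BV`. -/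
abbrev FCL (d : ℕ) := PolyAlg (Test d) ⧸ LinearMap.range (bv d)

/-- The cokernel `S^cl(𝔻) = C_c^∞(𝔻) / L C_c^∞(𝔻)`. -/
abbrev Scl (d : ℕ) := Test d ⧸ LinearMap.range (testL d)

/-! ### The operad of conformal disk embeddings and its algebras -/

/-- The set `CE_d^emb(n)` of conformal open embeddings `𝔻 ⊔ ⋯ ⊔ 𝔻 → 𝔻` of `n` disks, given by
their restrictions to the `n` components: these are `n` conformal open embeddings of the disk with
pairwise disjoint images. -/
structure CEemb (d n : ℕ) where
  emb : Fin n → ConfEmb d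
  disjoint : Pairwise fun i j => Disjoint (Set.range (emb i)) (Set.range (emb j))

instance (d n : ℕ) : CoeFun (CEemb d n) (fun _ => Fin n → ConfEmb d) := ⟨CEemb.emb⟩

namespace CEemb

variable {d n m : ℕ}

/-- The operadic unit `id_𝔻`. -/
def unit (d : ℕ) : CEemb d 1 where
  emb := fun _ => ConfEmb.id d
  disjoint := fun i j h => absurd (Subsingleton.elim i j) h

/-- The permutation of the disks. -/
def perm (φ : CEemb d n) (σ : Equiv.Perm (Fin n)) : CEemb d n where
  emb := fun i => φ (σ i)
  disjoint := fun _ _ h => φ.disjoint (σ.injective.ne h)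

/-- The composition
`φ ∘ᵢ ψ = (φ₁, …, φᵢ₋₁, φᵢ ∘ ψ₁, …, φᵢ ∘ ψₘ, φᵢ₊₁, …, φₙ₊₁)`. -/
def comp (φ : CEemb d (n + 1)) (i : Fin (n + 1)) (ψ : CEemb d m) : CEemb d (n + m) where
  emb := fun k =>
    if h₁ : k.1 < i.1 then φ ⟨k.1, by omega⟩
    else if h₂ : k.1 < i.1 + m then (φ i).comp (ψ ⟨k.1 - i.1, by omega⟩)
    else φ ⟨k.1 + 1 - m, by omega⟩
  disjoint := by
    have hsub : ∀ l, Set.range ((φ i).comp (ψ l)) ⊆ Set.range (φ i) := by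
      rintro l _ ⟨x, rfl⟩
      exact ⟨_, rfl⟩
    have hin : ∀ l l', l ≠ l' → Disjoint (Set.range ((φ i).comp (ψ l)))
        (Set.range ((φ i).comp (ψ l'))) := by
      intro l l' h
      rw [Set.disjoint_left]
      rintro _ ⟨x, rfl⟩ ⟨y, hy⟩
      have := (φ i).isOpenEmbedding.injective hy
      exact Set.disjoint_left.1 (ψ.disjoint h) ⟨x, rfl⟩ ⟨y, this⟩
    intro k k' hk
    have hkk : k.1 ≠ k'.1 := fun h => hk (Fin.ext h)
    have hne : ∀ a b : Fin (n + 1), a.1 ≠ b.1 →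
        Disjoint (Set.range (φ a)) (Set.range (φ b)) :=
      fun a b h => φ.disjoint (fun e => h (congrArg Fin.val e))
    split_ifs with h1 h2 h3 h4 h5 h6 h7 h8
    all_goals first
      | exact hne _ _ (by dsimp only; omega)
      | exact (hne _ _ (by dsimp only; omega)).mono_right (hsub _)
      | exact (hne _ _ (by dsimp only; omega)).mono_left (hsub _)
      | exact hin _ _ (fun e => by have := congrArg Fin.val e; dsimp only at this; omega)

end CEemb

/-- The structure of a `CE_d^emb`-algebra on a vector space `A`: the laws for a family of maps
`ρₙ : CE_d^emb(n) → Hom(A^{⊗ n}, A)` to be a homomorphism to the endomorphism operad. -/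
structure IsCEAlgebra {d : ℕ} {A : Type*} [AddCommGroup A] [Module ℝ A]
    (ρ : ∀ n, CEemb d n → MultilinearMap ℝ (fun _ : Fin n => A) A) : Prop where
  unit : ∀ x, ρ 1 (CEemb.unit d) ![x] = x
  comp : ∀ (n m : ℕ) (φ : CEemb d (n + 1)) (i : Fin (n + 1)) (ψ : CEemb d m)
    (x : Fin (n + m) → A),
    ρ (n + m) (φ.comp i ψ) x = ρ (n + 1) φ fun j =>
      if h₁ : j.1 < i.1 then x ⟨j.1, by omega⟩
      else if h₂ : j.1 = i.1 then ρ m ψ fun l => x ⟨i.1 + l.1, by omega⟩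
      else x ⟨j.1 + m - 1, by omega⟩
  equivariant : ∀ (n : ℕ) (φ : CEemb d n) (σ : Equiv.Perm (Fin n)) (x : Fin n → A),
    ρ n (φ.perm σ) (fun i => x (σ i)) = ρ n φ x

/-- `m` is the family of operations `F_CL(φ) : F_CL(𝔻)^{⊗ n} → F_CL(𝔻)`,
`[F₁] ⊗ ⋯ ⊗ [Fₙ] ↦ [W_{φ₁}(F₁) ⋯ W_{φₙ}(Fₙ)]`. (This formula determines `m`.) -/
def IsFactorizationProduct {d : ℕ}
    (m : ∀ n, CEemb d n → MultilinearMap ℝ (fun _ : Fin n => FCL d) (FCL d)) : Prop :=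
  ∀ (n : ℕ) (φ : CEemb d n) (F : Fin n → PolyAlg (Test d)),
    m n φ (fun i => (LinearMap.range (bv d)).mkQ (F i)) =
      (LinearMap.range (bv d)).mkQ (∏ i, polyMap (φ i).push (F i))

/-- `Ψ` is the quantization isomorphism `F_CL(𝔻) ≅ P(S^cl(𝔻))` induced by `exp(∂_{G_d})`.
(This formula determines `Ψ`.) -/
def IsGreenQuantization {d : ℕ} (Ψ : FCL d ≃ₗ[ℝ] PolyAlg (Scl d)) : Prop :=
  ∀ F : PolyAlg (Test d), Ψ ((LinearMap.range (bv d)).mkQ F) =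
    polyMap (LinearMap.range (testL d)).mkQ (expContract₂ (greenForm d) F)

/-- `T` is the isomorphism `S^cl(𝔻) ≅ H'(𝔻)`, `[f] ↦ (u ↦ ∫_𝔻 f u)`.
(This formula determines `T`.) -/
def IsHarmonicPairing {d : ℕ} (T : Scl d ≃ₗ[ℝ] HDual d) : Prop :=
  ∀ (f : Test d) (u : Harm d), T ((LinearMap.range (testL d)).mkQ f) u =
    ∫ x in (disk d : Set (Eu d)), f x * zeroExt u x

/-- The operations `ρ^H` on `P(H'(𝔻))`, transported from `F_CL(𝔻)` along
`F_CL(𝔻) ≅ P(S^cl(𝔻)) ≅ P(H'(𝔻))`. -/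
def rhoH {d : ℕ} (T : Scl d ≃ₗ[ℝ] HDual d) (Ψ : FCL d ≃ₗ[ℝ] PolyAlg (Scl d))
    (m : ∀ n, CEemb d n → MultilinearMap ℝ (fun _ : Fin n => FCL d) (FCL d))
    (n : ℕ) (φ : CEemb d n) :
    MultilinearMap ℝ (fun _ : Fin n => PolyAlg (HDual d)) (PolyAlg (HDual d)) :=
  (Ψ.trans (polyEquiv T)).toLinearMap.compMultilinearMap
    ((m n φ).compLinearMap fun _ => (Ψ.trans (polyEquiv T)).symm.toLinearMap)

/-- The transpose `T ↦ T ∘ R` of a continuous operator `R` on `H(𝔻)`. -/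
def transpose {d : ℕ} (R : Harm d →L[ℝ] Harm d) : HDual d →ₗ[ℝ] HDual d where
  toFun T := T.comp R
  map_add' T T' := by ext u; rfl
  map_smul' c T := by ext u; rfl

/-- The class in `P(H'(𝔻))` of a harmonic distribution. -/
abbrev obs {d : ℕ} (T : HDual d) : PolyAlg (HDual d) := SymmetricAlgebra.ι ℝ (HDual d) T

end

end ConformalDisk

open ConformalDisk

/-! ### The exponential of a contraction on the polynomial algebra -/

namespace ConformalDisk

noncomputable section

section SymAlg

variable {V V' : Type*} [AddCommGroup V] [Module ℝ V] [AddCommGroup V'] [Module ℝ V']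

/-! The geometric input is a two-point form of Liouville's theorem: for d ≥ 3 every conformal
embedding satisfies ‖φ(x) - φ(y)‖² = Ω(x) Ω(y) ‖x - y‖² (`ConfEmb.norm_sub_sq`). With ρ = 1/Ω, the
Christoffel formula shows that for orthogonal u, v the mixed derivative ∂_u∂_v(ρφ) equals (∂_u∂_vρ)
φ. Differentiating once more, in a third orthogonal direction, forces ∂_u∂_vρ = 0. Then ρ ‖φ -
φ(y)‖² has the same property, hence is a multiple of ‖x - y‖². Raised to the power -(d-2)/2, the
identity says that the Newton kernel N is conformally covariant, so W_φ preserves the Green form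
(`ConfEmb.greenForm_push`). Since convolution with N inverts L on compactly supported functions
(`conv_newton_laplacian`, `laplacian_conv_newton`), the covariance of L (`ConfEmb.push_testL`) and
of harmonic functions (`ConfEmb.laplacian_pull`) follows without computing the Laplacian of a
composite.

The operations descend to the cokernel because W_φ(Lh) = Lh' with h' supported in φ(𝔻): integrating
h' against W_φ f gives ∫ h f, and against observables pushed into another disk it gives zero. So a
product with one factor in the image of Δ^BV is again in that image (`pushProd_mem`).

The quantization map works because G is a Green function: ∂_G(Lh, f) = ∫ h f. Conjugation by
exp(∂_G) therefore removes the contraction term of Δ^BV and leaves F ⊗ h ↦ -F · Lh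
(`expContract₂_bv`), whose cokernel is P(C_c^∞ / L C_c^∞) (`ker_polyMap_mkQ`).

For the duality, harmonic functions are reproduced by convolution with a smooth kernel of
arbitrarily small support (`exists_reproducing_kernel`). This gives interior derivative estimates,
so a continuous functional on H(𝔻) is bounded by the supremum over a compact ball; Hahn–Banach and
two mollifications represent it by a test function (`pairing_surjective`). Conversely, if f
annihilates all harmonic functions, then N ∗ f vanishes outside 𝔻, because N(x - ·) is harmonic on 𝔻
for such x. Analyticity along rays extends the vanishing to the complement of a smaller concentric
ball containing the support of f. Thus N ∗ f is a test function on 𝔻 and L(N ∗ f) = f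
(`mem_range_testL_of_pairing_eq_zero`).

For the explicit formulas, W_φ is dual to u ↦ u^φ, and exp(∂_G) commutes with P(W_φ), so a unary
operation is induced by T ↦ φ.T. A binary operation on linear observables acquires the single
correction ∂_G(W_φ f, W_ψ g). As the two images are disjoint, G is harmonic in each variable there,
so the correction depends only on the functionals represented by f and g, and may be computed for f,
g representing derivatives of point evaluations. -/

lemma expContract₂_eq_sum (B : V →ₗ[ℝ] V →ₗ[ℝ] ℝ) (x : PolyAlg V) {N : ℕ}
    (hN : ∀ k ≥ N, (contract₂ B)^[k] x = 0) :
    expContract₂ B x = ∑ k ∈ Finset.range N, ((k.factorial : ℝ)⁻¹) • (contract₂ B)^[k] x := by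
  refine finsum_eq_sum_of_support_subset _ fun k hk => ?_
  rw [Finset.coe_range, Set.mem_Iio]
  by_contra h
  exact hk (by simp only [hN k (not_lt.1 h), smul_zero])

lemma expContract₂_add (B : V →ₗ[ℝ] V →ₗ[ℝ] ℝ) (hB : ∀ v w, B v w = B w v) (x y : PolyAlg V) :
    expContract₂ B (x + y) = expContract₂ B x + expContract₂ B y := by
  obtain ⟨N, hN⟩ := contract₂_locally_nilpotent B hB x
  obtain ⟨M, hM⟩ := contract₂_locally_nilpotent B hB y
  have hx : ∀ k ≥ max N M, (contract₂ B)^[k] x = 0 := fun k hk => hN k (le_of_max_le_left hk)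
  have hy : ∀ k ≥ max N M, (contract₂ B)^[k] y = 0 := fun k hk => hM k (le_of_max_le_right hk)
  rw [expContract₂_eq_sum B x hx, expContract₂_eq_sum B y hy,
    expContract₂_eq_sum B (x + y) (N := max N M)
      (fun k hk => by rw [iterate_map_add (contract₂ B), hx k hk, hy k hk, add_zero]),
    ← Finset.sum_add_distrib]
  exact Finset.sum_congr rfl fun k _ => by rw [iterate_map_add (contract₂ B), smul_add]

lemma iterate_contract₂_smul (B : V →ₗ[ℝ] V →ₗ[ℝ] ℝ) (k : ℕ) (c : ℝ) (x : PolyAlg V) :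
    (contract₂ B)^[k] (c • x) = c • (contract₂ B)^[k] x := by
  rw [← Module.End.pow_apply, ← Module.End.pow_apply, map_smul]

lemma expContract₂_smul (B : V →ₗ[ℝ] V →ₗ[ℝ] ℝ) (hB : ∀ v w, B v w = B w v) (c : ℝ)
    (x : PolyAlg V) : expContract₂ B (c • x) = c • expContract₂ B x := by
  obtain ⟨N, hN⟩ := contract₂_locally_nilpotent B hB x
  rw [expContract₂_eq_sum B x hN, expContract₂_eq_sum B (c • x) (N := N)
      (fun k hk => by rw [iterate_contract₂_smul, hN k hk, smul_zero]), Finset.smul_sum]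
  exact Finset.sum_congr rfl fun k _ => by rw [iterate_contract₂_smul, smul_comm]

lemma expContract₂_one (B : V →ₗ[ℝ] V →ₗ[ℝ] ℝ) : expContract₂ B (1 : PolyAlg V) = 1 := by
  rw [expContract₂_eq_sum B 1 (N := 1)]
  · simp
  · intro k hk
    obtain ⟨j, rfl⟩ := Nat.exists_eq_add_of_le' hk
    rw [Function.iterate_succ_apply, contract₂_one]
    exact iterate_map_zero (contract₂ B) j

lemma expContract₂_contract (B : V →ₗ[ℝ] V →ₗ[ℝ] ℝ) (hB : ∀ v w, B v w = B w v)
    (ℓ : V →ₗ[ℝ] ℝ) (x : PolyAlg V) :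
    expContract₂ B (contract ℓ x) = contract ℓ (expContract₂ B x) := by
  have hcomm : ∀ k, (contract₂ B)^[k] (contract ℓ x) = contract ℓ ((contract₂ B)^[k] x) :=
    fun k => (Function.Commute.iterate_left
      (fun y => contract₂_comm B hB ℓ y : Function.Commute (contract₂ B) (contract ℓ)) k) x
  obtain ⟨N, hN⟩ := contract₂_locally_nilpotent B hB x
  rw [expContract₂_eq_sum B x hN, expContract₂_eq_sum B (contract ℓ x) (N := N)
      (fun k hk => by rw [hcomm, hN k hk, map_zero]), map_sum]
  exact Finset.sum_congr rfl fun k _ => by rw [hcomm, map_smul]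

/-- The commutator of ∂_B with multiplication by v is `contract (B v)`, which commutes with ∂_B; the
commutator with a power of ∂_B is then the derivative of that power. -/
lemma iterate_contract₂_ι_mul (B : V →ₗ[ℝ] V →ₗ[ℝ] ℝ) (hB : ∀ v w, B v w = B w v) (v : V)
    (x : PolyAlg V) (k : ℕ) :
    (contract₂ B)^[k + 1] (SymmetricAlgebra.ι ℝ V v * x) =
      SymmetricAlgebra.ι ℝ V v * (contract₂ B)^[k + 1] x +
        ((k : ℝ) + 1) • contract (B v) ((contract₂ B)^[k] x) := by
  induction k with
  | zero => simp [contract₂_ι_mul B hB]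
  | succ k ih =>
    rw [Function.iterate_succ_apply', ih, map_add, map_smul, contract₂_ι_mul B hB,
      contract₂_comm B hB, ← Function.iterate_succ_apply' (contract₂ B),
      ← Function.iterate_succ_apply' (contract₂ B)]
    push_cast
    module

/-- The recursion which determines `exp(∂_B)`. -/
lemma expContract₂_ι_mul (B : V →ₗ[ℝ] V →ₗ[ℝ] ℝ) (hB : ∀ v w, B v w = B w v) (v : V)
    (x : PolyAlg V) :
    expContract₂ B (SymmetricAlgebra.ι ℝ V v * x) =
      SymmetricAlgebra.ι ℝ V v * expContract₂ B x + contract (B v) (expContract₂ B x) := by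
  obtain ⟨N, hN⟩ := contract₂_locally_nilpotent B hB x
  have hv : ∀ k ≥ N + 1, (contract₂ B)^[k] (SymmetricAlgebra.ι ℝ V v * x) = 0 := by
    intro k hk
    obtain ⟨j, rfl⟩ := Nat.exists_eq_add_of_le' (Nat.one_le_of_lt hk)
    rw [iterate_contract₂_ι_mul B hB, hN _ (by omega), hN _ (by omega)]
    simp
  -- The two sums over k ≤ N lose their k = 0 terms, so that index k + 1 on the left meets index k
  -- in the contraction sum; the factor (k + 1) / (k + 1)! becomes 1 / k!.
  rw [expContract₂_eq_sum B _ hv, Finset.sum_range_succ', ← expContract₂_contract B hB,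
    expContract₂_eq_sum B x (N := N + 1) (fun k hk => hN k (by omega)), Finset.sum_range_succ',
    expContract₂_contract B hB, expContract₂_eq_sum B x hN, mul_add, Finset.mul_sum, map_sum,
    add_right_comm, ← Finset.sum_add_distrib]
  congr 1
  · refine Finset.sum_congr rfl fun k _ => ?_
    have hf : (((k + 1).factorial : ℝ)⁻¹) * ((k : ℝ) + 1) = ((k.factorial : ℝ))⁻¹ := by
      rw [Nat.factorial_succ]
      push_cast
      field_simp
    rw [iterate_contract₂_ι_mul B hB, smul_add, smul_smul, hf, map_smul, mul_smul_comm]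
  · simp

lemma expContract₂_ι (B : V →ₗ[ℝ] V →ₗ[ℝ] ℝ) (hB : ∀ v w, B v w = B w v) (v : V) :
    expContract₂ B (SymmetricAlgebra.ι ℝ V v) = SymmetricAlgebra.ι ℝ V v := by
  have h := expContract₂_ι_mul B hB v 1
  rwa [expContract₂_one, contract_one, mul_one, add_zero] at h

lemma contract_ι (ℓ : V →ₗ[ℝ] ℝ) (v : V) :
    contract ℓ (SymmetricAlgebra.ι ℝ V v) = algebraMap ℝ _ (ℓ v) := by
  have h := contract_ι_mul ℓ v 1
  rwa [contract_one, mul_one, mul_zero, zero_add, ← Algebra.algebraMap_eq_smul_one] at h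

lemma expContract₂_ι_mul_ι (B : V →ₗ[ℝ] V →ₗ[ℝ] ℝ) (hB : ∀ v w, B v w = B w v) (v w : V) :
    expContract₂ B (SymmetricAlgebra.ι ℝ V v * SymmetricAlgebra.ι ℝ V w) =
      SymmetricAlgebra.ι ℝ V v * SymmetricAlgebra.ι ℝ V w + algebraMap ℝ _ (B v w) := by
  rw [expContract₂_ι_mul B hB, expContract₂_ι B hB, contract_ι]

/-- Induction on the number of factors avoids multiplying power series: in the recursion for a
product with v, the contractions with B v and with -B v cancel. -/
lemma expContract₂_neg_expContract₂ (B : V →ₗ[ℝ] V →ₗ[ℝ] ℝ) (hB : ∀ v w, B v w = B w v)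
    (x : PolyAlg V) : expContract₂ (-B) (expContract₂ B x) = x := by
  have hB' : ∀ v w, (-B) v w = (-B) w v := fun v w => by simp [hB v w]
  induction x using poly_induction with
  | h1 => rw [expContract₂_one, expContract₂_one]
  | hs c x hx => rw [expContract₂_smul B hB, expContract₂_smul _ hB', hx]
  | ha x y hx hy => rw [expContract₂_add B hB, expContract₂_add _ hB', hx, hy]
  | hm v x hx =>
    rw [expContract₂_ι_mul B hB, expContract₂_add _ hB', expContract₂_ι_mul _ hB',
      expContract₂_contract _ hB', hx]
    simp

/-- The linear automorphism `exp(∂_B)` of `P(V)`. -/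
def expContract₂Equiv (B : V →ₗ[ℝ] V →ₗ[ℝ] ℝ) (hB : ∀ v w, B v w = B w v) :
    PolyAlg V ≃ₗ[ℝ] PolyAlg V where
  toFun := expContract₂ B
  map_add' := expContract₂_add B hB
  map_smul' := expContract₂_smul B hB
  invFun := expContract₂ (-B)
  left_inv := expContract₂_neg_expContract₂ B hB
  right_inv x := by
    have h := expContract₂_neg_expContract₂ (-B) (fun v w => by simp [hB v w]) x
    have e : - -B = B := by
      ext v w
      simp
    rwa [e] at h

lemma polyMap_ι (f : V →ₗ[ℝ] V') (v : V) :
    polyMap f (SymmetricAlgebra.ι ℝ V v) = SymmetricAlgebra.ι ℝ V' (f v) := by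
  simp [polyMap]

lemma contract_polyMap (f : V →ₗ[ℝ] V') (ℓ : V' →ₗ[ℝ] ℝ) (x : PolyAlg V) :
    contract ℓ (polyMap f x) = polyMap f (contract (ℓ ∘ₗ f) x) := by
  induction x using poly_induction with
  | h1 => simp [contract_one]
  | hs c x hx => simp only [map_smul, hx]
  | ha x y hx hy => simp only [map_add, hx, hy]
  | hm v x hx => simp [contract_ι_mul, polyMap_ι, hx]

lemma contract_mul (ℓ : V →ₗ[ℝ] ℝ) (x y : PolyAlg V) :
    contract ℓ (x * y) = x * contract ℓ y + y * contract ℓ x :=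
  (polyDerivation (Algebra.linearMap ℝ (PolyAlg V) ∘ₗ ℓ)).leibniz x y

/-- Naturality of exp(∂_B) under isometries. It is applied to f = W_φ and the Green form, where the
isometry property is conformal invariance. -/
lemma expContract₂_polyMap (f : V →ₗ[ℝ] V') (B : V →ₗ[ℝ] V →ₗ[ℝ] ℝ)
    (hB : ∀ v w, B v w = B w v) (B' : V' →ₗ[ℝ] V' →ₗ[ℝ] ℝ) (hB' : ∀ v w, B' v w = B' w v)
    (hf : ∀ v w, B' (f v) (f w) = B v w) (x : PolyAlg V) :
    expContract₂ B' (polyMap f x) = polyMap f (expContract₂ B x) := by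
  induction x using poly_induction with
  | h1 => simp [expContract₂_one]
  | hs c x hx => rw [map_smul, expContract₂_smul _ hB', hx, expContract₂_smul _ hB, map_smul]
  | ha x y hx hy =>
    rw [map_add, expContract₂_add _ hB', hx, hy, expContract₂_add _ hB, map_add]
  | hm v x hx =>
    have h : B' (f v) ∘ₗ f = B v := by
      ext w
      exact hf v w
    rw [map_mul, polyMap_ι, expContract₂_ι_mul _ hB', hx, contract_polyMap, h,
      expContract₂_ι_mul _ hB, map_add, map_mul, polyMap_ι]

/-- The map `P(V) ⊗ V → P(V)`, `F ⊗ v ↦ F · L v`. -/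
def mulRange (L : V →ₗ[ℝ] V) : PolyAlg V ⊗[ℝ] V →ₗ[ℝ] PolyAlg V :=
  TensorProduct.lift ((LinearMap.mul ℝ (PolyAlg V)).compl₂ (SymmetricAlgebra.ι ℝ V ∘ₗ L))

lemma mulRange_tmul (L : V →ₗ[ℝ] V) (F : PolyAlg V) (v : V) :
    mulRange L (F ⊗ₜ v) = F * SymmetricAlgebra.ι ℝ V (L v) := rfl

/-- P(V / LV) is the quotient of P(V) by the ideal generated by LV, and the image of F ⊗ v ↦ F · Lv
is that ideal. -/
lemma ker_polyMap_mkQ (L : V →ₗ[ℝ] V) :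
    LinearMap.ker (polyMap (LinearMap.range L).mkQ).toLinearMap =
      LinearMap.range (mulRange L) := by
  refine le_antisymm (fun x hx => ?_) ?_
  · let I : Ideal (PolyAlg V) := Ideal.span (Set.range fun v => SymmetricAlgebra.ι ℝ V (L v))
    let g : V ⧸ LinearMap.range L →ₗ[ℝ] PolyAlg V ⧸ I :=
      (LinearMap.range L).liftQ ((Ideal.Quotient.mkₐ ℝ I).toLinearMap ∘ₗ SymmetricAlgebra.ι ℝ V)
        (by
          rintro _ ⟨v, rfl⟩
          exact Ideal.Quotient.eq_zero_iff_mem.2 (Ideal.subset_span ⟨v, rfl⟩))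
    have hg : (SymmetricAlgebra.lift g).comp (polyMap (LinearMap.range L).mkQ) =
        Ideal.Quotient.mkₐ ℝ I := by
      apply SymmetricAlgebra.algHom_ext
      ext v
      simp [polyMap_ι, g]
    have hxI : x ∈ I := by
      rw [← Ideal.Quotient.eq_zero_iff_mem]
      have h := congrArg (fun F => F x) hg
      change SymmetricAlgebra.lift g (polyMap _ x) = Ideal.Quotient.mk I x at h
      have hx' : polyMap (LinearMap.range L).mkQ x = 0 := hx
      rw [← h, hx', map_zero]
    clear hx
    induction hxI using Submodule.span_induction with
    | mem y hy =>
      obtain ⟨v, rfl⟩ := hy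
      exact ⟨1 ⊗ₜ v, by rw [mulRange_tmul, one_mul]⟩
    | zero => exact zero_mem _
    | add y z _ _ hy hz => exact add_mem hy hz
    | smul a y hyI hy =>
      clear hyI
      obtain ⟨t, rfl⟩ := hy
      induction t using TensorProduct.induction_on with
      | zero => simp
      | add b c hb hc => rw [map_add, smul_add]; exact add_mem hb hc
      | tmul F v => exact ⟨(a * F) ⊗ₜ v, by rw [mulRange_tmul, mulRange_tmul, smul_eq_mul, mul_assoc]⟩
  · rintro _ ⟨t, rfl⟩
    rw [LinearMap.mem_ker]
    induction t using TensorProduct.induction_on with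
    | zero => simp
    | add a b ha hb => rw [map_add, map_add, ha, hb, add_zero]
    | tmul F v =>
      change polyMap _ (F * SymmetricAlgebra.ι ℝ V (L v)) = 0
      have h : (LinearMap.range L).mkQ (L v) = 0 :=
        (Submodule.Quotient.mk_eq_zero _).2 ⟨v, rfl⟩
      rw [map_mul, polyMap_ι, h, map_zero, mul_zero]

lemma polyMap_surjective (f : V →ₗ[ℝ] V') (hf : Function.Surjective f) :
    Function.Surjective (polyMap f) := by
  intro y
  induction y using poly_induction with
  | h1 => exact ⟨1, map_one _⟩
  | hs c y hy => obtain ⟨x, rfl⟩ := hy; exact ⟨c • x, map_smul _ _ _⟩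
  | ha y z hy hz => obtain ⟨x, rfl⟩ := hy; obtain ⟨x', rfl⟩ := hz; exact ⟨x + x', map_add _ _ _⟩
  | hm v y hy =>
    obtain ⟨x, rfl⟩ := hy
    obtain ⟨w, rfl⟩ := hf v
    exact ⟨SymmetricAlgebra.ι ℝ V w * x, by rw [map_mul, polyMap_ι]⟩

/-- A multilinear map which vanishes as soon as one argument lies in `U` only depends on the
arguments modulo `U`. -/
lemma multilinear_eq_of_sub_mem {ι : Type*} [Fintype ι] {W : Type*}
    [AddCommGroup W] [Module ℝ W] (U : Submodule ℝ V)
    (f : MultilinearMap ℝ (fun _ : ι => V) W) (hf : ∀ i x, x i ∈ U → f x = 0) (x y : ι → V)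
    (hxy : ∀ i, x i - y i ∈ U) : f x = f y := by
  classical
  -- The arguments x i are replaced by y i one at a time; each replacement changes the value by f of
  -- a tuple with an entry ±(x i - y i) in U.
  have h : ∀ s : Finset ι, f (s.piecewise y x) = f x := by
    intro s
    induction s using Finset.induction_on with
    | empty => simp
    | insert i s hi ih =>
      rw [Finset.piecewise_insert, ← ih, ← sub_eq_zero]
      nth_rw 2 [← Function.update_eq_self i (s.piecewise y x)]
      rw [← MultilinearMap.map_update_sub]
      refine hf i _ ?_
      rw [Function.update_self, Finset.piecewise_eq_of_notMem _ _ _ hi, ← neg_sub]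
      exact neg_mem (hxy i)
  rw [← h Finset.univ, Finset.piecewise_univ]

end SymAlg

end

end ConformalDisk

/-! ### Directional derivatives, the Laplacian and integration by parts -/

namespace ConformalDisk

noncomputable section

section Calculus

variable {d : ℕ} {F : Type*} [NormedAddCommGroup F] [NormedSpace ℝ F]

/-- The derivative of `f` in the direction `v`. -/
def dirDeriv (v : Eu d) (f : Eu d → F) : Eu d → F := fun x => fderiv ℝ f x v

lemma dirDeriv_contDiffOn {U : Set (Eu d)} (hU : IsOpen U) {f : Eu d → F}
    (hf : ContDiffOn ℝ ∞ f U) (v : Eu d) : ContDiffOn ℝ ∞ (dirDeriv v f) U :=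
  (hf.fderiv_of_isOpen hU (by simp)).clm_apply contDiffOn_const

lemma dirDeriv_contDiff {f : Eu d → F} (hf : ContDiff ℝ ∞ f) (v : Eu d) :
    ContDiff ℝ ∞ (dirDeriv v f) :=
  (hf.fderiv_right (by simp)).clm_apply contDiff_const

lemma differentiableAt_of_contDiffOn {U : Set (Eu d)} (hU : IsOpen U) {f : Eu d → F}
    (hf : ContDiffOn ℝ ∞ f U) {x : Eu d} (hx : x ∈ U) : DifferentiableAt ℝ f x :=
  (hf.contDiffAt (hU.mem_nhds hx)).differentiableAt (by simp)

lemma dirDeriv_congr {U : Set (Eu d)} (hU : IsOpen U) {f g : Eu d → F} (h : Set.EqOn f g U)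
    (v : Eu d) : Set.EqOn (dirDeriv v f) (dirDeriv v g) U := fun x hx => by
  have : f =ᶠ[𝓝 x] g := Filter.eventually_of_mem (hU.mem_nhds hx) h
  simp only [dirDeriv, this.fderiv_eq]

lemma dirDeriv_dirDeriv {f : Eu d → F} {x : Eu d} (hf : ContDiffAt ℝ 2 f x) (u v : Eu d) :
    dirDeriv u (dirDeriv v f) x = fderiv ℝ (fderiv ℝ f) x u v := by
  have h : DifferentiableAt ℝ (fderiv ℝ f) x :=
    (hf.fderiv_right (m := 1) (by norm_num)).differentiableAt (by simp)
  change fderiv ℝ (fun y => fderiv ℝ f y v) x u = _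
  rw [fderiv_clm_apply h (differentiableAt_const v)]
  simp

lemma contDiffAt_two {U : Set (Eu d)} (hU : IsOpen U) {f : Eu d → F}
    (hf : ContDiffOn ℝ ∞ f U) {x : Eu d} (hx : x ∈ U) : ContDiffAt ℝ 2 f x :=
  (hf.contDiffAt (hU.mem_nhds hx)).of_le (WithTop.coe_le_coe.2 (le_top : (2 : ℕ∞) ≤ ⊤))

lemma dirDeriv_comm {U : Set (Eu d)} (hU : IsOpen U) {f : Eu d → F}
    (hf : ContDiffOn ℝ ∞ f U) (u v : Eu d) {x : Eu d} (hx : x ∈ U) :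
    dirDeriv u (dirDeriv v f) x = dirDeriv v (dirDeriv u f) x := by
  have h := contDiffAt_two hU hf hx
  rw [dirDeriv_dirDeriv h, dirDeriv_dirDeriv h]
  exact (h.isSymmSndFDerivAt (by simp)).eq u v

lemma dirDeriv_smul {f : Eu d → ℝ} {g : Eu d → F} {x : Eu d} (hf : DifferentiableAt ℝ f x)
    (hg : DifferentiableAt ℝ g x) (v : Eu d) :
    dirDeriv v (fun y => f y • g y) x = dirDeriv v f x • g x + f x • dirDeriv v g x := by
  simp only [dirDeriv]
  rw [fderiv_fun_smul hf hg]
  simp [add_comm]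

lemma dirDeriv_mul {f g : Eu d → ℝ} {x : Eu d} (hf : DifferentiableAt ℝ f x)
    (hg : DifferentiableAt ℝ g x) (v : Eu d) :
    dirDeriv v (fun y => f y * g y) x = dirDeriv v f x * g x + f x * dirDeriv v g x :=
  dirDeriv_smul hf hg v

lemma dirDeriv_add {f g : Eu d → F} {x : Eu d} (hf : DifferentiableAt ℝ f x)
    (hg : DifferentiableAt ℝ g x) (v : Eu d) :
    dirDeriv v (fun y => f y + g y) x = dirDeriv v f x + dirDeriv v g x := by
  simp only [dirDeriv]
  rw [fderiv_fun_add hf hg]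
  rfl

lemma dirDeriv_inner {f g : Eu d → Eu d} {x : Eu d} (hf : DifferentiableAt ℝ f x)
    (hg : DifferentiableAt ℝ g x) (v : Eu d) :
    dirDeriv v (fun y => inner ℝ (f y) (g y)) x =
      inner ℝ (dirDeriv v f x) (g x) + inner ℝ (f x) (dirDeriv v g x) := by
  simp only [dirDeriv]
  rw [fderiv_inner_apply ℝ hf hg, add_comm]

/-- The standard basis vectors. -/
abbrev basisVec (i : Fin d) : Eu d := EuclideanSpace.single i (1 : ℝ)

lemma laplacian_eq_sum {f : Eu d → ℝ} {x : Eu d} (hf : ContDiffAt ℝ 2 f x) :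
    Δ f x = ∑ i, dirDeriv (basisVec i) (dirDeriv (basisVec i) f) x := by
  rw [laplacian_eq_iteratedFDeriv_orthonormalBasis f (EuclideanSpace.basisFun (Fin d) ℝ)]
  refine Finset.sum_congr rfl fun i _ => ?_
  rw [dirDeriv_dirDeriv hf, iteratedFDeriv_two_apply]
  simp

lemma laplacian_contDiff {f : Eu d → ℝ} (hf : ContDiff ℝ ∞ f) : ContDiff ℝ ∞ (Δ f) := by
  have h : Δ f = fun x => ∑ i, dirDeriv (basisVec i) (dirDeriv (basisVec i) f) x := by
    ext x
    exact laplacian_eq_sum (contDiffAt_two isOpen_univ hf.contDiffOn (Set.mem_univ x))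
  rw [h]
  exact ContDiff.sum fun i _ => dirDeriv_contDiff (dirDeriv_contDiff hf _) _

lemma laplacian_contDiffOn {U : Set (Eu d)} (hU : IsOpen U) {f : Eu d → ℝ}
    (hf : ContDiffOn ℝ ∞ f U) : ContDiffOn ℝ ∞ (Δ f) U := by
  have h : ContDiffOn ℝ ∞
      (fun x => ∑ i, dirDeriv (basisVec i) (dirDeriv (basisVec i) f) x) U :=
    ContDiffOn.sum fun i _ => dirDeriv_contDiffOn hU (dirDeriv_contDiffOn hU hf _) _
  exact h.congr fun x hx => laplacian_eq_sum (contDiffAt_two hU hf hx)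

lemma tsupport_laplacian_subset (f : Eu d → ℝ) : tsupport (Δ f) ⊆ tsupport f := by
  refine closure_minimal (fun x hx => ?_) (isClosed_tsupport f)
  by_contra h
  refine hx ?_
  have hf : f =ᶠ[𝓝 x] fun _ => 0 := notMem_tsupport_iff_eventuallyEq.1 h
  rw [(laplacian_congr_nhds hf).eq_of_nhds, laplacian_const]
  rfl

lemma testL_apply (h : Test d) (x : Eu d) : testL d h x = -Δ (h : Eu d → ℝ) x := by
  rw [laplacian_eq_sum (contDiffAt_two isOpen_univ h.contDiff.contDiffOn (Set.mem_univ x)), testL]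
  have hs : ∀ (s : Finset (Fin d)) (g : Fin d → Test d), (∑ i ∈ s, g i) x = ∑ i ∈ s, g i x := by
    intro s g
    classical
    induction s using Finset.induction_on with
    | empty => simp
    | insert i s hi ih => rw [Finset.sum_insert hi, Finset.sum_insert hi, ← ih]; rfl
  simp only [LinearMap.neg_apply, LinearMap.sum_apply, LinearMap.comp_apply,
    ContinuousLinearMap.coe_coe]
  change -((∑ i, _ : Test d) x) = _
  rw [hs]
  congr 1

/-- Every smooth function on a neighbourhood `U` of a compact set `K` agrees near `K` with a smooth
function with compact support in `U`. -/
lemma exists_cutoff {K U : Set (Eu d)} (hK : IsCompact K) (hU : IsOpen U) (hKU : K ⊆ U)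
    {u : Eu d → ℝ} (hu : ContDiffOn ℝ ∞ u U) :
    ∃ (w : Eu d → ℝ) (V : Set (Eu d)), ContDiff ℝ ∞ w ∧ HasCompactSupport w ∧ tsupport w ⊆ U ∧
      IsOpen V ∧ K ⊆ V ∧ V ⊆ U ∧ Set.EqOn w u V := by
  -- Two nested compact neighbourhoods are needed: χ is 1 on K₁, so that the product equals u on an
  -- open set around K, and it vanishes outside the interior of K₂, so that the support stays in U.
  obtain ⟨K₂, hK₂, hKK₂, hK₂U⟩ := exists_compact_between hK hU hKU
  obtain ⟨K₁, hK₁, hKK₁, hK₁K₂⟩ := exists_compact_between hK isOpen_interior hKK₂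
  obtain ⟨χ, hχ, -, hχ0, hχ1⟩ := exists_contMDiff_zero_iff_one_iff_of_isClosed
    (modelWithCornersSelf ℝ (Eu d)) (n := ⊤) (s := (interior K₂)ᶜ) (t := K₁)
    isOpen_interior.isClosed_compl hK₁.isClosed (by
      rw [Set.disjoint_left]
      exact fun x hx hx' => hx (hK₁K₂ hx'))
  have hsupp : tsupport (fun x => χ x * u x) ⊆ K₂ := by
    refine closure_minimal (fun x hx => ?_) hK₂.isClosed
    by_contra h
    refine hx ?_
    have h0 : χ x = 0 := (hχ0 x).1 fun h' => h (interior_subset h')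
    simp [h0]
  refine ⟨fun x => χ x * u x, interior K₁, contDiff_iff_contDiffAt.2 fun x => ?_,
    hK₂.of_isClosed_subset (isClosed_tsupport _) hsupp, hsupp.trans hK₂U, isOpen_interior, hKK₁,
    (interior_subset.trans hK₁K₂).trans (interior_subset.trans hK₂U), fun x hx => ?_⟩
  · by_cases hx : x ∈ K₂
    · exact hχ.contDiff.contDiffAt.mul (hu.contDiffAt (hU.mem_nhds (hK₂U hx)))
    · have h : (fun x => χ x * u x) =ᶠ[𝓝 x] fun _ => 0 :=
        notMem_tsupport_iff_eventuallyEq.1 fun h => hx (hsupp h)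
      exact contDiffAt_const.congr_of_eventuallyEq h
  · have h1 : χ x = 1 := (hχ1 x).1 (interior_subset hx)
    simp [h1]

lemma integral_mul_dirDeriv {f g : Eu d → ℝ} (hf : ContDiff ℝ ∞ f) (hg : ContDiff ℝ ∞ g)
    (hgc : HasCompactSupport g) (v : Eu d) :
    ∫ x, f x * dirDeriv v g x = -∫ x, dirDeriv v f x * g x := by
  have hc : HasCompactSupport (dirDeriv v g) := hgc.fderiv_apply ℝ v
  refine integral_mul_fderiv_eq_neg_fderiv_mul_of_integrable ?_ ?_ ?_
    (fun x _ => hf.differentiable (by simp) x) (fun x _ => hg.differentiable (by simp) x)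
  · exact ((dirDeriv_contDiff hf v).continuous.mul hg.continuous).integrable_of_hasCompactSupport
      hgc.mul_left
  · exact (hf.continuous.mul (dirDeriv_contDiff hg v).continuous).integrable_of_hasCompactSupport
      hc.mul_left
  · exact (hf.continuous.mul hg.continuous).integrable_of_hasCompactSupport hgc.mul_left

/-- Compact support of one factor suffices for integrating by parts twice. The other factor will be
a regularized or truncated Newton kernel. -/
lemma integral_mul_laplacian {f g : Eu d → ℝ} (hf : ContDiff ℝ ∞ f) (hg : ContDiff ℝ ∞ g)
    (hgc : HasCompactSupport g) : ∫ x, f x * Δ g x = ∫ x, Δ f x * g x := by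
  have hc : ∀ v, HasCompactSupport (dirDeriv v g) := fun v => hgc.fderiv_apply ℝ v
  have e1 : ∀ x, f x * Δ g x =
      ∑ i, f x * dirDeriv (basisVec i) (dirDeriv (basisVec i) g) x := fun x => by
    rw [laplacian_eq_sum (contDiffAt_two isOpen_univ hg.contDiffOn (Set.mem_univ x)),
      Finset.mul_sum]
  have e2 : ∀ x, Δ f x * g x =
      ∑ i, dirDeriv (basisVec i) (dirDeriv (basisVec i) f) x * g x := fun x => by
    rw [laplacian_eq_sum (contDiffAt_two isOpen_univ hf.contDiffOn (Set.mem_univ x)),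
      Finset.sum_mul]
  simp_rw [e1, e2]
  rw [integral_finsetSum, integral_finsetSum]
  · refine Finset.sum_congr rfl fun i _ => ?_
    rw [integral_mul_dirDeriv hf (dirDeriv_contDiff hg _) (hc _),
      neg_eq_iff_eq_neg, integral_mul_dirDeriv (dirDeriv_contDiff hf _) hg hgc]
  · exact fun i _ => ((dirDeriv_contDiff (dirDeriv_contDiff hf _) _).continuous.mul
      hg.continuous).integrable_of_hasCompactSupport hgc.mul_left
  · exact fun i _ => (hf.continuous.mul (dirDeriv_contDiff (dirDeriv_contDiff hg _)
      _).continuous).integrable_of_hasCompactSupport ((hc _).fderiv_apply ℝ _).mul_left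

/-- A test function on the disk from a smooth function with compact support in the disk. -/
def mkTest (w : Eu d → ℝ) (hw : ContDiff ℝ ∞ w) (hc : HasCompactSupport w)
    (hs : tsupport w ⊆ disk d) : Test d := ⟨w, hw, hc, hs⟩

lemma test_eq_zero (f : Test d) {x : Eu d} (hx : x ∉ disk d) : f x = 0 :=
  image_eq_zero_of_notMem_tsupport fun h => hx (f.tsupport_subset h)

lemma setIntegral_test_mul (f : Test d) (u : Eu d → ℝ) :
    ∫ x in (disk d : Set (Eu d)), f x * u x = ∫ x, f x * u x :=
  setIntegral_eq_integral_of_forall_compl_eq_zero fun x hx => by rw [test_eq_zero f hx, zero_mul]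

/-- Green's identity for a smooth function near the support of a test function. -/
lemma integral_testL_mul {U : Set (Eu d)} (hU : IsOpen U) {u : Eu d → ℝ}
    (hu : ContDiffOn ℝ ∞ u U) (h : Test d) (hh : tsupport h ⊆ U) :
    ∫ x, testL d h x * u x = -∫ x, h x * Δ u x := by
  obtain ⟨w, V, hw, hwc, -, hV, hKV, -, hwu⟩ := exists_cutoff h.hasCompactSupport hU hh hu
  have e1 : ∀ x, testL d h x * u x = -(w x * Δ (h : Eu d → ℝ) x) := fun x => by
    rw [testL_apply]
    by_cases hx : x ∈ tsupport h
    · rw [hwu (hKV hx)]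
      ring
    · rw [image_eq_zero_of_notMem_tsupport fun h' => hx (tsupport_laplacian_subset _ h')]
      ring
  have e2 : ∀ x, h x * Δ u x = Δ w x * h x := fun x => by
    by_cases hx : x ∈ tsupport h
    · rw [(laplacian_congr_nhds (Filter.eventually_of_mem (hV.mem_nhds (hKV hx))
        hwu)).eq_of_nhds, mul_comm]
    · rw [image_eq_zero_of_notMem_tsupport hx]
      ring
  simp_rw [e1, e2]
  rw [integral_neg, integral_mul_laplacian hw h.contDiff h.hasCompactSupport]

end Calculus

end

end ConformalDisk

/-! ### The Newton potential -/

namespace ConformalDisk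

noncomputable section

section Newton

variable {d : ℕ}

/-- The open set where `‖x‖² + a > 0`. -/
lemma isOpen_norm_sq_add_pos (a : ℝ) : IsOpen {x : Eu d | 0 < ‖x‖ ^ 2 + a} :=
  isOpen_lt continuous_const (by fun_prop)

lemma contDiffOn_norm_sq_add_rpow (a p : ℝ) :
    ContDiffOn ℝ ∞ (fun x : Eu d => (‖x‖ ^ 2 + a) ^ p) {x | 0 < ‖x‖ ^ 2 + a} := fun _ hx =>
  (((contDiff_norm_sq ℝ).contDiffAt.add contDiffAt_const).rpow_const_of_ne
    (ne_of_gt hx)).contDiffWithinAt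

lemma dirDeriv_norm_sq_add_rpow (a p : ℝ) (v : Eu d) {x : Eu d} (hx : 0 < ‖x‖ ^ 2 + a) :
    dirDeriv v (fun x : Eu d => (‖x‖ ^ 2 + a) ^ p) x =
      2 * p * ((‖x‖ ^ 2 + a) ^ (p - 1) * inner ℝ x v) := by
  have h := ((hasStrictFDerivAt_norm_sq x).hasFDerivAt.add_const a).rpow_const (p := p)
    (Or.inl hx.ne')
  simp only [dirDeriv]
  rw [h.fderiv]
  simp
  ring

/-- One computation serves the Newton kernel (a = 0) and its regularization (a = ε²). For p =
-(d-2)/2 the coefficient 2(p - 1) + d of ‖x‖² in the bracket vanishes, and only d · a remains. -/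
lemma laplacian_norm_sq_add_rpow (a p : ℝ) {x : Eu d} (hx : 0 < ‖x‖ ^ 2 + a) :
    Δ (fun x : Eu d => (‖x‖ ^ 2 + a) ^ p) x =
      2 * p * (2 * (p - 1) * ‖x‖ ^ 2 + d * (‖x‖ ^ 2 + a)) * (‖x‖ ^ 2 + a) ^ (p - 2) := by
  have hU := isOpen_norm_sq_add_pos (d := d) a
  have h1 : ∀ v, dirDeriv v (dirDeriv v fun x : Eu d => (‖x‖ ^ 2 + a) ^ p) x =
      2 * p * (2 * (p - 1) * (‖x‖ ^ 2 + a) ^ (p - 2) * (inner ℝ x v) ^ 2 +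
        (‖x‖ ^ 2 + a) ^ (p - 1) * ‖v‖ ^ 2) := by
    intro v
    rw [dirDeriv_congr hU (fun y hy => dirDeriv_norm_sq_add_rpow a p v hy) v hx]
    have e : dirDeriv v (fun y : Eu d => (inner ℝ y v : ℝ)) x = ‖v‖ ^ 2 := by
      have := dirDeriv_inner (differentiableAt_id (𝕜 := ℝ) (x := x))
        (differentiableAt_const (𝕜 := ℝ) (x := x) v) v
      simpa [dirDeriv] using this
    have hd : DifferentiableAt ℝ (fun y : Eu d => (inner ℝ y v : ℝ)) x :=
      differentiableAt_id.inner ℝ (differentiableAt_const v)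
    have hp := differentiableAt_of_contDiffOn hU (contDiffOn_norm_sq_add_rpow (d := d) a (p - 1)) hx
    rw [dirDeriv_mul (differentiableAt_const _) (hp.fun_mul hd), dirDeriv_mul hp hd, e,
      dirDeriv_norm_sq_add_rpow a _ v hx]
    have : p - 1 - 1 = p - 2 := by ring
    have e0 : dirDeriv v (fun _ : Eu d => 2 * p) x = 0 := by simp [dirDeriv]
    rw [this, e0]
    ring
  rw [laplacian_eq_sum (contDiffAt_two hU (contDiffOn_norm_sq_add_rpow a p) hx)]
  simp_rw [h1]
  have h2 : ∑ i : Fin d, (inner ℝ x (basisVec i)) ^ 2 = ‖x‖ ^ 2 := by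
    rw [EuclideanSpace.real_norm_sq_eq]
    simp [basisVec, EuclideanSpace.inner_single_right]
  have h3 : (‖x‖ ^ 2 + a) ^ (p - 1) = (‖x‖ ^ 2 + a) ^ (p - 2) * (‖x‖ ^ 2 + a) := by
    rw [← Real.rpow_add_one hx.ne']
    ring_nf
  rw [← Finset.mul_sum, Finset.sum_add_distrib, ← Finset.mul_sum, h2, h3]
  simp
  ring

/-- The Newton kernel `N(z) = 1 / ((d - 2) ω_d ‖z‖^{d-2})`. -/
def newton (d : ℕ) (z : Eu d) : ℝ := 1 / (((d : ℝ) - 2) * sphereVol d * ‖z‖ ^ (d - 2))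

lemma green_eq_newton (x y : Eu d) : green d x y = newton d (x - y) := rfl

/-- The constant `1 / ((d - 2) ω_d)`. -/
def newtonConst (d : ℕ) : ℝ := (((d : ℝ) - 2) * sphereVol d)⁻¹

lemma sphereVol_eq (d : ℕ) :
    sphereVol d = d * (volume : Measure (Eu d)).real (Metric.ball 0 1) := by
  rw [sphereVol, Measure.toSphere_real_apply_univ]
  simp

lemma sphereVol_pos (hd : 3 ≤ d) : 0 < sphereVol d := by
  rw [sphereVol_eq]
  have h : 0 < (volume : Measure (Eu d)).real (Metric.ball 0 1) :=
    ENNReal.toReal_pos (Metric.measure_ball_pos _ _ one_pos).ne' measure_ball_lt_top.ne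
  have h2 : (0 : ℝ) < d := by exact_mod_cast (by omega : 0 < d)
  positivity

lemma norm_sq_rpow_neg (hd : 3 ≤ d) (t : ℝ) (ht : 0 ≤ t) :
    (t ^ 2) ^ (-(((d : ℝ) - 2) / 2)) = (t ^ (d - 2))⁻¹ := by
  rw [← Real.rpow_natCast t 2, ← Real.rpow_mul ht, ← Real.rpow_natCast t (d - 2),
    ← Real.rpow_neg ht, Nat.cast_sub (by omega)]
  congr 1
  push_cast
  ring

lemma newton_eq (hd : 3 ≤ d) (z : Eu d) :
    newton d z = newtonConst d * (‖z‖ ^ 2) ^ (-(((d : ℝ) - 2) / 2)) := by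
  rw [norm_sq_rpow_neg hd _ (norm_nonneg z), newton, newtonConst, one_div, mul_inv]

lemma newton_neg (z : Eu d) : newton d (-z) = newton d z := by
  simp [newton]

lemma contDiffOn_newton (hd : 3 ≤ d) : ContDiffOn ℝ ∞ (newton d) {0}ᶜ := by
  have h := contDiffOn_norm_sq_add_rpow (d := d) 0 (-(((d : ℝ) - 2) / 2))
  have h2 := (contDiffOn_const (c := newtonConst d)).mul h
  refine (h2.mono fun x hx => ?_).congr fun x hx => ?_
  · have : 0 < ‖x‖ := norm_pos_iff.2 hx
    change 0 < ‖x‖ ^ 2 + 0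
    positivity
  · rw [newton_eq hd, add_zero]

lemma laplacian_newton (hd : 3 ≤ d) {x : Eu d} (hx : x ≠ 0) : Δ (newton d) x = 0 := by
  have h0 : 0 < ‖x‖ := norm_pos_iff.2 hx
  have h1 : 0 < ‖x‖ ^ 2 + 0 := by positivity
  have e : newton d = newtonConst d • fun x : Eu d => (‖x‖ ^ 2 + 0) ^ (-(((d : ℝ) - 2) / 2)) := by
    ext z
    simp [newton_eq hd]
  rw [e, laplacian_smul _ (contDiffAt_two (isOpen_norm_sq_add_pos 0)
    (contDiffOn_norm_sq_add_rpow 0 _) h1), laplacian_norm_sq_add_rpow 0 _ h1]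
  have : 2 * (-(((d : ℝ) - 2) / 2) - 1) * ‖x‖ ^ 2 + d * (‖x‖ ^ 2 + 0) = 0 := by ring
  rw [this]
  simp

lemma newton_sub_contDiffOn (hd : 3 ≤ d) (x : Eu d) :
    ContDiffOn ℝ ∞ (fun y => newton d (x - y)) {x}ᶜ :=
  (contDiffOn_newton hd).comp (contDiff_const.sub contDiff_id).contDiffOn fun y hy h => by
    exact hy (sub_eq_zero.1 h).symm

/-- Precomposition with `y ↦ x - y` commutes with the Laplacian. -/
lemma laplacian_comp_sub {f : Eu d → ℝ} {U : Set (Eu d)} (hU : IsOpen U)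
    (hf : ContDiffOn ℝ ∞ f U) (x : Eu d) {y : Eu d} (hy : x - y ∈ U) :
    Δ (fun y => f (x - y)) y = Δ f (x - y) := by
  have hd : ∀ (v : Eu d) (g : Eu d → ℝ), dirDeriv v (fun y => g (x - y)) =
      fun y => -dirDeriv v g (x - y) := by
    intro v g
    ext y
    have e : (fun y => g (x - y)) =
        (fun z => g (x + z)) ∘ (LinearIsometryEquiv.neg ℝ (E := Eu d)).toContinuousLinearEquiv := by
      ext y
      exact congrArg g (sub_eq_add_neg x y)
    simp only [dirDeriv]
    rw [e, ContinuousLinearEquiv.comp_right_fderiv, fderiv_comp_add_left]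
    change fderiv ℝ g (x + -y) (-v) = _
    rw [← sub_eq_add_neg, map_neg]
  have h : ContDiffAt ℝ 2 (fun y => f (x - y)) y :=
    (contDiffAt_two hU hf hy).comp y (contDiffAt_const.sub contDiffAt_id)
  rw [laplacian_eq_sum h, laplacian_eq_sum (contDiffAt_two hU hf hy)]
  refine Finset.sum_congr rfl fun i _ => ?_
  rw [hd]
  have hn : (fun y => -dirDeriv (basisVec i) f (x - y)) =
      -fun y => dirDeriv (basisVec i) f (x - y) := rfl
  have hd2 := congrFun (hd (basisVec i) (dirDeriv (basisVec i) f)) y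
  rw [hn]
  simp only [dirDeriv] at hd2 ⊢
  rw [fderiv_neg, _root_.neg_apply, hd2, neg_neg]

lemma locallyIntegrable_newton (hd : 3 ≤ d) : LocallyIntegrable (newton d) := by
  intro x
  by_cases hx : x = 0
  · subst hx
    refine ⟨Metric.ball 0 2, Metric.ball_mem_nhds _ two_pos, ?_⟩
    refine IntegrableOn.congr_fun ((integrableOn_inv_norm_pow hd).const_mul (newtonConst d))
      (fun z _ => ?_) measurableSet_ball
    simp only [newton_eq hd, norm_sq_rpow_neg hd _ (norm_nonneg z)]
  · have h := ((contDiffOn_newton hd).continuousOn).locallyIntegrableOn (μ := volume)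
      (isOpen_compl_singleton.measurableSet)
    have h2 := h x hx
    rwa [isOpen_compl_singleton.nhdsWithin_eq hx] at h2

/-- The density `P(w) = c d (d - 2) (‖w‖² + 1)^{-(d+2)/2}`, of total mass one. -/
def bubble (d : ℕ) (w : Eu d) : ℝ :=
  newtonConst d * (d * ((d : ℝ) - 2)) * (‖w‖ ^ 2 + 1) ^ (-(((d : ℝ) - 2) / 2) - 2)

/-- The radial density of the bubble has the explicit primitive (r² / (r² + 1))^{d/2} / d. Writing
the base as 1 - 1/(r² + 1) makes its limit at infinity visible. -/
lemma hasDerivAt_radial_primitive (hd : 3 ≤ d) (r : ℝ) (hr : 0 ≤ r) :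
    HasDerivAt (fun r : ℝ => ((1 : ℝ) - (r ^ 2 + 1)⁻¹) ^ ((d : ℝ) / 2) / d)
      (r ^ (d - 1) * (r ^ 2 + 1) ^ (-(((d : ℝ) - 2) / 2) - 2)) r := by
  have h3 : (3 : ℝ) ≤ d := by exact_mod_cast hd
  have hq : 0 < r ^ 2 + 1 := by positivity
  have h1 : HasDerivAt (fun r : ℝ => 1 - (r ^ 2 + 1)⁻¹) (2 * r / (r ^ 2 + 1) ^ 2) r := by
    have h := (((hasDerivAt_pow 2 r).add_const 1).inv hq.ne').const_sub 1
    refine h.congr_deriv ?_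
    simp
    ring
  have h2 := (h1.rpow_const (p := (d : ℝ) / 2) (Or.inr (by linarith))).div_const (d : ℝ)
  refine h2.congr_deriv ?_
  have e1 : 1 - (r ^ 2 + 1)⁻¹ = r ^ 2 / (r ^ 2 + 1) := by field_simp; ring
  have e2 : (r ^ 2) ^ ((d : ℝ) / 2 - 1) = r ^ (d - 2) := by
    rw [← Real.rpow_natCast r 2, ← Real.rpow_mul hr, ← Real.rpow_natCast r (d - 2),
      Nat.cast_sub (by omega)]
    congr 1
    push_cast
    ring
  have e3 : (r ^ 2 + 1) ^ (-(((d : ℝ) - 2) / 2) - 2) =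
      ((r ^ 2 + 1) ^ ((d : ℝ) / 2 - 1))⁻¹ * ((r ^ 2 + 1) ^ 2)⁻¹ := by
    rw [← Real.rpow_natCast (r ^ 2 + 1) 2, ← Real.rpow_neg hq.le, ← Real.rpow_neg hq.le,
      ← Real.rpow_add hq]
    congr 1
    push_cast
    ring
  have e4 : r ^ (d - 1) = r ^ (d - 2) * r := by
    rw [← pow_succ]
    congr 1
    omega
  rw [e1, Real.div_rpow (by positivity) hq.le, e2, e3, e4]
  have : (0 : ℝ) < (r ^ 2 + 1) ^ ((d : ℝ) / 2 - 1) := Real.rpow_pos_of_pos hq _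
  field_simp

lemma tendsto_radial_primitive (d : ℕ) :
    Filter.Tendsto (fun r : ℝ => ((1 : ℝ) - (r ^ 2 + 1)⁻¹) ^ ((d : ℝ) / 2) / d) Filter.atTop
      (𝓝 ((d : ℝ)⁻¹)) := by
  have h1 : Filter.Tendsto (fun r : ℝ => 1 - (r ^ 2 + 1)⁻¹) Filter.atTop (𝓝 (1 - 0)) :=
    tendsto_const_nhds.sub (tendsto_inv_atTop_zero.comp
      (Filter.tendsto_atTop_add_const_right _ _ (Filter.tendsto_pow_atTop two_ne_zero)))
  rw [sub_zero] at h1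
  have h2 := (h1.rpow_const (p := (d : ℝ) / 2) (Or.inl one_ne_zero)).div_const (d : ℝ)
  rwa [Real.one_rpow, one_div] at h2

lemma integrable_bubble (hd : 3 ≤ d) : Integrable (bubble d) := by
  have : Nonempty (Fin d) := ⟨⟨0, by omega⟩⟩
  refine Integrable.const_mul ?_ _
  rw [integrable_fun_norm_addHaar (volume : Measure (Eu d))
    (f := fun r : ℝ => (r ^ 2 + 1) ^ (-(((d : ℝ) - 2) / 2) - 2))]
  simp only [finrank_euclideanSpace, Fintype.card_fin, smul_eq_mul]
  refine integrableOn_Ioi_deriv_of_nonneg' (fun r hr => hasDerivAt_radial_primitive hd r hr)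
    (fun r hr => ?_) (tendsto_radial_primitive d)
  have hr' : (0 : ℝ) < r := hr
  positivity

/-- Polar coordinates contribute ω_d = d · vol(B), and the radial integral is 1/d. The constant 1 /
((d-2) ω_d) of the Newton kernel is what makes the total mass one. -/
lemma integral_bubble (hd : 3 ≤ d) : ∫ w, bubble d w = 1 := by
  have : Nonempty (Fin d) := ⟨⟨0, by omega⟩⟩
  have h3 : (3 : ℝ) ≤ d := by exact_mod_cast hd
  simp only [bubble]
  rw [integral_const_mul, integral_fun_norm_addHaar (volume : Measure (Eu d))
    (fun r : ℝ => (r ^ 2 + 1) ^ (-(((d : ℝ) - 2) / 2) - 2))]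
  simp only [finrank_euclideanSpace, Fintype.card_fin, smul_eq_mul, nsmul_eq_mul]
  rw [integral_Ioi_of_hasDerivAt_of_nonneg' (fun r hr => hasDerivAt_radial_primitive hd r hr)
    (fun r hr => by have hr' : (0 : ℝ) < r := hr; positivity) (tendsto_radial_primitive d)]
  have h0 : (0 : ℝ) ^ ((d : ℝ) / 2) = 0 := Real.zero_rpow (by linarith)
  have h4 := sphereVol_pos hd
  rw [sphereVol_eq] at h4
  rw [newtonConst, sphereVol_eq]
  have h5 : (d : ℝ) - 2 ≠ 0 := by linarith
  have h6 : (d : ℝ) ≠ 0 := by linarith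
  have h7 : (volume : Measure (Eu d)).real (Metric.ball 0 1) ≠ 0 := (right_ne_zero_of_mul h4.ne')
  simp [h0]
  field_simp

/-- The regularized Newton kernel. -/
def newtonReg (d : ℕ) (ε : ℝ) (z : Eu d) : ℝ :=
  newtonConst d * (‖z‖ ^ 2 + ε ^ 2) ^ (-(((d : ℝ) - 2) / 2))

lemma contDiff_newtonReg {ε : ℝ} (hε : 0 < ε) : ContDiff ℝ ∞ (newtonReg d ε) := by
  have h := contDiffOn_norm_sq_add_rpow (d := d) (ε ^ 2) (-(((d : ℝ) - 2) / 2))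
  have h2 := (contDiffOn_const (c := newtonConst d)).mul h
  rw [← contDiffOn_univ]
  exact h2.mono fun x _ => by change 0 < ‖x‖ ^ 2 + ε ^ 2; positivity

/-- The regularized kernel has Laplacian -ε^{-d} P(z/ε), minus an approximate identity. The argument
ε • w and the absolute value match the Jacobian in `Measure.integral_comp_smul`. -/
lemma laplacian_newtonReg {ε : ℝ} (hε : 0 < ε) (w : Eu d) :
    Δ (newtonReg d ε) (ε • w) = -(|(ε ^ d)⁻¹| * bubble d w) := by
  have h1 : 0 < ‖ε • w‖ ^ 2 + ε ^ 2 := by positivity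
  have e : newtonReg d ε =
      newtonConst d • fun x : Eu d => (‖x‖ ^ 2 + ε ^ 2) ^ (-(((d : ℝ) - 2) / 2)) := rfl
  rw [e, laplacian_smul _ (contDiffAt_two (isOpen_norm_sq_add_pos _)
    (contDiffOn_norm_sq_add_rpow _ _) h1), laplacian_norm_sq_add_rpow _ _ h1, bubble]
  have e2 : ‖ε • w‖ ^ 2 + ε ^ 2 = ε ^ 2 * (‖w‖ ^ 2 + 1) := by
    rw [norm_smul, mul_pow, Real.norm_eq_abs, sq_abs]
    ring
  have e3 : (ε ^ 2) ^ (-(((d : ℝ) - 2) / 2) - 2) = (ε ^ d)⁻¹ * (ε ^ 2)⁻¹ := by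
    rw [← Real.rpow_natCast ε 2, ← Real.rpow_mul hε.le, ← Real.rpow_natCast ε d,
      ← Real.rpow_neg hε.le, ← Real.rpow_neg hε.le, ← Real.rpow_add hε]
    congr 1
    push_cast
    ring
  have e4 : 2 * (-(((d : ℝ) - 2) / 2) - 1) * ‖ε • w‖ ^ 2 + d * (‖ε • w‖ ^ 2 + ε ^ 2) =
      d * ε ^ 2 := by ring
  rw [e4, e2, Real.mul_rpow (by positivity) (by positivity), e3, abs_of_pos (by positivity),
    smul_eq_mul]
  field_simp

/-- `L N = δ₀`. -/
lemma integral_newton_mul_laplacian (hd : 3 ≤ d) {f : Eu d → ℝ} (hf : ContDiff ℝ ∞ f)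
    (hfc : HasCompactSupport f) : ∫ z, newton d z * Δ f z = -f 0 := by
  have : Nonempty (Fin d) := ⟨⟨0, by omega⟩⟩
  have h3 : (3 : ℝ) ≤ d := by exact_mod_cast hd
  have hΔc : HasCompactSupport (Δ f) :=
    hfc.mono' ((subset_tsupport _).trans (tsupport_laplacian_subset f))
  have hΔ := (laplacian_contDiff hf).continuous
  -- the left hand side is the limit of the regularized integrals
  have hlim1 : Filter.Tendsto (fun ε : ℝ => ∫ z, newtonReg d ε z * Δ f z) (𝓝[>] 0)
      (𝓝 (∫ z, newton d z * Δ f z)) := by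
    refine tendsto_integral_filter_of_dominated_convergence (fun z => ‖Δ f z • newton d z‖) ?_ ?_
      ((locallyIntegrable_newton hd).integrable_smul_left_of_hasCompactSupport hΔ hΔc).norm ?_
    · filter_upwards [self_mem_nhdsWithin] with ε hε
      exact ((contDiff_newtonReg hε).continuous.mul hΔ).aestronglyMeasurable
    · filter_upwards [self_mem_nhdsWithin] with ε (hε : 0 < ε)
      have h0 : ∀ᵐ z : Eu d, z ≠ 0 := by simp [ae_iff]
      filter_upwards [h0] with z hz
      rw [norm_mul, smul_eq_mul, norm_mul, mul_comm]
      refine mul_le_mul_of_nonneg_left ?_ (norm_nonneg _)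
      have hz' : 0 < ‖z‖ := norm_pos_iff.2 hz
      rw [newton_eq hd, newtonReg, norm_mul, norm_mul]
      refine mul_le_mul_of_nonneg_left ?_ (norm_nonneg _)
      rw [Real.norm_of_nonneg (by positivity), Real.norm_of_nonneg (by positivity)]
      -- The exponent is negative, so adding ε² to the base decreases the kernel: the Newton kernel
      -- itself is the dominating function.
      exact Real.rpow_le_rpow_of_nonpos (by positivity) (by nlinarith) (by linarith)
    · have h0 : ∀ᵐ z : Eu d, z ≠ 0 := by simp [ae_iff]
      filter_upwards [h0] with z hz
      have hz' : 0 < ‖z‖ := norm_pos_iff.2 hz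
      refine Filter.Tendsto.mul_const _ ?_
      rw [newton_eq hd]
      refine Filter.Tendsto.const_mul _ (Filter.Tendsto.rpow_const ?_ (Or.inl (by positivity)))
      have : Filter.Tendsto (fun ε : ℝ => ‖z‖ ^ 2 + ε ^ 2) (𝓝 0) (𝓝 (‖z‖ ^ 2 + 0 ^ 2)) :=
        (by fun_prop : Continuous fun ε : ℝ => ‖z‖ ^ 2 + ε ^ 2).tendsto 0
      rw [zero_pow two_ne_zero, add_zero] at this
      exact this.mono_left nhdsWithin_le_nhds
  -- the regularized integrals are averages of `f`
  have heq : ∀ ε : ℝ, 0 < ε →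
      ∫ z, newtonReg d ε z * Δ f z = -∫ w, bubble d w * f (ε • w) := by
    intro ε hε
    rw [integral_mul_laplacian (contDiff_newtonReg hε) hf hfc]
    have h := Measure.integral_comp_smul (volume : Measure (Eu d))
      (fun z => Δ (newtonReg d ε) z * f z) ε
    simp only [laplacian_newtonReg hε, finrank_euclideanSpace, Fintype.card_fin,
      smul_eq_mul] at h
    have hc : |(ε ^ d)⁻¹| ≠ 0 := by positivity
    have h' : ∫ w : Eu d, -(|(ε ^ d)⁻¹| * bubble d w) * f (ε • w) =
        |(ε ^ d)⁻¹| * -∫ w, bubble d w * f (ε • w) := by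
      rw [← integral_neg, ← integral_const_mul]
      congr 1
      ext w
      ring
    rw [h'] at h
    exact (mul_left_cancel₀ hc h).symm
  obtain ⟨C, hC⟩ := hf.continuous.bounded_above_of_compact_support hfc
  have hlim2 : Filter.Tendsto (fun ε : ℝ => ∫ w, bubble d w * f (ε • w)) (𝓝[>] 0)
      (𝓝 (∫ w, bubble d w * f 0)) := by
    refine tendsto_integral_filter_of_dominated_convergence (fun w => ‖bubble d w‖ * C) ?_ ?_
      ((integrable_bubble hd).norm.mul_const C) ?_
    · exact .of_forall fun ε => (integrable_bubble hd).aestronglyMeasurable.mul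
        (hf.continuous.comp (by fun_prop)).aestronglyMeasurable
    · refine .of_forall fun ε => .of_forall fun w => ?_
      rw [norm_mul]
      exact mul_le_mul_of_nonneg_left (hC _) (norm_nonneg _)
    · refine .of_forall fun w => Filter.Tendsto.const_mul _ ?_
      have : Filter.Tendsto (fun ε : ℝ => f (ε • w)) (𝓝 0) (𝓝 (f ((0 : ℝ) • w))) :=
        (hf.continuous.comp (by fun_prop : Continuous fun ε : ℝ => ε • w)).tendsto 0
      rw [zero_smul] at this
      exact this.mono_left nhdsWithin_le_nhds
  rw [integral_mul_const, integral_bubble hd, one_mul] at hlim2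
  refine tendsto_nhds_unique hlim1 (hlim2.neg.congr' ?_)
  filter_upwards [self_mem_nhdsWithin] with ε hε
  exact (heq ε hε).symm

end Newton

end

end ConformalDisk

/-! ### Convolutions, potentials and mollification of harmonic functions -/

namespace ConformalDisk

noncomputable section

section Convolution

variable {d : ℕ}

/-- The convolution of two functions on `ℝᵈ`. -/
def conv (g f : Eu d → ℝ) : Eu d → ℝ :=
  convolution g f (ContinuousLinearMap.mul ℝ ℝ) volume

lemma conv_apply (g f : Eu d → ℝ) (x : Eu d) : conv g f x = ∫ y, g y * f (x - y) := rfl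

lemma conv_apply_swap (g f : Eu d → ℝ) (x : Eu d) : conv g f x = ∫ y, g (x - y) * f y :=
  convolution_mul_swap

lemma conv_contDiff {g f : Eu d → ℝ} (hg : LocallyIntegrable g) (hf : ContDiff ℝ ∞ f)
    (hfc : HasCompactSupport f) : ContDiff ℝ ∞ (conv g f) :=
  hfc.contDiff_convolution_right _ hg hf

lemma dirDeriv_conv {g f : Eu d → ℝ} (hg : LocallyIntegrable g) (hf : ContDiff ℝ ∞ f)
    (hfc : HasCompactSupport f) (v : Eu d) : dirDeriv v (conv g f) = conv g (dirDeriv v f) := by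
  ext x
  have h := hfc.hasFDerivAt_convolution_right (ContinuousLinearMap.mul ℝ ℝ) hg
    (hf.of_le (WithTop.coe_le_coe.2 (le_top : (1 : ℕ∞) ≤ ⊤))) x
  simp only [dirDeriv, conv]
  rw [h.fderiv, convolution_precompR_apply _ hg (hfc.fderiv ℝ) (hf.continuous_fderiv (by simp))]
  rfl

lemma laplacian_eq_sum_of_contDiff {f : Eu d → ℝ} (hf : ContDiff ℝ ∞ f) (x : Eu d) :
    Δ f x = ∑ i, dirDeriv (basisVec i) (dirDeriv (basisVec i) f) x :=
  laplacian_eq_sum (contDiffAt_two isOpen_univ hf.contDiffOn (Set.mem_univ x))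

lemma integrable_mul_comp_sub {g f : Eu d → ℝ} (hg : LocallyIntegrable g) (hf : Continuous f)
    (hfc : HasCompactSupport f) (x : Eu d) : Integrable fun y => g y * f (x - y) :=
  hfc.convolutionExists_right (ContinuousLinearMap.mul ℝ ℝ) hg hf x

lemma laplacian_conv {g f : Eu d → ℝ} (hg : LocallyIntegrable g) (hf : ContDiff ℝ ∞ f)
    (hfc : HasCompactSupport f) : Δ (conv g f) = conv g (Δ f) := by
  ext x
  have hc : ∀ v, HasCompactSupport (dirDeriv v f) := fun v => hfc.fderiv_apply ℝ v
  rw [laplacian_eq_sum_of_contDiff (conv_contDiff hg hf hfc), conv_apply]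
  simp_rw [laplacian_eq_sum_of_contDiff hf, Finset.mul_sum]
  rw [integral_finsetSum _ fun i _ => integrable_mul_comp_sub hg
    (dirDeriv_contDiff (dirDeriv_contDiff hf _) _).continuous ((hc _).fderiv_apply ℝ _) x]
  refine Finset.sum_congr rfl fun i _ => ?_
  rw [dirDeriv_conv hg hf hfc, dirDeriv_conv hg (dirDeriv_contDiff hf _) (hc _), conv_apply]

lemma hasCompactSupport_comp_sub {f : Eu d → ℝ} (hfc : HasCompactSupport f) (x : Eu d) :
    HasCompactSupport fun y => f (x - y) :=
  hfc.comp_homeomorph (Homeomorph.subLeft x)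

lemma contDiff_comp_sub {f : Eu d → ℝ} (hf : ContDiff ℝ ∞ f) (x : Eu d) :
    ContDiff ℝ ∞ fun y => f (x - y) := hf.comp (contDiff_const.sub contDiff_id)

lemma conv_newton_laplacian (hd : 3 ≤ d) {f : Eu d → ℝ} (hf : ContDiff ℝ ∞ f)
    (hfc : HasCompactSupport f) : conv (newton d) (Δ f) = -f := by
  ext x
  have h := integral_newton_mul_laplacian hd (contDiff_comp_sub hf x)
    (hasCompactSupport_comp_sub hfc x)
  simp_rw [laplacian_comp_sub isOpen_univ hf.contDiffOn x (Set.mem_univ _)] at h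
  rw [conv_apply, h, sub_zero]
  rfl

lemma laplacian_conv_newton (hd : 3 ≤ d) {f : Eu d → ℝ} (hf : ContDiff ℝ ∞ f)
    (hfc : HasCompactSupport f) : Δ (conv (newton d) f) = -f := by
  rw [laplacian_conv (locallyIntegrable_newton hd) hf hfc, conv_newton_laplacian hd hf hfc]

/-- A smooth kernel with support in the `ε`-ball which reproduces harmonic functions. -/
lemma exists_reproducing_kernel (hd : 3 ≤ d) {ε : ℝ} (hε : 0 < ε) :
    ∃ η : Eu d → ℝ, ContDiff ℝ ∞ η ∧ HasCompactSupport η ∧ (∀ z, ε ≤ ‖z‖ → η z = 0) ∧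
      ∀ (U : Set (Eu d)) (u : Eu d → ℝ), IsOpen U → ContDiffOn ℝ ∞ u U → (∀ x ∈ U, Δ u x = 0) →
        ∀ x, Metric.closedBall x ε ⊆ U → ∫ y, η (x - y) * u y = u x := by
  -- The singularity of N is cut out: k = (1 - χ) N is smooth and equals N for ‖z‖ ≥ ε/2. The
  -- reproducing kernel is -Δk, which vanishes where k agrees with the harmonic function N.
  let χ : ContDiffBump (0 : Eu d) := ⟨ε / 3, ε / 2, by positivity, by linarith⟩
  let k : Eu d → ℝ := fun z => (1 - χ z) * newton d z
  have hk0 : ∀ z ∈ Metric.ball (0 : Eu d) (ε / 3), k z = 0 := fun z hz => by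
    simp only [k]
    rw [χ.one_of_mem_closedBall (Metric.ball_subset_closedBall hz)]
    ring
  have hk1 : ∀ z, ε / 2 ≤ ‖z‖ → k z = newton d z := fun z hz => by
    simp only [k]
    rw [χ.zero_of_le_dist (by simpa using hz)]
    ring
  have hk : ContDiff ℝ ∞ k := by
    refine contDiff_iff_contDiffAt.2 fun z => ?_
    by_cases hz : z = 0
    · have h : k =ᶠ[𝓝 z] fun _ => 0 := Filter.eventually_of_mem
        (Metric.isOpen_ball.mem_nhds (by rw [hz]; exact Metric.mem_ball_self (by positivity))) hk0
      exact contDiffAt_const.congr_of_eventuallyEq h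
    · exact (contDiffAt_const.sub χ.contDiff.contDiffAt).mul
        ((contDiffOn_newton hd).contDiffAt (isOpen_compl_singleton.mem_nhds hz))
  have hη0 : ∀ z, ε ≤ ‖z‖ → Δ k z = 0 := fun z hz => by
    have hU : IsOpen {z : Eu d | ε / 2 < ‖z‖} := isOpen_lt continuous_const continuous_norm
    have hzU : ε / 2 < ‖z‖ := by linarith
    have h : k =ᶠ[𝓝 z] newton d :=
      Filter.eventually_of_mem (hU.mem_nhds hzU) fun y hy => hk1 y (le_of_lt hy)
    rw [(laplacian_congr_nhds h).eq_of_nhds]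
    exact laplacian_newton hd (norm_pos_iff.1 (by linarith))
  refine ⟨-Δ k, (laplacian_contDiff hk).neg, ?_, fun z hz => by simp [hη0 z hz], ?_⟩
  · refine HasCompactSupport.intro (isCompact_closedBall (0 : Eu d) ε) fun z hz => ?_
    rw [mem_closedBall_zero_iff, not_le] at hz
    simp [hη0 z hz.le]
  · intro U u hU hu hu0 x hx
    obtain ⟨f, V, hf, hfc, -, hV, hKV, hVU, hfu⟩ :=
      exists_cutoff (isCompact_closedBall x ε) hU hx hu
    have hΔf : ∀ y ∈ Metric.closedBall x ε, Δ f y = 0 := fun y hy => by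
      rw [(laplacian_congr_nhds (Filter.eventually_of_mem (hV.mem_nhds (hKV hy)) hfu)).eq_of_nhds]
      exact hu0 y (hx hy)
    -- The kernels k and N differ only for ‖z‖ < ε/2, where x - z lies in the ball on which Δf = 0.
    -- Hence k may replace N in N ∗ Δf = -f.
    have h1 : ∫ z, k z * Δ f (x - z) = -f x := by
      have h := congrFun (conv_newton_laplacian hd hf hfc) x
      rw [conv_apply] at h
      rw [← Pi.neg_apply, ← h]
      congr 1
      ext z
      by_cases hz : ε / 2 ≤ ‖z‖
      · rw [hk1 z hz]
      · rw [hΔf (x - z), mul_zero, mul_zero]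
        rw [Metric.mem_closedBall, dist_eq_norm, sub_sub_cancel_left, norm_neg]
        linarith
    have h2 := integral_mul_laplacian hk (contDiff_comp_sub hf x) (hasCompactSupport_comp_sub hfc x)
    simp_rw [laplacian_comp_sub isOpen_univ hf.contDiffOn x (Set.mem_univ _)] at h2
    have h3 : ∀ y, (-Δ k) (x - y) * u y = -(Δ k (x - y) * f y) := fun y => by
      rw [Pi.neg_apply]
      by_cases hy : y ∈ Metric.closedBall x ε
      · rw [hfu (hKV hy), neg_mul]
      · rw [hη0 (x - y)]
        · simp
        · rw [Metric.mem_closedBall, dist_comm, dist_eq_norm] at hy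
          linarith
    have h4 : ∫ y, Δ k (x - y) * f y = ∫ z, Δ k z * f (x - z) := convolution_mul_swap.symm
    simp_rw [h3]
    rw [integral_neg, h4, ← h2, h1, neg_neg, hfu (hKV (Metric.mem_closedBall_self hε.le))]

/-- Induction over the first order factors of `∂^α`. -/
lemma multiDeriv_induction {P : ((Eu d → ℝ) → Eu d → ℝ) → ℕ → Prop} (hid : P id 0)
    (hcomp : ∀ S T m n, P S m → P T n → P (S ∘ T) (m + n))
    (hD : ∀ i, P (dirDeriv (basisVec i)) 1) (α : Fin d → ℕ) : P (multiDeriv α) (∑ i, α i) := by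
  have hiter : ∀ i k, P ((dirDeriv (basisVec i))^[k]) k := by
    intro i k
    induction k with
    | zero => exact hid
    | succ k ih => exact hcomp _ _ _ _ ih (hD i)
  have hl : ∀ l : List (Fin d), P (fun f => l.foldr
      (fun i g => (fun h x => fderiv ℝ h x (EuclideanSpace.single i (1 : ℝ)))^[α i] g) f)
      (l.map α).sum := by
    intro l
    induction l with
    | nil => exact hid
    | cons i l ih => exact hcomp _ _ _ _ (hiter i (α i)) ih
  rw [Fin.sum_univ_def]
  exact hl _

lemma multiDeriv_congr {U : Set (Eu d)} (hU : IsOpen U) {f g : Eu d → ℝ} (h : Set.EqOn f g U)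
    (α : Fin d → ℕ) : Set.EqOn (multiDeriv α f) (multiDeriv α g) U :=
  multiDeriv_induction (P := fun T _ => ∀ f g, Set.EqOn f g U → Set.EqOn (T f) (T g) U)
    (fun _ _ h => h) (fun _ _ _ _ hS hT f g h => hS _ _ (hT f g h))
    (fun _ _ _ h => dirDeriv_congr hU h _) α f g h

lemma multiDeriv_zero (f : Eu d → ℝ) : multiDeriv 0 f = f := by
  have h : ∀ l : List (Fin d), l.foldr
      (fun i g => (fun h x => fderiv ℝ h x (EuclideanSpace.single i (1 : ℝ)))^[0] g) f = f := by
    intro l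
    induction l with
    | nil => rfl
    | cons i l ih => simp
  exact h _

lemma multiDeriv_conv {g f : Eu d → ℝ} (hg : LocallyIntegrable g) (hf : ContDiff ℝ ∞ f)
    (hfc : HasCompactSupport f) (α : Fin d → ℕ) :
    ContDiff ℝ ∞ (multiDeriv α f) ∧ HasCompactSupport (multiDeriv α f) ∧
      multiDeriv α (conv g f) = conv g (multiDeriv α f) :=
  multiDeriv_induction (P := fun T _ => ∀ f, ContDiff ℝ ∞ f → HasCompactSupport f →
      ContDiff ℝ ∞ (T f) ∧ HasCompactSupport (T f) ∧ T (conv g f) = conv g (T f))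
    (fun _ hf hfc => ⟨hf, hfc, rfl⟩)
    (fun S T _ _ hS hT f hf hfc => by
      obtain ⟨h1, h2, h3⟩ := hT f hf hfc
      obtain ⟨h4, h5, h6⟩ := hS _ h1 h2
      exact ⟨h4, h5, by rw [Function.comp_apply, h3, h6]; rfl⟩)
    (fun i f hf hfc => ⟨dirDeriv_contDiff hf _, hfc.fderiv_apply ℝ _, dirDeriv_conv hg hf hfc _⟩)
    α f hf hfc

/-- The compact ball of radius `r < 1` in the disk. -/
lemma exists_radius {K : Set (Eu d)} (hK : IsCompact K) (hKD : K ⊆ disk d) :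
    ∃ r, 0 ≤ r ∧ r < 1 ∧ K ⊆ Metric.closedBall 0 r := by
  obtain rfl | hne := K.eq_empty_or_nonempty
  · exact ⟨0, le_rfl, one_pos, Set.empty_subset _⟩
  · obtain ⟨x, hx, hmax⟩ := hK.exists_isMaxOn hne continuous_norm.continuousOn
    exact ⟨‖x‖, norm_nonneg x, mem_ball_zero_iff.1 (hKD hx), fun y hy =>
      mem_closedBall_zero_iff.2 (hmax hy)⟩

lemma closedBall_subset_disk {r : ℝ} (hr : r < 1) :
    Metric.closedBall (0 : Eu d) r ⊆ disk d := Metric.closedBall_subset_ball hr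

/-- A harmonic function, truncated to a compact ball, is locally integrable. -/
lemma integrable_indicator_harm (u : Harm d) {r : ℝ} (hr : r < 1) :
    Integrable ((Metric.closedBall (0 : Eu d) r).indicator (zeroExt u)) :=
  (integrable_indicator_iff Metric.isClosed_closedBall.measurableSet).2
    ((u.2.1.continuousOn.mono (closedBall_subset_disk hr)).integrableOn_compact
      (isCompact_closedBall _ _))

/-- Interior derivative estimates for harmonic functions. -/
lemma exists_harmSeminorm_le (hd : 3 ≤ d)
    (p : TopologicalSpace.Compacts (disk d) × (Fin d → ℕ)) :
    ∃ r C : ℝ, 0 ≤ r ∧ r < 1 ∧ 0 ≤ C ∧ ∀ (u : Harm d) (M : ℝ), 0 ≤ M →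
      (∀ y : disk d, ‖(y : Eu d)‖ ≤ r → |u y| ≤ M) → harmSeminorm d p u ≤ C * M := by
  obtain ⟨K, α⟩ := p
  obtain ⟨r, hr0, hr, hKr⟩ := exists_radius (K := Subtype.val '' (K : Set (disk d)))
    (K.isCompact.image continuous_subtype_val) (by rintro _ ⟨x, -, rfl⟩; exact x.2)
  have hε : 0 < (1 - r) / 4 := by linarith
  obtain ⟨η, hη, hηc, hη0, hηu⟩ := exists_reproducing_kernel hd hε
  set ε := (1 - r) / 4 with hεdef
  have hr2 : r + 2 * ε < 1 := by linarith
  refine ⟨r + 2 * ε, ∫ z, ‖multiDeriv α η z‖, by positivity, hr2,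
    integral_nonneg fun _ => norm_nonneg _, fun u M hM hu => ?_⟩
  -- Truncation makes u globally integrable. For ‖x‖ < r + ε the kernel reaches only points of norm
  -- at most r + 2ε, so u = w ∗ η near K. All derivatives then fall on η, and the L¹ norm of ∂^α η
  -- is the constant.
  set w := (Metric.closedBall (0 : Eu d) (r + 2 * ε)).indicator (zeroExt u) with hw
  have hwi : Integrable w := integrable_indicator_harm u hr2
  obtain ⟨h1, h2, h3⟩ := multiDeriv_conv hwi.locallyIntegrable hη hηc α
  have hwM : ∀ y, ‖w y‖ ≤ M := fun y => by
    by_cases hy : y ∈ Metric.closedBall (0 : Eu d) (r + 2 * ε)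
    · rw [hw, Set.indicator_of_mem hy]
      have h := zeroExt_apply u ⟨y, closedBall_subset_disk hr2 hy⟩
      dsimp only at h
      rw [h]
      exact hu _ (mem_closedBall_zero_iff.1 hy)
    · rw [hw, Set.indicator_of_notMem hy, norm_zero]
      exact hM
  have heq : Set.EqOn (zeroExt u) (conv w η) (Metric.ball 0 (r + ε)) := fun x hx => by
    have hxn := mem_ball_zero_iff.1 hx
    have hsub : Metric.closedBall x ε ⊆ Metric.closedBall 0 (r + 2 * ε) := fun y hy => by
      rw [mem_closedBall_zero_iff]
      have := norm_le_norm_add_norm_sub' y x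
      rw [Metric.mem_closedBall, dist_eq_norm] at hy
      linarith
    rw [conv_apply, ← hηu (disk d) (zeroExt u) (disk d).isOpen u.2.1 u.2.2 x
      (hsub.trans (closedBall_subset_disk hr2))]
    congr 1
    ext y
    by_cases hy : y ∈ Metric.closedBall (0 : Eu d) (r + 2 * ε)
    · rw [hw, Set.indicator_of_mem hy, mul_comm]
    · rw [hw, Set.indicator_of_notMem hy, hη0 (x - y)]
      · ring
      · by_contra h
        refine hy (hsub ?_)
        rw [Metric.mem_closedBall, dist_comm, dist_eq_norm]
        linarith
  change ‖restrictDeriv K α u‖ ≤ _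
  rw [ContinuousMap.norm_le _ (mul_nonneg (integral_nonneg fun _ => norm_nonneg _) hM)]
  intro x
  change ‖multiDeriv α (zeroExt u) ((x : disk d) : Eu d)‖ ≤ _
  have hx : ((x : disk d) : Eu d) ∈ Metric.ball (0 : Eu d) (r + ε) := by
    have := mem_closedBall_zero_iff.1 (hKr ⟨x, x.2, rfl⟩)
    rw [mem_ball_zero_iff]
    linarith
  rw [multiDeriv_congr Metric.isOpen_ball heq α hx, h3, conv_apply_swap]
  refine (norm_integral_le_of_norm_le ((h1.continuous.integrable_of_hasCompactSupport h2).norm.mul_const M)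
    (.of_forall fun y => ?_)).trans (integral_mul_const _ _).le
  rw [norm_mul, mul_comm]
  exact mul_le_mul_of_nonneg_left (hwM _) (norm_nonneg _)

end Convolution

/-! ### The pairing of test functions with harmonic functions, and its surjectivity -/

section Pairing

variable {d : ℕ}

lemma integrable_test_mul_harm (f : Test d) (u : Harm d) :
    Integrable fun x => f x * zeroExt u x := by
  have hc : ContinuousOn (fun x => f x * zeroExt u x) (tsupport f) :=
    f.continuous.continuousOn.mul (u.2.1.continuousOn.mono f.tsupport_subset)
  refine (integrableOn_iff_integrable_of_support_subset fun x hx => ?_).1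
    (hc.integrableOn_compact f.hasCompactSupport)
  by_contra h
  exact hx (by simp only [image_eq_zero_of_notMem_tsupport h, zero_mul])

/-- The functional `u ↦ ∫ f u` on harmonic functions. -/
def pairingLin (f : Test d) : Harm d →ₗ[ℝ] ℝ where
  toFun u := ∫ x, f x * zeroExt u x
  map_add' u v := by
    rw [← integral_add (integrable_test_mul_harm f u) (integrable_test_mul_harm f v)]
    congr 1
    ext x
    change f x * zeroExt (u.1 + v.1) x = _
    rw [zeroExt_add, Pi.add_apply, mul_add]
  map_smul' c u := by
    rw [RingHom.id_apply, smul_eq_mul, ← integral_const_mul]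
    congr 1
    ext x
    change f x * zeroExt (c • u.1) x = _
    rw [zeroExt_smul, Pi.smul_apply, smul_eq_mul]
    ring

lemma abs_le_harmSeminorm (u : Harm d) (K : TopologicalSpace.Compacts (disk d)) {x : disk d}
    (hx : x ∈ K) : |u x| ≤ harmSeminorm d (K, 0) u := by
  have h := (restrictDeriv K 0 u).norm_coe_le_norm ⟨x, hx⟩
  change ‖multiDeriv 0 (zeroExt u) x‖ ≤ _ at h
  rw [multiDeriv_zero, zeroExt_apply] at h
  exact h

lemma continuous_pairingLin (f : Test d) : Continuous (pairingLin f) := by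
  have hK : IsCompact (Subtype.val ⁻¹' tsupport f : Set (disk d)) := by
    rw [Topology.IsEmbedding.subtypeVal.isCompact_iff, Set.image_preimage_eq_of_subset]
    · exact f.hasCompactSupport
    · rw [Subtype.range_coe_subtype]; exact f.tsupport_subset
  have hi : Integrable fun x => ‖f x‖ :=
    (f.continuous.integrable_of_hasCompactSupport f.hasCompactSupport).norm
  refine (harm_withSeminorms d).continuous_normedSpace_rng ℝ (pairingLin f)
    ⟨{(⟨_, hK⟩, 0)}, ⟨∫ x, ‖f x‖, integral_nonneg fun _ => norm_nonneg _⟩, fun u => ?_⟩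
  rw [Finset.sup_singleton]
  change ‖∫ x, f x * zeroExt u x‖ ≤ (∫ x, ‖f x‖) * harmSeminorm d _ u
  rw [← integral_mul_const]
  refine norm_integral_le_of_norm_le (hi.mul_const _) (.of_forall fun x => ?_)
  rw [norm_mul]
  by_cases hx : x ∈ tsupport f
  · refine mul_le_mul_of_nonneg_left ?_ (norm_nonneg _)
    have hx' : x ∈ disk d := f.tsupport_subset hx
    have h := zeroExt_apply u ⟨x, hx'⟩
    dsimp only at h
    rw [h]
    exact abs_le_harmSeminorm u ⟨_, hK⟩ (x := ⟨x, hx'⟩) hx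
  · simp [image_eq_zero_of_notMem_tsupport hx]

/-- The map `C_c^∞(𝔻) → H'(𝔻)`, `f ↦ (u ↦ ∫ f u)`. -/
def pairing (d : ℕ) : Test d →ₗ[ℝ] HDual d where
  toFun f := ⟨pairingLin f, continuous_pairingLin f⟩
  map_add' f g := by
    ext u
    change ∫ x, (f + g) x * zeroExt u x = (∫ x, f x * zeroExt u x) + ∫ x, g x * zeroExt u x
    rw [← integral_add (integrable_test_mul_harm f u) (integrable_test_mul_harm g u)]
    congr 1
    ext x
    exact add_mul _ _ _
  map_smul' c f := by
    ext u
    change ∫ x, (c • f) x * zeroExt u x = c * ∫ x, f x * zeroExt u x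
    rw [← integral_const_mul]
    congr 1
    ext x
    exact mul_assoc _ _ _

lemma pairing_apply (f : Test d) (u : Harm d) : pairing d f u = ∫ x, f x * zeroExt u x := rfl

lemma pairing_testL (h : Test d) : pairing d (testL d h) = 0 := by
  ext u
  rw [pairing_apply, integral_testL_mul (disk d).isOpen u.2.1 h h.tsupport_subset]
  have e : ∀ x, h x * Δ (zeroExt u) x = 0 := fun x => by
    by_cases hx : x ∈ disk d
    · rw [u.2.2 x hx, mul_zero]
    · rw [test_eq_zero h hx, zero_mul]
  simp_rw [e]
  simp

/-- A functional bounded by a seminorm `‖J v‖` factors through `J` continuously. -/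
lemma exists_factor_of_bound {V E : Type*} [AddCommGroup V] [Module ℝ V]
    [NormedAddCommGroup E] [NormedSpace ℝ E] (J : V →ₗ[ℝ] E) (l : V →ₗ[ℝ] ℝ) (C : ℝ)
    (h : ∀ v, |l v| ≤ C * ‖J v‖) : ∃ M : E →L[ℝ] ℝ, ∀ v, M (J v) = l v := by
  have hker : LinearMap.ker J ≤ LinearMap.ker l := fun v hv => by
    have h1 := h v
    rw [LinearMap.mem_ker.1 hv, norm_zero, mul_zero] at h1
    exact abs_nonpos_iff.1 h1
  let g : LinearMap.range J →ₗ[ℝ] ℝ :=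
    (LinearMap.ker J).liftQ l hker ∘ₗ J.quotKerEquivRange.symm.toLinearMap
  have hg : ∀ v, g ⟨J v, v, rfl⟩ = l v := fun v => by
    change (LinearMap.ker J).liftQ l hker (J.quotKerEquivRange.symm ⟨J v, v, rfl⟩) = l v
    rw [J.quotKerEquivRange_symm_apply_image v ⟨v, rfl⟩]
    rfl
  let g' : LinearMap.range J →L[ℝ] ℝ := g.mkContinuous C (by
    rintro ⟨_, v, rfl⟩
    rw [hg]
    exact h v)
  obtain ⟨M, hM, -⟩ := exists_extension_norm_eq (LinearMap.range J) g'
  exact ⟨M, fun v => (hM ⟨J v, v, rfl⟩).trans (hg v)⟩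

/-- Continuity bounds l by finitely many derivative seminorms, and the interior estimates bound each
of them by a supremum over a compact ball. The largest of the finitely many radii is still less than
one. -/
lemma HDual.exists_bound (hd : 3 ≤ d) (l : HDual d) :
    ∃ r C : ℝ, 0 ≤ r ∧ r < 1 ∧ 0 ≤ C ∧ ∀ (u : Harm d) (M : ℝ), 0 ≤ M →
      (∀ y : disk d, ‖(y : Eu d)‖ ≤ r → |u y| ≤ M) → |l u| ≤ C * M := by
  obtain ⟨s, C, -, hC⟩ := Seminorm.bound_of_continuous (harm_withSeminorms d)
    ((normSeminorm ℝ ℝ).comp l.toLinearMap) (continuous_norm.comp l.continuous)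
  have hs : ∃ r C : ℝ, 0 ≤ r ∧ r < 1 ∧ 0 ≤ C ∧ ∀ (u : Harm d) (M : ℝ), 0 ≤ M →
      (∀ y : disk d, ‖(y : Eu d)‖ ≤ r → |u y| ≤ M) → s.sup (harmSeminorm d) u ≤ C * M := by
    clear hC
    induction s using Finset.cons_induction with
    | empty => exact ⟨0, 0, le_rfl, one_pos, le_rfl, fun u M _ _ => by simp⟩
    | cons p s hp ih =>
      obtain ⟨r, C, hr0, hr, hC0, h⟩ := ih
      obtain ⟨r', C', hr0', hr', hC0', h'⟩ := exists_harmSeminorm_le hd p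
      refine ⟨max r r', max C C', le_max_of_le_left hr0, max_lt hr hr', le_max_of_le_left hC0,
        fun u M hM hu => ?_⟩
      rw [Finset.sup_cons, Seminorm.sup_apply]
      refine sup_le ?_ ?_
      · exact (h' u M hM fun y hy => hu y (hy.trans (le_max_right _ _))).trans
          (mul_le_mul_of_nonneg_right (le_max_right _ _) hM)
      · exact (h u M hM fun y hy => hu y (hy.trans (le_max_left _ _))).trans
          (mul_le_mul_of_nonneg_right (le_max_left _ _) hM)
  obtain ⟨r, C', hr0, hr, hC0, h⟩ := hs
  refine ⟨r, C * C', hr0, hr, by positivity, fun u M hM hu => ?_⟩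
  refine (hC u).trans ?_
  change (C : ℝ) * _ ≤ _
  rw [mul_assoc]
  exact mul_le_mul_of_nonneg_left (h u M hM hu) C.2

/-- The functional is bounded by a supremum over a compact ball K, so it factors through restriction
to K and extends by Hahn–Banach to some M on C(K). Applying M to the reproducing formula u = ∫ u(y)
η(· - y) dy represents l by the continuous density F(y) = M(η(· - y)). Only continuity of F is
evident, so F is mollified by η once more, which does not change its integrals against harmonic
functions. -/
lemma pairing_surjective (hd : 3 ≤ d) : Function.Surjective (pairing d) := by
  intro l
  obtain ⟨r, C, hr0, hr, hC0, hl⟩ := HDual.exists_bound hd l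
  have hε : 0 < (1 - r) / 4 := by linarith
  obtain ⟨η, hη, hηc, hη0, hηu⟩ := exists_reproducing_kernel hd hε
  set ε := (1 - r) / 4 with hεdef
  have hr1 : r + ε < 1 := by linarith
  have hr2 : r + 2 * ε < 1 := by linarith
  have hball : ∀ {x : Eu d} {s : ℝ}, ‖x‖ ≤ s →
      Metric.closedBall x ε ⊆ Metric.closedBall 0 (s + ε) := fun {x s} hx y hy => by
    rw [mem_closedBall_zero_iff]
    have := norm_le_norm_add_norm_sub' y x
    rw [Metric.mem_closedBall, dist_eq_norm] at hy
    linarith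
  have hη1 : ∀ {x y : Eu d} {s : ℝ}, ‖x‖ ≤ s → s + ε < ‖y‖ → η (x - y) = 0 := by
    intro x y s hx hy
    refine hη0 _ ?_
    have := norm_le_norm_add_norm_sub' y x
    rw [norm_sub_rev] at this
    linarith
  -- the functional extends to continuous functions on the ball of radius `r`
  let K := Metric.closedBall (0 : Eu d) r
  have : CompactSpace K := isCompact_iff_compactSpace.1 (isCompact_closedBall _ _)
  let J : Harm d →ₗ[ℝ] C(K, ℝ) :=
    { toFun := fun u => ⟨fun x => zeroExt u x, continuousOn_iff_continuous_domRestrict.1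
        (u.2.1.continuousOn.mono (closedBall_subset_disk hr))⟩
      map_add' := fun u v => by
        ext x
        exact congrFun (zeroExt_add u.1 v.1) x
      map_smul' := fun c u => by
        ext x
        exact congrFun (zeroExt_smul c u.1) x }
  obtain ⟨M, hM⟩ := exists_factor_of_bound J l.toLinearMap C fun u => by
    refine hl u ‖J u‖ (norm_nonneg _) fun y hy => ?_
    have h := (J u).norm_coe_le_norm ⟨y, mem_closedBall_zero_iff.2 hy⟩
    change ‖zeroExt u y‖ ≤ _ at h
    rwa [zeroExt_apply] at h
  let κ : C(Eu d, C(K, ℝ)) := ContinuousMap.curry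
    ⟨fun p : Eu d × K => η ((p.2 : Eu d) - p.1), hη.continuous.comp (by fun_prop)⟩
  have hκ : ∀ y x, κ y x = η ((x : Eu d) - y) := fun _ _ => rfl
  let F : Eu d → ℝ := fun y => M (κ y)
  have hF : Continuous F := M.continuous.comp κ.continuous
  have hF0 : ∀ y, r + ε < ‖y‖ → F y = 0 := fun y hy => by
    have : κ y = 0 := by
      ext x
      rw [hκ]
      exact hη1 (mem_closedBall_zero_iff.1 x.2) hy
    simp only [F, this, map_zero]
  have hFc : HasCompactSupport F :=
    HasCompactSupport.intro (isCompact_closedBall (0 : Eu d) (r + ε)) fun y hy =>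
      hF0 y (by rwa [mem_closedBall_zero_iff, not_le] at hy)
  -- The restriction of u to K is the C(K)-valued integral of u(y) κ(y), and the continuous
  -- functional M passes under that integral.
  have hlF : ∀ u : Harm d, l u = ∫ y, F y * zeroExt u y := by
    intro u
    have hint : IntegrableOn (fun y => zeroExt u y • κ y) (Metric.closedBall 0 (r + ε)) :=
      ((u.2.1.continuousOn.mono (closedBall_subset_disk hr1)).smul
        κ.continuous.continuousOn).integrableOn_compact (isCompact_closedBall _ _)
    have hJ : J u = ∫ y in Metric.closedBall (0 : Eu d) (r + ε), zeroExt u y • κ y := by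
      ext x
      have hx := mem_closedBall_zero_iff.1 x.2
      have h1 := (ContinuousMap.evalCLM ℝ x).integral_comp_comm hint
      change _ = ContinuousMap.evalCLM ℝ x (∫ y in _, zeroExt u y • κ y)
      rw [← h1]
      change zeroExt u x = ∫ y in _, zeroExt u y * η ((x : Eu d) - y)
      rw [setIntegral_eq_integral_of_forall_compl_eq_zero fun y hy => by
        rw [mem_closedBall_zero_iff, not_le] at hy
        rw [hη1 hx hy, mul_zero]]
      rw [← hηu (disk d) (zeroExt u) (disk d).isOpen u.2.1 u.2.2 x
        ((hball hx).trans (closedBall_subset_disk hr1))]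
      simp_rw [mul_comm]
    have h2 := M.integral_comp_comm hint
    rw [← hJ, hM] at h2
    change _ = l u at h2
    have h3 : ∫ y in Metric.closedBall (0 : Eu d) (r + ε), F y * zeroExt u y =
        ∫ y, F y * zeroExt u y :=
      setIntegral_eq_integral_of_forall_compl_eq_zero fun y hy => by
        rw [mem_closedBall_zero_iff, not_le] at hy
        rw [hF0 y hy, zero_mul]
    rw [← h2, ← h3]
    congr 1
    ext y
    rw [map_smul, smul_eq_mul, mul_comm]
  -- a second mollification
  let f : Eu d → ℝ := conv F fun z => η (0 - z)
  have hf_apply : ∀ z, f z = ∫ y, F y * η (y - z) := fun z => by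
    simp only [f, conv_apply]
    congr 1
    ext y
    congr 2
    abel
  have hf : ContDiff ℝ ∞ f := conv_contDiff hF.locallyIntegrable (contDiff_comp_sub hη 0)
    (hasCompactSupport_comp_sub hηc 0)
  have hf0 : ∀ z, r + 2 * ε < ‖z‖ → f z = 0 := fun z hz => by
    rw [hf_apply]
    have : ∀ y, F y * η (y - z) = 0 := fun y => by
      by_cases hy : ‖y‖ ≤ r + ε
      · rw [hη1 hy (by linarith), mul_zero]
      · rw [hF0 y (not_le.1 hy), zero_mul]
    simp_rw [this]
    simp
  have hfs : tsupport f ⊆ Metric.closedBall 0 (r + 2 * ε) :=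
    closure_minimal (fun z hz => by
      rw [mem_closedBall_zero_iff]
      by_contra h
      exact hz (hf0 z (not_le.1 h))) Metric.isClosed_closedBall
  refine ⟨mkTest f hf ((isCompact_closedBall _ _).of_isClosed_subset (isClosed_tsupport _) hfs)
    (hfs.trans (closedBall_subset_disk hr2)), ?_⟩
  ext u
  rw [pairing_apply, hlF]
  change ∫ z, f z * zeroExt u z = _
  -- The truncation justifies Fubini. For ‖y‖ ≤ r + ε, where F lives, the kernel at y does not see
  -- the truncation, so the inner integral over z reproduces u(y).
  set w := (Metric.closedBall (0 : Eu d) (r + 2 * ε)).indicator (zeroExt u) with hw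
  have hwi : Integrable w := integrable_indicator_harm u hr2
  obtain ⟨A, hA⟩ := hη.continuous.bounded_above_of_compact_support hηc
  have hprod : Integrable (fun p : Eu d × Eu d => w p.1 * F p.2 * η (p.2 - p.1))
      (volume.prod volume) :=
    (hwi.mul_prod (hF.integrable_of_hasCompactSupport hFc)).mul_bdd (c := A)
      (hη.continuous.comp (by fun_prop)).aestronglyMeasurable (.of_forall fun p => hA _)
  calc ∫ z, f z * zeroExt u z = ∫ z, ∫ y, w z * F y * η (y - z) := by
        congr 1
        ext z
        by_cases hz : z ∈ Metric.closedBall (0 : Eu d) (r + 2 * ε)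
        · simp_rw [hw, Set.indicator_of_mem hz, mul_assoc]
          rw [integral_const_mul, ← hf_apply, mul_comm]
        · rw [hf0 z (by rwa [mem_closedBall_zero_iff, not_le] at hz)]
          simp [hw, Set.indicator_of_notMem hz]
    _ = ∫ y, ∫ z, w z * F y * η (y - z) := integral_integral_swap hprod
    _ = ∫ y, F y * zeroExt u y := by
        congr 1
        ext y
        by_cases hy : ‖y‖ ≤ r + ε
        · have hsub := hball hy
          have e2 : r + ε + ε = r + 2 * ε := by ring
          rw [e2] at hsub
          rw [← hηu (disk d) (zeroExt u) (disk d).isOpen u.2.1 u.2.2 y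
            (hsub.trans (closedBall_subset_disk hr2)), ← integral_const_mul]
          congr 1
          ext z
          by_cases hz : z ∈ Metric.closedBall (0 : Eu d) (r + 2 * ε)
          · rw [hw, Set.indicator_of_mem hz]
            ring
          · rw [hw, Set.indicator_of_notMem hz, hη1 hy (by
              rw [mem_closedBall_zero_iff, not_le] at hz
              linarith)]
            ring
        · simp [hF0 y (not_le.1 hy)]

end Pairing

end

end ConformalDisk

/-! ### The duality between `C_c^∞(𝔻) / L C_c^∞(𝔻)` and harmonic functions -/

namespace ConformalDisk

noncomputable section

section Duality

variable {d : ℕ}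

lemma zeroExt_restrict {F : Type*} [Zero F] (w : Eu d → F) :
    Set.EqOn (zeroExt fun x : disk d => w x) w (disk d) :=
  fun x hx => zeroExt_apply (fun x : disk d => w x) ⟨x, hx⟩

/-- The harmonic function on the disk given by a function which is harmonic near each point of
the disk. -/
def mkHarm (w : Eu d → ℝ) (hw : ContDiffOn ℝ ∞ w (disk d)) (hw0 : ∀ x ∈ disk d, Δ w x = 0) :
    Harm d :=
  ⟨fun x => w x, hw.congr (zeroExt_restrict w), fun x hx => by
    rw [(laplacian_congr_nhds (Filter.eventually_of_mem ((disk d).isOpen.mem_nhds hx)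
      (zeroExt_restrict w))).eq_of_nhds]
    exact hw0 x hx⟩

lemma pairing_mkHarm (f : Test d) (w : Eu d → ℝ) (hw : ContDiffOn ℝ ∞ w (disk d))
    (hw0 : ∀ x ∈ disk d, Δ w x = 0) : pairing d f (mkHarm w hw hw0) = ∫ x, f x * w x := by
  rw [pairing_apply]
  congr 1
  ext x
  by_cases hx : x ∈ disk d
  · rw [show zeroExt (mkHarm w hw hw0) x = w x from zeroExt_restrict w hx]
  · rw [test_eq_zero f hx, zero_mul, zero_mul]

/-- `y ↦ N(x - y)` is harmonic away from `x`. -/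
lemma laplacian_newton_sub (hd : 3 ≤ d) {x y : Eu d} (h : y ≠ x) :
    Δ (fun y => newton d (x - y)) y = 0 := by
  have h' : x - y ≠ 0 := sub_ne_zero.2 h.symm
  rw [laplacian_comp_sub isOpen_compl_singleton (contDiffOn_newton hd) x h']
  exact laplacian_newton hd h'

/-- The polynomial `‖z θ - y‖²` in a complex parameter `z`, for a unit vector `θ`. -/
def complexNormSq (θ : Eu d) (z : ℂ) (y : Eu d) : ℂ :=
  z ^ 2 - 2 * z * ((inner ℝ θ y : ℝ) : ℂ) + ((‖y‖ ^ 2 : ℝ) : ℂ)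

lemma complexNormSq_ofReal {θ : Eu d} (hθ : ‖θ‖ = 1) (t : ℝ) (y : Eu d) :
    complexNormSq θ t y = ((‖t • θ - y‖ ^ 2 : ℝ) : ℂ) := by
  rw [norm_sub_sq_real, norm_smul, hθ, mul_one, Real.norm_eq_abs, sq_abs, inner_smul_left,
    complexNormSq]
  push_cast
  simp
  ring

lemma continuous_complexNormSq (θ : Eu d) :
    Continuous fun p : ℂ × Eu d => complexNormSq θ p.1 p.2 := by
  have h : Continuous fun p : ℂ × Eu d => (inner ℝ θ p.2 : ℝ) := continuous_const.inner continuous_snd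
  unfold complexNormSq
  exact ((continuous_fst.pow 2).sub ((continuous_const.mul continuous_fst).mul
    (Complex.continuous_ofReal.comp h))).add
      (Complex.continuous_ofReal.comp (continuous_snd.norm.pow 2))

/-- At z = t₀ the value is ‖t₀θ - y‖² ≥ (t₀ - r)² > 0. Compactness in y keeps the real part positive
on a complex disk around t₀ independent of y, so that complex powers are holomorphic in z there. -/
lemma exists_complexNormSq_mem_slitPlane {θ : Eu d} (hθ : ‖θ‖ = 1) {r t₀ : ℝ} (ht₀ : r < t₀) :
    ∃ δ > 0, ∀ z ∈ Metric.closedBall (t₀ : ℂ) δ, ∀ y ∈ Metric.closedBall (0 : Eu d) r,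
      complexNormSq θ z y ∈ Complex.slitPlane := by
  have hpos : ∀ y ∈ Metric.closedBall (0 : Eu d) r, ∀ᶠ z : ℂ × Eu d in 𝓝 ((t₀ : ℂ), y), 0 < (complexNormSq θ z.1 z.2).re := by
    intro y hy
    refine (Complex.continuous_re.comp (continuous_complexNormSq θ)).continuousAt.eventually (lt_mem_nhds ?_)
    change 0 < (complexNormSq θ t₀ y).re
    rw [complexNormSq_ofReal hθ, Complex.ofReal_re]
    have hy' := mem_closedBall_zero_iff.1 hy
    have h0 : 0 ≤ r := (norm_nonneg y).trans hy'
    have h1 := norm_sub_norm_le (t₀ • θ) y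
    rw [norm_smul, hθ, mul_one, Real.norm_of_nonneg (h0.trans ht₀.le)] at h1
    have : 0 < ‖t₀ • θ - y‖ := by linarith
    positivity
  obtain ⟨δ, hδ, hball⟩ := Metric.nhds_basis_closedBall.mem_iff.1
    ((isCompact_closedBall _ _).eventually_forall_of_forall_eventually
      (P := fun z y => 0 < (complexNormSq θ z y).re) hpos)
  exact ⟨δ, hδ, fun z hz y hy => Or.inl (hball hz y hy)⟩

lemma hasDerivAt_complexNormSq (θ y : Eu d) (z : ℂ) :
    HasDerivAt (fun z => complexNormSq θ z y) (2 * z - 2 * ((inner ℝ θ y : ℝ) : ℂ)) z := by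
  have h := (((hasDerivAt_pow 2 z).sub (((hasDerivAt_id z).const_mul 2).mul_const
    ((inner ℝ θ y : ℝ) : ℂ))).add_const ((‖y‖ ^ 2 : ℝ) : ℂ))
  refine h.congr_deriv ?_
  simp

/-- Potentials are real analytic along rays, outside of the support of the density. -/
lemma analyticAt_potential_ray {f : Eu d → ℝ} (hf : Continuous f) {θ : Eu d} (hθ : ‖θ‖ = 1)
    {r t₀ : ℝ} (ht₀ : r < t₀) (p : ℝ) :
    AnalyticAt ℝ (fun t : ℝ => ∫ y in Metric.closedBall (0 : Eu d) r,
      (‖t • θ - y‖ ^ 2) ^ p * f y) t₀ := by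
  set K := Metric.closedBall (0 : Eu d) r with hK
  have hKc : IsCompact K := isCompact_closedBall _ _
  have hq := continuous_complexNormSq θ
  obtain ⟨δ, hδ, hre⟩ := exists_complexNormSq_mem_slitPlane hθ ht₀
  let Φ : ℂ → Eu d → ℂ := fun z y => complexNormSq θ z y ^ (p : ℂ) * (f y : ℂ)
  let Φ' : ℂ → Eu d → ℂ := fun z y =>
    (p * complexNormSq θ z y ^ ((p : ℂ) - 1) * (2 * z - 2 * ((inner ℝ θ y : ℝ) : ℂ))) * (f y : ℂ)
  have hfc : Continuous fun y => (f y : ℂ) := Complex.continuous_ofReal.comp hf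
  have hcpow : ∀ c : ℂ, ContinuousOn (fun q : ℂ × Eu d => complexNormSq θ q.1 q.2 ^ c)
      (Metric.closedBall (t₀ : ℂ) δ ×ˢ K) := fun c =>
    hq.continuousOn.cpow continuousOn_const fun q hq' => hre q.1 hq'.1 q.2 hq'.2
  have hΦ'c : ContinuousOn (fun q : ℂ × Eu d => Φ' q.1 q.2)
      (Metric.closedBall (t₀ : ℂ) δ ×ˢ K) := by
    have h2 : Continuous fun q : ℂ × Eu d => 2 * q.1 - 2 * ((inner ℝ θ q.2 : ℝ) : ℂ) :=
      (continuous_const.mul continuous_fst).sub (continuous_const.mul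
        (Complex.continuous_ofReal.comp (continuous_const.inner continuous_snd)))
    exact ((continuousOn_const.mul (hcpow _)).mul h2.continuousOn).mul
      (hfc.comp continuous_snd).continuousOn
  have hΦc : ∀ z ∈ Metric.closedBall (t₀ : ℂ) δ, ContinuousOn (Φ z) K := fun z hz =>
    ((hcpow _).comp (by fun_prop : ContinuousOn (fun y : Eu d => (z, y)) K)
      fun y hy => ⟨hz, hy⟩).mul hfc.continuousOn
  have hΦ'cz : ∀ z ∈ Metric.closedBall (t₀ : ℂ) δ, ContinuousOn (Φ' z) K := fun z hz =>
    ContinuousOn.comp (f := fun y : Eu d => (z, y)) (g := fun q : ℂ × Eu d => Φ' q.1 q.2) hΦ'c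
      (Continuous.prodMk_right z).continuousOn (fun y hy => ⟨hz, hy⟩)
  obtain ⟨B, hB⟩ := ((isCompact_closedBall (t₀ : ℂ) δ).prod hKc).exists_bound_of_continuousOn hΦ'c
  -- Differentiation under the integral, dominated by the maximum B of the derivative on a compact
  -- product, gives holomorphy in the complexified parameter.
  have hdiff : DifferentiableOn ℂ (fun z => ∫ y in K, Φ z y) (Metric.ball (t₀ : ℂ) δ) := by
    intro z₁ hz₁
    have hsub : ∀ z ∈ Metric.ball (t₀ : ℂ) δ, z ∈ Metric.closedBall (t₀ : ℂ) δ :=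
      fun z hz => Metric.ball_subset_closedBall hz
    refine (hasDerivAt_integral_of_dominated_loc_of_deriv_le (μ := volume.restrict K)
      (F := Φ) (F' := Φ') (bound := fun _ => B) (Metric.isOpen_ball.mem_nhds hz₁) ?_ ?_ ?_ ?_ ?_
      ?_).2.differentiableAt.differentiableWithinAt
    · filter_upwards [Metric.isOpen_ball.mem_nhds hz₁] with z hz
      exact ((hΦc z (hsub z hz)).integrableOn_compact hKc).aestronglyMeasurable
    · exact (hΦc z₁ (hsub z₁ hz₁)).integrableOn_compact hKc
    · exact ((hΦ'cz z₁ (hsub z₁ hz₁)).integrableOn_compact hKc).aestronglyMeasurable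
    · filter_upwards [ae_restrict_mem hKc.measurableSet] with y hy z hz
      exact hB (z, y) ⟨hsub z hz, hy⟩
    · exact integrableOn_const hKc.measure_lt_top.ne
    · filter_upwards [ae_restrict_mem hKc.measurableSet] with y hy z hz
      exact ((hasDerivAt_complexNormSq θ y z).cpow_const (hre z (hsub z hz) y hy)).mul_const _
  -- A holomorphic function is analytic, and the real part of its restriction to the real axis is
  -- real analytic; on real t it is the potential.
  have han := (hdiff.analyticAt (Metric.isOpen_ball.mem_nhds (Metric.mem_ball_self hδ))).re_ofReal
  refine han.congr (.of_forall fun t => ?_)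
  have h : ∀ y, Φ t y = (((‖t • θ - y‖ ^ 2) ^ p * f y : ℝ) : ℂ) := fun y => by
    simp only [Φ]
    rw [complexNormSq_ofReal hθ, ← Complex.ofReal_cpow (by positivity)]
    push_cast
    rfl
  simp_rw [h]
  rw [integral_complex_ofReal, Complex.ofReal_re]

/-- For ‖x‖ ≥ 1 the kernel N(x - ·) is a harmonic function on 𝔻, so the hypothesis applies. For r <
‖x‖ < 1 it is singular inside 𝔻, and the vanishing is continued inwards along the ray through x by
analyticity. -/
lemma conv_newton_eq_zero_of_pairing (hd : 3 ≤ d) (f : Test d) (hf : pairing d f = 0) {r : ℝ}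
    (hr0 : 0 ≤ r) (hfr : tsupport f ⊆ Metric.closedBall 0 r) (x : Eu d)
    (hx : r < ‖x‖) : conv (newton d) f x = 0 := by
  -- far away from the disk the potential vanishes since the kernel is harmonic on the disk
  have hfar : ∀ x : Eu d, 1 ≤ ‖x‖ → conv (newton d) f x = 0 := by
    intro x hx
    have hne : ∀ y ∈ disk d, y ≠ x := fun y hy h => by
      have := mem_ball_zero_iff.1 hy
      rw [h] at this
      linarith
    have h := pairing_mkHarm f (fun y => newton d (x - y))
      ((newton_sub_contDiffOn hd x).mono hne) fun y hy => laplacian_newton_sub hd (hne y hy)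
    rw [hf] at h
    rw [conv_apply_swap]
    simp_rw [mul_comm (newton d _)]
    exact h.symm
  have hx0 : 0 < ‖x‖ := hr0.trans_lt hx
  set θ := ‖x‖⁻¹ • x with hθ
  have hθ1 : ‖θ‖ = 1 := by
    rw [hθ, norm_smul, norm_inv, norm_norm, inv_mul_cancel₀ hx0.ne']
  have hray : ∀ t : ℝ, conv (newton d) f (t • θ) = newtonConst d *
      ∫ y in Metric.closedBall (0 : Eu d) r, (‖t • θ - y‖ ^ 2) ^ (-(((d : ℝ) - 2) / 2)) * f y := by
    intro t
    rw [setIntegral_eq_integral_of_forall_compl_eq_zero fun y hy => by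
      rw [image_eq_zero_of_notMem_tsupport fun h => hy (hfr h), mul_zero], conv_apply_swap,
      ← integral_const_mul]
    congr 1
    ext y
    rw [newton_eq hd, mul_assoc]
  have han : AnalyticOnNhd ℝ (fun t : ℝ => conv (newton d) f (t • θ)) (Set.Ioi r) := by
    intro t ht
    simp_rw [hray]
    exact analyticAt_const.mul (analyticAt_potential_ray f.continuous hθ1 ht _)
  -- The identity theorem needs a point of the ray past r with a neighbourhood where the potential
  -- is known to vanish; any parameter above both r and 1 serves.
  have hm : max r 1 + 1 ∈ Set.Ioi r := by
    have := le_max_left r 1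
    rw [Set.mem_Ioi]
    linarith
  have hz := han.eqOn_zero_of_preconnected_of_eventuallyEq_zero isPreconnected_Ioi hm (by
    have h1 : (1 : ℝ) < max r 1 + 1 := by
      have := le_max_right r 1
      linarith
    filter_upwards [lt_mem_nhds h1] with t ht
    refine hfar _ ?_
    rw [norm_smul, hθ1, mul_one, Real.norm_of_nonneg (by linarith)]
    exact ht.le)
  have h := hz (show ‖x‖ ∈ Set.Ioi r from hx)
  have e : ‖x‖ • θ = x := by rw [hθ, smul_smul, mul_inv_cancel₀ hx0.ne', one_smul]
  dsimp only at h
  rwa [e] at h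

/-- The preimage is the Newton potential of f: the vanishing result puts its support in a compact
ball inside 𝔻. -/
lemma mem_range_testL_of_pairing_eq_zero (hd : 3 ≤ d) (f : Test d) (hf : pairing d f = 0) :
    f ∈ LinearMap.range (testL d) := by
  obtain ⟨r, hr0, hr, hfr⟩ := exists_radius f.hasCompactSupport f.tsupport_subset
  have hs : tsupport (conv (newton d) f) ⊆ Metric.closedBall 0 r :=
    closure_minimal (fun x hx => by
      rw [mem_closedBall_zero_iff]
      by_contra h
      exact hx (conv_newton_eq_zero_of_pairing hd f hf hr0 hfr x (not_le.1 h)))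
      Metric.isClosed_closedBall
  refine ⟨mkTest (conv (newton d) f)
    (conv_contDiff (locallyIntegrable_newton hd) f.contDiff f.hasCompactSupport)
    ((isCompact_closedBall _ _).of_isClosed_subset (isClosed_tsupport _) hs)
    (hs.trans (closedBall_subset_disk hr)), ?_⟩
  ext x
  rw [testL_apply]
  change -Δ (conv (newton d) f) x = f x
  rw [laplacian_conv_newton hd f.contDiff f.hasCompactSupport, Pi.neg_apply, neg_neg]

lemma ker_pairing (hd : 3 ≤ d) : LinearMap.ker (pairing d) = LinearMap.range (testL d) := by
  refine le_antisymm (fun f hf => mem_range_testL_of_pairing_eq_zero hd f hf) ?_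
  rintro _ ⟨h, rfl⟩
  exact pairing_testL h

/-- The isomorphism `C_c^∞(𝔻) / L C_c^∞(𝔻) ≅ H'(𝔻)`. -/
def harmonicPairing (hd : 3 ≤ d) : Scl d ≃ₗ[ℝ] HDual d :=
  (Submodule.quotEquivOfEq _ _ (ker_pairing hd).symm).trans
    ((pairing d).quotKerEquivOfSurjective (pairing_surjective hd))

lemma harmonicPairing_mkQ (hd : 3 ≤ d) (f : Test d) :
    harmonicPairing hd ((LinearMap.range (testL d)).mkQ f) = pairing d f := rfl

lemma isHarmonicPairing (hd : 3 ≤ d) : IsHarmonicPairing (harmonicPairing hd) := fun f u => by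
  rw [harmonicPairing_mkQ, pairing_apply, setIntegral_test_mul]

end Duality

end

end ConformalDisk

/-! ### Liouville's theorem: conformal embeddings of flat disks are Möbius -/

namespace ConformalDisk

noncomputable section

section Liouville

variable {d : ℕ}

/-- The integrability condition behind Liouville's theorem: exchanging the outer and inner
directions of a third derivative compares two mixed second derivatives. -/
lemma dirDeriv_swap {F : Type*} [NormedAddCommGroup F] [NormedSpace ℝ F] {U : Set (Eu d)}
    (hU : IsOpen U) {f : Eu d → F} (hf : ContDiffOn ℝ ∞ f U) (u v w : Eu d) {x : Eu d}
    (hx : x ∈ U) :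
    dirDeriv w (dirDeriv u (dirDeriv v f)) x = dirDeriv v (dirDeriv u (dirDeriv w f)) x := by
  rw [dirDeriv_congr hU (fun y hy => dirDeriv_comm hU hf u v hy) w hx,
    dirDeriv_comm hU (dirDeriv_contDiffOn hU hf u) w v hx,
    dirDeriv_congr hU (fun y hy => dirDeriv_comm hU hf w u hy) v hx]

lemma eq_of_fderiv_eq_zero {F : Type*} [NormedAddCommGroup F] [NormedSpace ℝ F]
    {f : Eu d → F} (hf : ContDiffOn ℝ ∞ f (disk d)) (h : ∀ x ∈ disk d, ∀ v, dirDeriv v f x = 0)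
    {x y : Eu d} (hx : x ∈ disk d) (hy : y ∈ disk d) : f x = f y := by
  refine (disk d).isOpen.is_const_of_fderiv_eq_zero (𝕜 := ℝ)
    (convex_ball (0 : Eu d) 1).isPreconnected
    (fun z hz => (differentiableAt_of_contDiffOn (disk d).isOpen hf hz).differentiableWithinAt)
    (fun z hz => ?_) hx hy
  ext1 v
  exact h z hz v

/-- The second derivative is bilinear. -/
lemma dirDeriv_dirDeriv_eq_sum {f : Eu d → ℝ} {x : Eu d} (hf : ContDiffAt ℝ 2 f x) (u v : Eu d) :
    dirDeriv u (dirDeriv v f) x =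
      ∑ i, ∑ j, u i * v j * dirDeriv (basisVec i) (dirDeriv (basisVec j) f) x := by
  have hu : u = ∑ i, u i • basisVec i := by
    conv_lhs => rw [← (EuclideanSpace.basisFun (Fin d) ℝ).sum_repr u]
    simp
  have hv : v = ∑ i, v i • basisVec i := by
    conv_lhs => rw [← (EuclideanSpace.basisFun (Fin d) ℝ).sum_repr v]
    simp
  rw [dirDeriv_dirDeriv hf]
  conv_lhs => rw [hu, hv]
  simp only [map_sum, map_smul, _root_.sum_apply, _root_.smul_apply, smul_eq_mul,
    dirDeriv_dirDeriv hf, Finset.mul_sum]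
  rw [Finset.sum_comm]
  refine Finset.sum_congr rfl fun i _ => Finset.sum_congr rfl fun j _ => ?_
  ring

lemma inner_basisVec_ne {i j : Fin d} (h : i ≠ j) : inner ℝ (basisVec i) (basisVec j) = (0 : ℝ) := by
  simp [basisVec, EuclideanSpace.inner_single_left, h]

/-- A function whose Hessian is off-diagonal in every orthonormal frame, and which vanishes to
second order at `y`, is a multiple of `‖x - y‖²`. -/
lemma eq_norm_sq_of_hessian (hd : 2 ≤ d) {F : Eu d → ℝ} (hF : ContDiffOn ℝ ∞ F (disk d))
    (hH : ∀ x ∈ disk d, ∀ u v : Eu d, inner ℝ u v = (0 : ℝ) → dirDeriv u (dirDeriv v F) x = 0)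
    {y : Eu d} (hy : y ∈ disk d) (hFy : F y = 0) (hDy : ∀ v, dirDeriv v F y = 0) (i : Fin d)
    {x : Eu d} (hx : x ∈ disk d) :
    F x = dirDeriv (basisVec i) (dirDeriv (basisVec i) F) y / 2 * ‖x - y‖ ^ 2 := by
  have hU := (disk d).isOpen
  have h2 : ∀ {z}, z ∈ disk d → ContDiffAt ℝ 2 F z := fun hz => contDiffAt_two hU hF hz
  set l : Eu d → ℝ := dirDeriv (basisVec i) (dirDeriv (basisVec i) F) with hl
  have hls : ContDiffOn ℝ ∞ l (disk d) := dirDeriv_contDiffOn hU (dirDeriv_contDiffOn hU hF _) _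
  have hdiag : ∀ z ∈ disk d, ∀ j, dirDeriv (basisVec j) (dirDeriv (basisVec j) F) z = l z := by
    intro z hz j
    by_cases hij : j = i
    · rw [hij]
    -- The vectors e_j + e_i and e_j - e_i are orthogonal; the vanishing of their mixed derivative
    -- says ∂_j² F = ∂_i² F.
    · have h := hH z hz (basisVec j + basisVec i) (basisVec j - basisVec i) (by
        simp only [inner_add_left, inner_sub_right, inner_basisVec_ne hij,
          inner_basisVec_ne (Ne.symm hij), real_inner_self_eq_norm_sq]
        simp)
      have hc := dirDeriv_comm hU hF (basisVec j) (basisVec i) hz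
      rw [dirDeriv_dirDeriv (h2 hz)] at h
      simp only [map_add, map_sub, _root_.add_apply, ← dirDeriv_dirDeriv (h2 hz)] at h
      linarith
  have hlconst : ∀ z ∈ disk d, l z = l y := by
    intro z hz
    refine eq_of_fderiv_eq_zero hls (fun z hz v => ?_) hz hy
    have hk : ∀ k, dirDeriv (basisVec k) l z = 0 := by
      intro k
      -- Since l = ∂_j² F for every j, a choice j ≠ k gives ∂_k l = ∂_j(∂_k ∂_j F) = 0. Two distinct
      -- directions are needed, hence d ≥ 2.
      obtain ⟨j, hj⟩ : ∃ j : Fin d, k ≠ j := by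
        by_cases h0 : k = ⟨0, by omega⟩
        · exact ⟨⟨1, by omega⟩, by rw [h0]; simp⟩
        · exact ⟨_, h0⟩
      rw [← dirDeriv_congr hU (fun z hz => hdiag z hz j) _ hz,
        dirDeriv_comm hU (dirDeriv_contDiffOn hU hF _) _ _ hz,
        dirDeriv_congr hU (g := fun _ => 0)
          (fun z hz => hH z hz _ _ (inner_basisVec_ne hj)) _ hz]
      simp [dirDeriv]
    have hv : v = ∑ k, v k • basisVec k := by
      conv_lhs => rw [← (EuclideanSpace.basisFun (Fin d) ℝ).sum_repr v]
      simp
    rw [dirDeriv, hv, map_sum]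
    refine Finset.sum_eq_zero fun k _ => ?_
    rw [map_smul]
    exact (congrArg _ (hk k)).trans (smul_zero _)
  have hHess : ∀ z ∈ disk d, ∀ u v, dirDeriv u (dirDeriv v F) z = l y * inner ℝ u v := by
    intro z hz u v
    rw [dirDeriv_dirDeriv_eq_sum (h2 hz), PiLp.inner_apply, Finset.mul_sum]
    refine Finset.sum_congr rfl fun j _ => ?_
    rw [Finset.sum_eq_single j]
    · rw [hdiag z hz, hlconst z hz]
      simp
      ring
    · intro k _ hk
      rw [hH z hz _ _ (inner_basisVec_ne hk.symm), mul_zero]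
    · simp
  -- subtract the quadratic function
  have hn : ∀ v z, dirDeriv v (fun z => ‖z - y‖ ^ 2) z = 2 * inner ℝ (z - y) v := fun v z => by
    have h := (hasStrictFDerivAt_norm_sq (z - y)).hasFDerivAt.comp z
      ((hasFDerivAt_id z).sub_const y)
    change fderiv ℝ ((fun z : Eu d => ‖z‖ ^ 2) ∘ fun z => id z - y) z v = _
    rw [h.fderiv]
    simp [inner_sub_left]
  have hD : ∀ z ∈ disk d, ∀ v, dirDeriv v F z = l y * inner ℝ (z - y) v := by
    intro z hz v
    have hs : ContDiffOn ℝ ∞ (fun z => dirDeriv v F z - l y * inner ℝ (z - y) v) (disk d) :=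
      (dirDeriv_contDiffOn hU hF v).sub (contDiff_const.mul
        ((contDiff_id.sub contDiff_const).inner ℝ contDiff_const)).contDiffOn
    have h := eq_of_fderiv_eq_zero hs (fun z hz u => ?_) hz hy
    · rw [hDy, sub_self, inner_zero_left, mul_zero, sub_zero] at h
      linarith
    · have hl : HasFDerivAt (fun z : Eu d => l y * inner ℝ (z - y) v)
          (l y • innerSL ℝ v) z := by
        have h := ((innerSL ℝ v).hasFDerivAt (x := z - y)).comp z
          ((hasFDerivAt_id z).sub_const y)
        have h' := h.const_mul (l y)
        refine h'.congr_of_eventuallyEq (.of_forall fun z => ?_)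
        simp [real_inner_comm]
      have hd := (differentiableAt_of_contDiffOn hU (dirDeriv_contDiffOn hU hF v) hz).hasFDerivAt
      have hfd : fderiv ℝ (fun z => dirDeriv v F z - l y * inner ℝ (z - y) v) z =
          fderiv ℝ (dirDeriv v F) z - l y • innerSL ℝ v := (hd.sub hl).fderiv
      have h4 : fderiv ℝ (dirDeriv v F) z u = l y * inner ℝ u v := hHess z hz u v
      rw [dirDeriv, hfd]
      simp [h4, real_inner_comm]
  have hs : ContDiffOn ℝ ∞ (fun z => F z - l y / 2 * ‖z - y‖ ^ 2) (disk d) :=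
    hF.sub (contDiff_const.mul ((contDiff_id.sub contDiff_const).norm_sq ℝ)).contDiffOn
  have h := eq_of_fderiv_eq_zero hs (fun z hz u => ?_) hx hy
  · rw [hFy, sub_self y, norm_zero] at h
    linarith
  · have h1 := (differentiableAt_of_contDiffOn hU hF hz).hasFDerivAt
    have h2 : DifferentiableAt ℝ (fun z => ‖z - y‖ ^ 2) z :=
      (((contDiff_id (n := ∞)).sub contDiff_const).norm_sq ℝ).differentiable (by simp) z
    have h3 := h2.hasFDerivAt.const_mul (l y / 2)
    have h4 : fderiv ℝ F z u = _ := hD z hz u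
    have h5 : fderiv ℝ (fun z => ‖z - y‖ ^ 2) z u = _ := hn u z
    have hfd : fderiv ℝ (fun z => F z - l y / 2 * ‖z - y‖ ^ 2) z = _ := (h1.sub h3).fderiv
    rw [dirDeriv, hfd]
    change fderiv ℝ F z u - l y / 2 * fderiv ℝ (fun z => ‖z - y‖ ^ 2) z u = 0
    rw [h4, h5]
    ring

/-! ### Derivatives of conformal maps and of the conformal factor -/

namespace ConfEmb

/-- The conformal factor, extended by zero. -/
def factorExt (φ : ConfEmb d) : Eu d → ℝ := zeroExt φ.factor

lemma factorExt_apply (φ : ConfEmb d) (x : disk d) : φ.factorExt x = φ.factor x :=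
  zeroExt_apply _ x

lemma factorExt_contDiffOn (φ : ConfEmb d) : ContDiffOn ℝ ∞ φ.factorExt (disk d) := φ.factor_smooth

lemma factorExt_pos (φ : ConfEmb d) {x : Eu d} (hx : x ∈ disk d) : 0 < φ.factorExt x := by
  rw [φ.factorExt_apply ⟨x, hx⟩]
  exact φ.factor_pos _

lemma ext_contDiffOn (φ : ConfEmb d) : ContDiffOn ℝ ∞ φ.ext (disk d) := φ.smooth

lemma inner_dirDeriv (φ : ConfEmb d) {x : Eu d} (hx : x ∈ disk d) (v w : Eu d) :
    inner ℝ (dirDeriv v φ.ext x) (dirDeriv w φ.ext x) = φ.factorExt x ^ 2 * inner ℝ v w := by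
  rw [φ.factorExt_apply ⟨x, hx⟩]
  exact φ.inner_fderiv ⟨x, hx⟩ v w

lemma fderiv_injective (φ : ConfEmb d) {x : Eu d} (hx : x ∈ disk d) :
    Function.Injective (fderiv ℝ φ.ext x : Eu d →ₗ[ℝ] Eu d) := by
  rw [injective_iff_map_eq_zero]
  intro v hv
  have h := φ.inner_dirDeriv hx v v
  change fderiv ℝ φ.ext x v = 0 at hv
  rw [dirDeriv, hv, inner_zero_left, zero_eq_mul] at h
  rcases h with h | h
  · exact absurd h (pow_ne_zero 2 (φ.factorExt_pos hx).ne')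
  · exact inner_self_eq_zero.1 h

lemma eq_zero_of_inner_dirDeriv (φ : ConfEmb d) {x : Eu d} (hx : x ∈ disk d) (z : Eu d)
    (h : ∀ w, inner ℝ z (dirDeriv w φ.ext x) = (0 : ℝ)) : z = 0 := by
  obtain ⟨w, hw⟩ := (LinearMap.injective_iff_surjective.1 (φ.fderiv_injective hx)) z
  have h' := h w
  rw [show dirDeriv w φ.ext x = z from hw] at h'
  exact inner_self_eq_zero.1 h'

/-- The Christoffel symbols of a conformally flat metric. -/
lemma two_inner_dirDeriv_dirDeriv (φ : ConfEmb d) {x : Eu d} (hx : x ∈ disk d) (u v w : Eu d) :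
    inner ℝ (dirDeriv u (dirDeriv v φ.ext) x) (dirDeriv w φ.ext x) =
      φ.factorExt x * (dirDeriv u φ.factorExt x * inner ℝ v w +
        dirDeriv v φ.factorExt x * inner ℝ u w - dirDeriv w φ.factorExt x * inner ℝ u v) := by
  have hU := (disk d).isOpen
  have key : ∀ a b c : Eu d, inner ℝ (dirDeriv a (dirDeriv b φ.ext) x) (dirDeriv c φ.ext x) +
      inner ℝ (dirDeriv b φ.ext x) (dirDeriv a (dirDeriv c φ.ext) x) =
      2 * φ.factorExt x * dirDeriv a φ.factorExt x * inner ℝ b c := by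
    intro a b c
    have hs := fun v => differentiableAt_of_contDiffOn hU
      (dirDeriv_contDiffOn hU φ.ext_contDiffOn v) hx
    have hΩ := differentiableAt_of_contDiffOn hU φ.factorExt_contDiffOn hx
    rw [← dirDeriv_inner (hs b) (hs c),
      dirDeriv_congr hU (fun y hy => φ.inner_dirDeriv hy b c) a hx]
    have h := ((hΩ.hasFDerivAt.pow 2).mul_const (inner ℝ b c : ℝ)).fderiv
    rw [dirDeriv, h]
    simp [dirDeriv]
    ring
  have k1 := key u v w
  have k2 := key v u w
  have k3 := key w u v
  rw [dirDeriv_comm hU φ.ext_contDiffOn v u hx] at k2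
  rw [dirDeriv_comm hU φ.ext_contDiffOn w u hx, dirDeriv_comm hU φ.ext_contDiffOn w v hx] at k3
  have c1 := real_inner_comm (dirDeriv v φ.ext x) (dirDeriv u (dirDeriv w φ.ext) x)
  linarith

/-- The inverse of the conformal factor. -/
def invFactor (φ : ConfEmb d) : Eu d → ℝ := fun x => (φ.factorExt x)⁻¹

lemma invFactor_contDiffOn (φ : ConfEmb d) : ContDiffOn ℝ ∞ φ.invFactor (disk d) :=
  φ.factorExt_contDiffOn.inv fun _ hx => (φ.factorExt_pos hx).ne'

lemma dirDeriv_invFactor (φ : ConfEmb d) {x : Eu d} (hx : x ∈ disk d) (v : Eu d) :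
    dirDeriv v φ.invFactor x * φ.factorExt x + φ.invFactor x * dirDeriv v φ.factorExt x = 0 := by
  have hU := (disk d).isOpen
  rw [← dirDeriv_mul (differentiableAt_of_contDiffOn hU φ.invFactor_contDiffOn hx)
    (differentiableAt_of_contDiffOn hU φ.factorExt_contDiffOn hx),
    dirDeriv_congr hU (f := fun y => φ.invFactor y * φ.factorExt y) (g := fun _ => 1)
      (fun y hy => inv_mul_cancel₀ (φ.factorExt_pos hy).ne') v hx]
  simp [dirDeriv]

/-- For orthogonal u and v the Christoffel formula expresses ∂_u∂_vφ through ∂_uφ and ∂_vφ; in terms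
of ρ = 1/Ω it becomes this relation. It is tested against all ∂_wφ, which exhaust ℝᵈ because dφ is
invertible. -/
lemma invFactor_cross (φ : ConfEmb d) {x : Eu d} (hx : x ∈ disk d) {u v : Eu d}
    (huv : inner ℝ u v = (0 : ℝ)) :
    dirDeriv u φ.invFactor x • dirDeriv v φ.ext x + dirDeriv v φ.invFactor x • dirDeriv u φ.ext x +
      φ.invFactor x • dirDeriv u (dirDeriv v φ.ext) x = 0 := by
  refine φ.eq_zero_of_inner_dirDeriv hx _ fun w => ?_
  rw [inner_add_left, inner_add_left, inner_smul_left, inner_smul_left, inner_smul_left,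
    φ.inner_dirDeriv hx, φ.inner_dirDeriv hx, φ.two_inner_dirDeriv_dirDeriv hx, huv]
  have h1 := φ.dirDeriv_invFactor hx u
  have h2 := φ.dirDeriv_invFactor hx v
  simp only [conj_trivial]
  linear_combination φ.factorExt x * inner ℝ v w * h1 + φ.factorExt x * inner ℝ u w * h2

lemma dirDeriv_ext_sub (φ : ConfEmb d) (c v : Eu d) :
    dirDeriv v (fun x => φ.ext x - c) = dirDeriv v φ.ext := by
  ext1 x
  simp only [dirDeriv, fderiv_sub_const]

lemma dirDeriv_invFactor_smul (φ : ConfEmb d) (c : Eu d) {x : Eu d} (hx : x ∈ disk d) (v : Eu d) :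
    dirDeriv v (fun x => φ.invFactor x • (φ.ext x - c)) x =
      dirDeriv v φ.invFactor x • (φ.ext x - c) + φ.invFactor x • dirDeriv v φ.ext x := by
  have hU := (disk d).isOpen
  rw [dirDeriv_smul (differentiableAt_of_contDiffOn hU φ.invFactor_contDiffOn hx)
    ((differentiableAt_of_contDiffOn hU φ.ext_contDiffOn hx).sub_const c), dirDeriv_ext_sub]

/-- By the product rule, the terms containing derivatives of φ are exactly the left side of
`invFactor_cross`. The constant c is free: c = 0 serves for the Hessian of ρ, and c = φ(y) for the
two-point identity. -/
lemma hessian_invFactor_smul (φ : ConfEmb d) (c : Eu d) {x : Eu d} (hx : x ∈ disk d) {u v : Eu d}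
    (huv : inner ℝ u v = (0 : ℝ)) :
    dirDeriv u (dirDeriv v fun x => φ.invFactor x • (φ.ext x - c)) x =
      dirDeriv u (dirDeriv v φ.invFactor) x • (φ.ext x - c) := by
  have hU := (disk d).isOpen
  have hρ := φ.invFactor_contDiffOn
  have he := φ.ext_contDiffOn
  have d1 := differentiableAt_of_contDiffOn hU (dirDeriv_contDiffOn hU hρ v) hx
  have d2 := (differentiableAt_of_contDiffOn hU he hx).sub_const c
  have d3 := differentiableAt_of_contDiffOn hU hρ hx
  have d4 := differentiableAt_of_contDiffOn hU (dirDeriv_contDiffOn hU he v) hx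
  rw [dirDeriv_congr hU (fun y hy => φ.dirDeriv_invFactor_smul c hy v) u hx,
    dirDeriv_add (d1.fun_smul d2) (d3.fun_smul d4), dirDeriv_smul d1 d2, dirDeriv_smul d3 d4,
    dirDeriv_ext_sub]
  have h := φ.invFactor_cross hx huv
  rw [← sub_eq_zero, ← h]
  abel

/-- This is the step that needs d ≥ 3. Take w orthogonal to u and v. The symmetry of ∂_w∂_u∂_v(ρφ)
in v and w gives (∂_u∂_vρ) ∂_wφ = (∂_u∂_wρ) ∂_vφ. As ∂_vφ and ∂_wφ are orthogonal and ∂_wφ ≠ 0, the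
coefficient ∂_u∂_vρ is zero. -/
lemma hessian_invFactor (hd : 3 ≤ d) (φ : ConfEmb d) {x : Eu d} (hx : x ∈ disk d) {u v : Eu d}
    (huv : inner ℝ u v = (0 : ℝ)) : dirDeriv u (dirDeriv v φ.invFactor) x = 0 := by
  have hU := (disk d).isOpen
  -- a vector orthogonal to `u` and `v`
  obtain ⟨w, hw0, huw, hvw⟩ : ∃ w : Eu d, w ≠ 0 ∧ inner ℝ u w = (0 : ℝ) ∧ inner ℝ v w = (0 : ℝ) := by
    let S : Submodule ℝ (Eu d) := Submodule.span ℝ {u, v}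
    have h1 : Module.finrank ℝ S ≤ 2 := by
      refine (finrank_span_le_card ({u, v} : Set (Eu d))).trans ?_
      rw [Set.toFinset_card]
      simpa using (Set.toFinset_card ({u, v} : Set (Eu d))).symm.le.trans
        (by simpa using Finset.card_le_two (a := u) (b := v))
    have h2 := S.finrank_add_finrank_orthogonal
    rw [finrank_euclideanSpace, Fintype.card_fin] at h2
    have h3 : Sᗮ ≠ ⊥ := fun h => by
      rw [h, finrank_bot] at h2
      omega
    obtain ⟨w, hw, hw0⟩ := Submodule.exists_mem_ne_zero_of_ne_bot h3
    exact ⟨w, hw0, (Submodule.mem_orthogonal _ _).1 hw u (Submodule.subset_span (by simp)),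
      (Submodule.mem_orthogonal _ _).1 hw v (Submodule.subset_span (by simp))⟩
  have hρ := φ.invFactor_contDiffOn
  have hs : ContDiffOn ℝ ∞ (fun x => φ.invFactor x • (φ.ext x - 0)) (disk d) :=
    hρ.smul (φ.ext_contDiffOn.sub contDiffOn_const)
  have hk : ∀ a b c : Eu d, inner ℝ a b = (0 : ℝ) →
      dirDeriv c (dirDeriv a (dirDeriv b fun x => φ.invFactor x • (φ.ext x - 0))) x =
        dirDeriv c (dirDeriv a (dirDeriv b φ.invFactor)) x • (φ.ext x - 0) +
          dirDeriv a (dirDeriv b φ.invFactor) x • dirDeriv c φ.ext x := by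
    intro a b c hab
    rw [dirDeriv_congr hU (fun y hy => φ.hessian_invFactor_smul 0 hy hab) c hx, dirDeriv_smul
      (differentiableAt_of_contDiffOn hU (dirDeriv_contDiffOn hU (dirDeriv_contDiffOn hU hρ b) a) hx)
      ((differentiableAt_of_contDiffOn hU φ.ext_contDiffOn hx).sub_const 0), dirDeriv_ext_sub]
  have h := dirDeriv_swap hU hs u v w hx
  rw [hk u v w huv, hk u w v huw, dirDeriv_swap hU hρ u v w hx, add_right_inj] at h
  have h' := congrArg (fun z => (inner ℝ z (dirDeriv w φ.ext x) : ℝ)) h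
  simp only [inner_smul_left, φ.inner_dirDeriv hx, hvw, conj_trivial, mul_zero] at h'
  have hw' : φ.factorExt x ^ 2 * (inner ℝ w w : ℝ) ≠ 0 :=
    mul_ne_zero (pow_ne_zero 2 (φ.factorExt_pos hx).ne') (fun h => hw0 (inner_self_eq_zero.1 h))
  exact (mul_eq_zero.1 h').resolve_right hw'

/-- `‖φ(x) - φ(y)‖² = Ω(x) Ω(y) ‖x - y‖²` for conformal maps in dimension at least three. -/
lemma norm_sub_sq (hd : 3 ≤ d) (φ : ConfEmb d) (x y : disk d) :
    ‖(φ x : Eu d) - φ y‖ ^ 2 = φ.factor x * φ.factor y * ‖(x : Eu d) - y‖ ^ 2 := by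
  have hU := (disk d).isOpen
  set c : Eu d := φ.ext y with hc
  have hp : ContDiffOn ℝ ∞ (fun z => φ.ext z - c) (disk d) :=
    φ.ext_contDiffOn.sub contDiffOn_const
  have hq : ContDiffOn ℝ ∞ (fun z => φ.invFactor z • (φ.ext z - c)) (disk d) :=
    φ.invFactor_contDiffOn.smul hp
  -- F = ‖φ(z) - φ(y)‖² / Ω(z). It will be shown to equal Ω(y) ‖z - y‖², because its Hessian
  -- vanishes on orthogonal pairs and it vanishes to second order at y.
  let F : Eu d → ℝ := fun z => inner ℝ (φ.invFactor z • (φ.ext z - c)) (φ.ext z - c)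
  have hF : ContDiffOn ℝ ∞ F (disk d) := hq.inner ℝ hp
  have hDF : ∀ z ∈ disk d, ∀ v, dirDeriv v F z =
      inner ℝ (dirDeriv v (fun z => φ.invFactor z • (φ.ext z - c)) z) (φ.ext z - c) +
        inner ℝ (φ.invFactor z • (φ.ext z - c)) (dirDeriv v φ.ext z) := fun z hz v => by
    rw [← dirDeriv_ext_sub φ c v]
    exact dirDeriv_inner (differentiableAt_of_contDiffOn hU hq hz)
      (differentiableAt_of_contDiffOn hU hp hz) v
  have hDDF : ∀ z ∈ disk d, ∀ u v, dirDeriv u (dirDeriv v F) z =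
      (inner ℝ (dirDeriv u (dirDeriv v fun z => φ.invFactor z • (φ.ext z - c)) z) (φ.ext z - c) +
      inner ℝ (dirDeriv v (fun z => φ.invFactor z • (φ.ext z - c)) z) (dirDeriv u φ.ext z)) +
      (inner ℝ (dirDeriv u (fun z => φ.invFactor z • (φ.ext z - c)) z) (dirDeriv v φ.ext z) +
      inner ℝ (φ.invFactor z • (φ.ext z - c)) (dirDeriv u (dirDeriv v φ.ext) z)) := by
    intro z hz u v
    have e1 := differentiableAt_of_contDiffOn hU (dirDeriv_contDiffOn hU hq v) hz
    have e2 := differentiableAt_of_contDiffOn hU hp hz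
    have e3 := differentiableAt_of_contDiffOn hU hq hz
    have e4 := differentiableAt_of_contDiffOn hU (dirDeriv_contDiffOn hU φ.ext_contDiffOn v) hz
    rw [dirDeriv_congr hU (fun z hz => hDF z hz v) u hz,
      dirDeriv_add (e1.inner ℝ e2) (e3.inner ℝ e4), dirDeriv_inner e1 e2, dirDeriv_inner e3 e4,
      dirDeriv_ext_sub]
  have hH : ∀ z ∈ disk d, ∀ u v : Eu d, inner ℝ u v = (0 : ℝ) →
      dirDeriv u (dirDeriv v F) z = 0 := by
    intro z hz u v huv
    have hvu : inner ℝ v u = (0 : ℝ) := by rw [real_inner_comm]; exact huv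
    have hZ := congrArg (fun w => (inner ℝ (φ.ext z - c) w : ℝ)) (φ.invFactor_cross hz huv)
    simp only [inner_add_right, inner_smul_right, inner_zero_right] at hZ
    rw [hDDF z hz, φ.hessian_invFactor_smul c hz huv, φ.hessian_invFactor hd hz huv,
      φ.dirDeriv_invFactor_smul c hz, φ.dirDeriv_invFactor_smul c hz]
    simp only [zero_smul, inner_zero_left, inner_add_left, inner_smul_left, conj_trivial,
      φ.inner_dirDeriv hz, huv, hvu]
    linear_combination hZ
  have hpy : φ.ext (y : Eu d) - c = 0 := sub_self _
  have hD1 : ∀ v, dirDeriv v F y = 0 := fun v => by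
    rw [hDF y y.2, hpy, inner_zero_right, smul_zero, inner_zero_left, add_zero]
  let i : Fin d := ⟨0, by omega⟩
  -- At y only the products of first derivatives survive, giving 2 ρ(y) Ω(y)² = 2 Ω(y).
  have hval : dirDeriv (basisVec i) (dirDeriv (basisVec i) F) y = 2 * φ.factor y := by
    rw [hDDF y y.2, φ.dirDeriv_invFactor_smul c y.2, hpy]
    simp only [smul_zero, inner_zero_left, inner_zero_right, zero_add, add_zero, inner_smul_left,
      conj_trivial, φ.inner_dirDeriv y.2, invFactor, φ.factorExt_apply]
    have := (φ.factor_pos y).ne'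
    simp [basisVec]
    field_simp
    norm_num
  have h := eq_norm_sq_of_hessian (by omega) hF hH y.2 (by simp only [F, hpy, inner_zero_right])
    hD1 i x.2
  rw [hval] at h
  simp only [F, inner_smul_left, conj_trivial, real_inner_self_eq_norm_sq, invFactor,
    φ.factorExt_apply, hc, φ.ext_apply] at h
  have hx := (φ.factor_pos x).ne'
  field_simp at h
  linarith

end ConfEmb

end Liouville

end

end ConformalDisk

/-! ### Conformal covariance -/

namespace ConformalDisk

noncomputable section

section Covariance

variable {d : ℕ}

lemma conv_newton_test_contDiff (hd : 3 ≤ d) (f : Test d) : ContDiff ℝ ∞ (conv (newton d) f) :=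
  conv_contDiff (locallyIntegrable_newton hd) f.contDiff f.hasCompactSupport

lemma conv_newton_testL (hd : 3 ≤ d) (h : Test d) : conv (newton d) (testL d h) = h := by
  have e : (testL d h : Eu d → ℝ) = fun x => -Δ (h : Eu d → ℝ) x := funext (testL_apply h)
  ext x
  rw [e, conv_apply]
  simp only [mul_neg]
  rw [integral_neg, ← conv_apply, conv_newton_laplacian hd h.contDiff h.hasCompactSupport]
  simp

lemma greenForm_eq (f g : Test d) :
    greenForm d f g = ∫ x, f x * conv (newton d) g x := by
  change ∫ p in (disk d : Set (Eu d)) ×ˢ (disk d : Set (Eu d)),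
      green d p.1 p.2 * f p.1 * g p.2 = _
  rw [Measure.volume_eq_prod, setIntegral_prod _ (integrableOn_green_mul f g),
    ← setIntegral_test_mul]
  refine integral_congr_ae (.of_forall fun x => ?_)
  dsimp only
  rw [conv_apply_swap, ← integral_const_mul]
  rw [setIntegral_eq_integral_of_forall_compl_eq_zero fun y hy => by
    rw [test_eq_zero g hy, mul_zero]]
  refine integral_congr_ae (.of_forall fun y => ?_)
  simp only [green_eq_newton]
  ring

lemma greenForm_comm (f g : Test d) : greenForm d f g = greenForm d g f := by
  change ∫ p in (disk d : Set (Eu d)) ×ˢ (disk d : Set (Eu d)), green d p.1 p.2 * f p.1 * g p.2 =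
    ∫ p in (disk d : Set (Eu d)) ×ˢ (disk d : Set (Eu d)), green d p.1 p.2 * g p.1 * f p.2
  rw [Measure.volume_eq_prod, ← setIntegral_prod_swap]
  refine integral_congr_ae (.of_forall fun p => ?_)
  simp only [Prod.fst_swap, Prod.snd_swap, green_eq_newton]
  rw [← newton_neg, neg_sub]
  ring

lemma testPairing_apply (h f : Test d) : testPairing d h f = ∫ x, f x * h x :=
  setIntegral_test_mul f h

/-- G inverts L. This is the only property of G needed for exp(∂_G) to cancel the contraction term
of Δ^BV. -/
lemma greenForm_testL (hd : 3 ≤ d) (h f : Test d) :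
    greenForm d (testL d h) f = testPairing d h f := by
  rw [greenForm_comm, greenForm_eq, conv_newton_testL hd, testPairing_apply]

lemma pairing_eq_integral (f : Test d) {u : Harm d} {w : Eu d → ℝ}
    (h : ∀ x : disk d, u x = w x) : pairing d f u = ∫ x, f x * w x := by
  rw [pairing_apply]
  refine integral_congr_ae (.of_forall fun x => ?_)
  dsimp only
  by_cases hx : x ∈ disk d
  · rw [← h ⟨x, hx⟩, ← zeroExt_apply u ⟨x, hx⟩]
  · rw [test_eq_zero f hx, zero_mul, zero_mul]

/-! ### Change of variables and transport along conformal embeddings -/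

namespace ConfEmb

/-- The Gram matrix of the columns of dφ is Ω² times the identity, so the squared determinant is
Ω^{2d}. -/
lemma abs_det_fderiv (φ : ConfEmb d) {x : Eu d} (hx : x ∈ disk d) :
    |(fderiv ℝ φ.ext x).det| = φ.factorExt x ^ d := by
  have h := LinearMap.normDet_sq_eq_det_gram
    (fderiv ℝ φ.ext x : Eu d →ₗ[ℝ] Eu d) (EuclideanSpace.basisFun (Fin d) ℝ)
  rw [LinearMap.normDet_eq_abs_det] at h
  have hg : Matrix.gram ℝ (fun i => (fderiv ℝ φ.ext x : Eu d →ₗ[ℝ] Eu d)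
      (EuclideanSpace.basisFun (Fin d) ℝ i)) = φ.factorExt x ^ 2 • (1 : Matrix (Fin d) (Fin d) ℝ) := by
    ext i j
    refine (φ.inner_dirDeriv hx _ _).trans ?_
    rw [(EuclideanSpace.basisFun (Fin d) ℝ).inner_eq_ite]
    simp [Matrix.one_apply]
  have h' : |(fderiv ℝ φ.ext x).det| ^ 2 = (φ.factorExt x ^ d) ^ 2 := by
    refine Eq.trans ?_ (h.trans ?_)
    · rfl
    · rw [← pow_mul, mul_comm d 2, pow_mul]
      have := congrArg Matrix.det hg
      rw [Matrix.det_smul, Matrix.det_one, mul_one, Fintype.card_fin] at this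
      exact this
  exact (pow_left_inj₀ (abs_nonneg _) (pow_nonneg (φ.factorExt_pos hx).le d) two_ne_zero).1 h'

/-- The image `φ(𝔻)`. -/
def image (φ : ConfEmb d) : Set (Eu d) := Set.range fun x => (φ x : Eu d)

lemma isOpen_image (φ : ConfEmb d) : IsOpen φ.image :=
  ((disk d).isOpen.isOpenEmbedding_subtypeVal.comp φ.isOpenEmbedding).isOpen_range

lemma image_subset_disk (φ : ConfEmb d) : φ.image ⊆ disk d := by
  rintro _ ⟨x, rfl⟩
  exact (φ x).2

lemma mem_image (φ : ConfEmb d) (x : disk d) : (φ x : Eu d) ∈ φ.image := ⟨x, rfl⟩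

lemma ext_image_disk (φ : ConfEmb d) : φ.ext '' disk d = φ.image := by
  ext y
  constructor
  · rintro ⟨x, hx, rfl⟩
    exact ⟨⟨x, hx⟩, (φ.ext_apply ⟨x, hx⟩).symm⟩
  · rintro ⟨x, rfl⟩
    exact ⟨x, x.2, φ.ext_apply x⟩

lemma integral_eq_of_eq_zero (φ : ConfEmb d) {g : Eu d → ℝ} (hg : ∀ y ∉ φ.image, g y = 0) :
    ∫ y, g y = ∫ x in (disk d : Set (Eu d)), φ.factorExt x ^ d * g (φ.ext x) := by
  rw [← setIntegral_eq_integral_of_forall_compl_eq_zero hg, ← ext_image_disk,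
    integral_image_eq_integral_abs_det_fderiv_smul volume (disk d).isOpen.measurableSet
      (fun x hx => (φ.differentiableAt_ext ⟨x, hx⟩).hasFDerivAt.hasFDerivWithinAt)]
  · refine setIntegral_congr_fun (disk d).isOpen.measurableSet fun x hx => ?_
    rw [φ.abs_det_fderiv hx, smul_eq_mul]
  · intro x hx y hy hxy
    have h1 := φ.ext_apply ⟨x, hx⟩
    have h2 := φ.ext_apply ⟨y, hy⟩
    dsimp only at h1 h2
    rw [h1, h2] at hxy
    exact congrArg Subtype.val (φ.coe_injective hxy)

/-- The function `u^φ(x) = Ω_φ(x)^{(d-2)/2} u(φ(x))`. -/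
def pull (φ : ConfEmb d) (u : Eu d → ℝ) (x : Eu d) : ℝ :=
  φ.factorExt x ^ (((d : ℝ) - 2) / 2) * u (φ.ext x)

lemma pull_apply (φ : ConfEmb d) (u : Eu d → ℝ) (x : disk d) :
    φ.pull u x = φ.factor x ^ (((d : ℝ) - 2) / 2) * u (φ x) := by
  rw [pull, factorExt_apply, ext_apply]

lemma push_apply (φ : ConfEmb d) (f : Test d) (x : disk d) :
    φ.push f (φ x : Eu d) = φ.factor x ^ (-(((d : ℝ) + 2) / 2)) * f x := φ.pushFun_apply f x

lemma push_eq_zero (φ : ConfEmb d) (f : Test d) {y : Eu d} (hy : y ∉ φ.image) :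
    φ.push f y = 0 := by
  change φ.pushFun f y = 0
  exact Function.extend_apply' _ _ _ hy

lemma tsupport_push_subset (φ : ConfEmb d) (f : Test d) : tsupport (φ.push f) ⊆ φ.image := by
  obtain ⟨K, hK, hKr, hK0⟩ := φ.exists_compact_pushFun f
  exact (closure_minimal (Function.support_subset_iff'.2 hK0) hK.isClosed).trans hKr

lemma push_ext (φ : ConfEmb d) {f : Test d} {g : Test d}
    (h : ∀ x : disk d, g (φ x : Eu d) = φ.factor x ^ (-(((d : ℝ) + 2) / 2)) * f x)
    (h0 : ∀ y ∉ φ.image, g y = 0) : g = φ.push f := by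
  ext y
  by_cases hy : y ∈ φ.image
  · obtain ⟨x, rfl⟩ := hy
    rw [push_apply]
    exact h x
  · rw [push_eq_zero φ f hy, h0 y hy]

/-- The weights are chosen to make W_φ and u ↦ u^φ transposes: the Jacobian Ω^d times Ω^{-(d+2)/2}
is Ω^{(d-2)/2}. -/
lemma integral_push_mul (φ : ConfEmb d) (f : Test d) (u : Eu d → ℝ) :
    ∫ y, φ.push f y * u y = ∫ x, f x * φ.pull u x := by
  rw [φ.integral_eq_of_eq_zero fun y hy => by rw [push_eq_zero φ f hy, zero_mul],
    ← setIntegral_test_mul]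
  refine setIntegral_congr_fun (disk d).isOpen.measurableSet fun x hx => ?_
  have h := φ.push_apply f ⟨x, hx⟩
  have h1 := φ.ext_apply ⟨x, hx⟩
  have h2 := φ.factorExt_apply ⟨x, hx⟩
  dsimp only at h h1 h2 ⊢
  have hp := φ.factor_pos ⟨x, hx⟩
  rw [pull, h2, h1, h, ← Real.rpow_natCast]
  have : φ.factor ⟨x, hx⟩ ^ (((d : ℝ) - 2) / 2) =
      φ.factor ⟨x, hx⟩ ^ (d : ℝ) * φ.factor ⟨x, hx⟩ ^ (-(((d : ℝ) + 2) / 2)) := by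
    rw [← Real.rpow_add hp]
    congr 1
    ring
  rw [this]
  ring

/-- The two-point identity raised to the power -(d-2)/2; all later covariance statements about
potentials derive from it. -/
lemma newton_sub (hd : 3 ≤ d) (φ : ConfEmb d) (x y : disk d) :
    newton d ((φ x : Eu d) - φ y) = φ.factor x ^ (-(((d : ℝ) - 2) / 2)) *
      φ.factor y ^ (-(((d : ℝ) - 2) / 2)) * newton d ((x : Eu d) - y) := by
  have hx := φ.factor_pos x
  have hy := φ.factor_pos y
  rw [newton_eq hd, newton_eq hd, φ.norm_sub_sq hd, Real.mul_rpow (by positivity) (by positivity),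
    Real.mul_rpow hx.le hy.le]
  ring

lemma rpow_neg_mul_cancel (φ : ConfEmb d) (x : disk d) (p : ℝ) :
    φ.factor x ^ p * φ.factor x ^ (-p) = 1 := by
  rw [← Real.rpow_add (φ.factor_pos x), add_neg_cancel, Real.rpow_zero]

lemma conv_newton_push_apply (f : Test d) (φ : ConfEmb d) (z : Eu d) :
    conv (newton d) (φ.push f) z = ∫ x, f x * φ.pull (fun y => newton d (z - y)) x := by
  rw [conv_apply_swap, ← integral_push_mul]
  simp only [mul_comm]

lemma conv_newton_push (hd : 3 ≤ d) (φ : ConfEmb d) (f : Test d) (x : disk d) :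
    conv (newton d) (φ.push f) (φ x) =
      φ.factor x ^ (-(((d : ℝ) - 2) / 2)) * conv (newton d) f x := by
  rw [conv_newton_push_apply, conv_apply_swap, ← integral_const_mul]
  refine integral_congr_ae (.of_forall fun y => ?_)
  dsimp only
  by_cases hy : y ∈ disk d
  · have h := φ.pull_apply (fun y => newton d (φ x - y)) ⟨y, hy⟩
    dsimp only at h
    rw [h, φ.newton_sub hd]
    linear_combination f y * φ.factor x ^ (-(((d : ℝ) - 2) / 2)) * newton d ((x : Eu d) - y) *
      φ.rpow_neg_mul_cancel ⟨y, hy⟩ (((d : ℝ) - 2) / 2)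
  · rw [test_eq_zero f hy]
    ring

/-- In ∫ W_φ f · (N ∗ W_φ g), the weight Ω^{(d-2)/2} from the transposition cancels the weight of
the potential. -/
lemma greenForm_push (hd : 3 ≤ d) (φ : ConfEmb d) (f g : Test d) :
    greenForm d (φ.push f) (φ.push g) = greenForm d f g := by
  rw [greenForm_eq, greenForm_eq, integral_push_mul]
  refine integral_congr_ae (.of_forall fun x => ?_)
  dsimp only
  by_cases hx : x ∈ disk d
  · have h := φ.pull_apply (conv (newton d) (φ.push g)) ⟨x, hx⟩
    dsimp only at h
    rw [h, φ.conv_newton_push hd]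
    linear_combination f x * conv (newton d) g x *
      φ.rpow_neg_mul_cancel ⟨x, hx⟩ (((d : ℝ) - 2) / 2)
  · rw [test_eq_zero f hx]
    ring

/-- The action of `φ` on test functions of conformal weight `(d - 2) / 2`. -/
lemma exists_pushWeight (φ : ConfEmb d) (h : Test d) :
    ∃ h' : Test d, (∀ x : disk d, h' (φ x : Eu d) = φ.factor x ^ (-(((d : ℝ) - 2) / 2)) * h x) ∧
      tsupport h' ⊆ φ.image := by
  -- W_φ applied to Ω² h has weight -(d+2)/2 + 2 = -(d-2)/2. Since Ω is smooth only on 𝔻, it is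
  -- replaced by a global function agreeing with it near the support of h.
  obtain ⟨w, V, hw, -, -, -, hKV, -, hwu⟩ := exists_cutoff h.hasCompactSupport (disk d).isOpen
    h.tsupport_subset φ.factorExt_contDiffOn
  have hs : tsupport (fun x => w x ^ 2 * h x) ⊆ tsupport h :=
    closure_mono fun x hx hx' => hx (by
      change w x ^ 2 * h x = 0
      rw [hx', mul_zero])
  let h₂ : Test d := mkTest (fun x => w x ^ 2 * h x) ((hw.pow 2).mul h.contDiff)
    (h.hasCompactSupport.of_isClosed_subset (isClosed_tsupport _) hs)
    (hs.trans h.tsupport_subset)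
  refine ⟨φ.push h₂, fun x => ?_, φ.tsupport_push_subset h₂⟩
  rw [push_apply]
  change _ * (w x ^ 2 * h x) = _
  by_cases hx : (x : Eu d) ∈ tsupport h
  · rw [hwu (hKV hx), factorExt_apply, ← mul_assoc, ← Real.rpow_natCast,
      ← Real.rpow_add (φ.factor_pos x)]
    congr 2
    push_cast
    ring
  · rw [image_eq_zero_of_notMem_tsupport hx]
    ring

/-- The conformal covariance of the Laplacian. -/
lemma push_testL (hd : 3 ≤ d) (φ : ConfEmb d) (h : Test d) :
    ∃ h' : Test d, testL d h' = φ.push (testL d h) ∧ tsupport h' ⊆ φ.image ∧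
      ∀ x : disk d, h' (φ x : Eu d) = φ.factor x ^ (-(((d : ℝ) - 2) / 2)) * h x := by
  obtain ⟨h', hh, hs⟩ := φ.exists_pushWeight h
  refine ⟨h', ?_, hs, hh⟩
  -- On φ(𝔻), h' is the potential of W_φ(Lh), by covariance of potentials and N ∗ Lh = h. As L
  -- inverts the potential, Lh' = W_φ(Lh) there; outside φ(𝔻) both sides vanish.
  have hE : Set.EqOn (h' : Eu d → ℝ) (conv (newton d) (φ.push (testL d h))) φ.image := by
    rintro _ ⟨x, rfl⟩
    dsimp only
    rw [hh, φ.conv_newton_push hd, conv_newton_testL hd]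
  ext y
  rw [testL_apply]
  by_cases hy : y ∈ φ.image
  · rw [(laplacian_congr_nhds (Filter.eventually_of_mem (φ.isOpen_image.mem_nhds hy)
      hE)).eq_of_nhds, laplacian_conv_newton hd (φ.push (testL d h)).contDiff
        (φ.push (testL d h)).hasCompactSupport]
    simp
  · rw [push_eq_zero φ _ hy,
      image_eq_zero_of_notMem_tsupport fun hy' => hy (hs (tsupport_laplacian_subset _ hy')),
      neg_zero]

lemma testPairing_push (φ : ConfEmb d) {h h' : Test d}
    (hh : ∀ x : disk d, h' (φ x : Eu d) = φ.factor x ^ (-(((d : ℝ) - 2) / 2)) * h x)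
    (f : Test d) : testPairing d h' (φ.push f) = testPairing d h f := by
  rw [testPairing_apply, testPairing_apply, integral_push_mul]
  refine integral_congr_ae (.of_forall fun x => ?_)
  dsimp only
  by_cases hx : x ∈ disk d
  · have e := φ.pull_apply h' ⟨x, hx⟩
    dsimp only at e
    rw [e, hh]
    linear_combination f x * h x * φ.rpow_neg_mul_cancel ⟨x, hx⟩ (((d : ℝ) - 2) / 2)
  · rw [test_eq_zero f hx]
    ring

lemma testPairing_push_of_disjoint {φ ψ : ConfEmb d} (hφψ : Disjoint φ.image ψ.image)
    {h' : Test d} (hh : tsupport h' ⊆ φ.image) (f : Test d) :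
    testPairing d h' (ψ.push f) = 0 := by
  rw [testPairing_apply]
  refine integral_eq_zero_of_ae (.of_forall fun y => ?_)
  by_cases hy : y ∈ φ.image
  · exact mul_eq_zero_of_left (push_eq_zero ψ f fun hy' => Set.disjoint_left.1 hφψ hy hy') _
  · exact mul_eq_zero_of_right _ (image_eq_zero_of_notMem_tsupport fun hy' => hy (hh hy'))

lemma pull_contDiffOn (φ : ConfEmb d) {u : Eu d → ℝ} (hu : ContDiffOn ℝ ∞ u φ.image) :
    ContDiffOn ℝ ∞ (φ.pull u) (disk d) :=
  (φ.factorExt_contDiffOn.rpow_const_of_ne fun _ hx => (φ.factorExt_pos hx).ne').mul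
    (hu.comp φ.ext_contDiffOn fun _ hx => φ.ext_image_disk ▸ Set.mem_image_of_mem _ hx)

/-- The conformal covariance of harmonic functions. -/
lemma laplacian_pull (hd : 3 ≤ d) (φ : ConfEmb d) {u : Eu d → ℝ} (hu : ContDiffOn ℝ ∞ u φ.image)
    (hu0 : ∀ y ∈ φ.image, Δ u y = 0) : ∀ x ∈ disk d, Δ (φ.pull u) x = 0 := by
  have hs := φ.pull_contDiffOn hu
  have hc : ContinuousOn (Δ (φ.pull u)) (disk d) :=
    (laplacian_contDiffOn (disk d).isOpen hs).continuousOn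
  -- The equation is proved weakly: Δ(u^φ) tested against g becomes, by transposition and
  -- `push_testL`, Δu tested against a function supported in φ(𝔻). Continuity then upgrades almost
  -- everywhere to everywhere.
  have hae := (disk d).isOpen.ae_eq_zero_of_integral_contDiff_smul_eq_zero (μ := volume)
    (hc.locallyIntegrableOn (disk d).isOpen.measurableSet) fun g hg hgc hgs => by
      obtain ⟨g', hg', hgs', -⟩ := φ.push_testL hd (mkTest g hg hgc hgs)
      have h1 := integral_testL_mul (disk d).isOpen hs (mkTest g hg hgc hgs) hgs
      have h2 := integral_testL_mul φ.isOpen_image hu g' hgs'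
      rw [hg', integral_push_mul, h1] at h2
      have h3 : ∫ y, g' y * Δ u y = 0 := integral_eq_zero_of_ae (.of_forall fun y => by
        by_cases hy : y ∈ φ.image
        · exact mul_eq_zero_of_right _ (hu0 y hy)
        · exact mul_eq_zero_of_left
            (image_eq_zero_of_notMem_tsupport fun hy' => hy (hgs' hy')) _)
      rw [h3] at h2
      exact neg_injective h2
  exact Measure.eqOn_open_of_ae_eq
    ((ae_restrict_iff' (disk d).isOpen.measurableSet).2 hae) (disk d).isOpen hc continuousOn_const

lemma harm_laplacian (u : Harm d) : ∀ x ∈ disk d, Δ (zeroExt u) x = 0 := u.2.2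

lemma harm_ext {u v : Harm d} (h : ∀ x, u x = v x) : u = v := Subtype.ext (funext h)

/-- The linear operator `u ↦ u^φ` on harmonic functions. -/
def pullHarmLin (hd : 3 ≤ d) (φ : ConfEmb d) : Harm d →ₗ[ℝ] Harm d where
  toFun u := mkHarm (φ.pull (zeroExt u))
    (φ.pull_contDiffOn (u.2.1.mono φ.image_subset_disk))
    (φ.laplacian_pull hd (u.2.1.mono φ.image_subset_disk)
      fun y hy => harm_laplacian u y (φ.image_subset_disk hy))
  map_add' u v := harm_ext fun x => by
    change φ.pull (zeroExt (u.1 + v.1)) x = φ.pull (zeroExt u) x + φ.pull (zeroExt v) x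
    rw [zeroExt_add]
    exact mul_add _ _ _
  map_smul' c u := harm_ext fun x => by
    change φ.pull (zeroExt (c • u.1)) x = c * φ.pull (zeroExt u) x
    rw [zeroExt_smul]
    exact mul_left_comm _ _ _

lemma pullHarmLin_apply (hd : 3 ≤ d) (φ : ConfEmb d) (u : Harm d) (x : disk d) :
    φ.pullHarmLin hd u x = φ.factor x ^ (((d : ℝ) - 2) / 2) * u (φ x) := by
  change φ.pull (zeroExt u) x = _
  rw [pull_apply, zeroExt_apply]

/-- The interior estimates bound every derivative seminorm of u^φ by its supremum over a ball, hence
by the supremum of |u| over the compact image of that ball; no derivative of a composite is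
estimated. -/
lemma continuous_pullHarmLin (hd : 3 ≤ d) (φ : ConfEmb d) : Continuous (φ.pullHarmLin hd) := by
  refine WithSeminorms.continuous_of_isBounded (harm_withSeminorms d) (harm_withSeminorms d) _
    (Seminorm.IsBounded.of_real fun p => ?_)
  obtain ⟨r, C, hr0, hr, hC0, h⟩ := exists_harmSeminorm_le hd p
  have hK : IsCompact {y : disk d | ‖(y : Eu d)‖ ≤ r} := by
    have e : {y : disk d | ‖(y : Eu d)‖ ≤ r} = Subtype.val ⁻¹' Metric.closedBall (0 : Eu d) r := by
      ext y
      simp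
    rw [e, Topology.IsEmbedding.subtypeVal.isCompact_iff, Set.image_preimage_eq_of_subset]
    · exact isCompact_closedBall 0 r
    · rw [Subtype.range_coe_subtype]
      exact closedBall_subset_disk hr
  let K : TopologicalSpace.Compacts (disk d) :=
    ⟨φ '' {y : disk d | ‖(y : Eu d)‖ ≤ r}, hK.image φ.isOpenEmbedding.continuous⟩
  obtain ⟨B, hB⟩ := hK.exists_bound_of_continuousOn
    (f := fun y : disk d => φ.factor y ^ (((d : ℝ) - 2) / 2)) (by
      refine Continuous.continuousOn ?_
      have hc : Continuous fun y : disk d => φ.factorExt y :=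
        φ.factorExt_contDiffOn.continuousOn.comp_continuous continuous_subtype_val fun y => y.2
      simp only [factorExt_apply] at hc
      exact hc.rpow_const fun y => Or.inl (φ.factor_pos y).ne')
  refine ⟨{(K, 0)}, C * |B|, fun u => ?_⟩
  rw [Finset.sup_singleton, mul_assoc]
  refine h _ _ (by positivity) fun y hy => ?_
  rw [pullHarmLin_apply, abs_mul]
  exact mul_le_mul ((hB y hy).trans (le_abs_self B))
    (abs_le_harmSeminorm u K (Set.mem_image_of_mem _ hy)) (abs_nonneg _) (abs_nonneg _)

/-- The continuous linear operator `u ↦ u^φ` on harmonic functions. -/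
def pullHarm (hd : 3 ≤ d) (φ : ConfEmb d) : Harm d →L[ℝ] Harm d :=
  ⟨φ.pullHarmLin hd, φ.continuous_pullHarmLin hd⟩

lemma pullHarm_apply (hd : 3 ≤ d) (φ : ConfEmb d) (u : Harm d) (x : disk d) :
    φ.pullHarm hd u x = φ.factor x ^ (((d : ℝ) - 2) / 2) * u (φ x) := φ.pullHarmLin_apply hd u x

lemma pairing_push (hd : 3 ≤ d) (φ : ConfEmb d) (f : Test d) :
    pairing d (φ.push f) = transpose (φ.pullHarm hd) (pairing d f) := by
  ext u
  rw [pairing_apply, integral_push_mul]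
  symm
  exact pairing_eq_integral f fun _ => rfl

lemma transpose_pullHarm_dirac (hd : 3 ≤ d) (φ : ConfEmb d) (a : disk d) :
    transpose (φ.pullHarm hd) (dirac a) =
      (φ.factor a ^ (((d : ℝ) - 2) / 2)) • dirac (φ a) := by
  ext u
  change dirac a (φ.pullHarm hd u) = _ * dirac (φ a) u
  rw [dirac_apply, dirac_apply, pullHarm_apply]

/-- The harmonic function `x ↦ Ω_φ(x)^{(d-2)/2} G(z, φ(x))`, for `z` outside of `φ(𝔻)`. -/
def pullNewton (hd : 3 ≤ d) (φ : ConfEmb d) (z : Eu d) (hz : z ∉ φ.image) : Harm d :=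
  have hn : ContDiffOn ℝ ∞ (fun y => newton d (z - y)) φ.image :=
    (newton_sub_contDiffOn hd z).mono fun _ hy e => hz (Set.mem_singleton_iff.1 e ▸ hy)
  mkHarm (φ.pull fun y => newton d (z - y)) (φ.pull_contDiffOn hn)
    (φ.laplacian_pull hd hn fun _ hy => laplacian_newton_sub hd fun e => hz (e ▸ hy))

lemma pullNewton_apply (hd : 3 ≤ d) (φ : ConfEmb d) (z : Eu d) (hz : z ∉ φ.image) (x : disk d) :
    φ.pullNewton hd z hz x = φ.pull (fun y => newton d (z - y)) x := rfl

/-- Off φ(𝔻) the potential of W_φ f depends on f only through the functional it represents, so it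
can be evaluated for f representing a point evaluation or a derivative of one. -/
lemma conv_newton_push_eq_pairing (hd : 3 ≤ d) (φ : ConfEmb d) (z : Eu d) (hz : z ∉ φ.image)
    (f : Test d) : conv (newton d) (φ.push f) z = pairing d f (φ.pullNewton hd z hz) := by
  rw [conv_newton_push_apply]
  symm
  exact pairing_eq_integral f fun _ => rfl

/-- The pullback along `φ` of the potential of `W_ψ g`, if `φ` and `ψ` have disjoint images. -/
def pullPotential (hd : 3 ≤ d) {φ ψ : ConfEmb d} (h : Disjoint φ.image ψ.image) (g : Test d) :
    Harm d :=
  mkHarm (φ.pull (conv (newton d) (ψ.push g)))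
    (φ.pull_contDiffOn (conv_newton_test_contDiff hd _).contDiffOn)
    (φ.laplacian_pull hd (conv_newton_test_contDiff hd _).contDiffOn fun y hy => by
      rw [laplacian_conv_newton hd (ψ.push g).contDiff (ψ.push g).hasCompactSupport, Pi.neg_apply,
        push_eq_zero ψ g fun hy' => Set.disjoint_left.1 h hy hy', neg_zero])

lemma pullPotential_apply (hd : 3 ≤ d) {φ ψ : ConfEmb d} (h : Disjoint φ.image ψ.image)
    (g : Test d) (x : disk d) :
    pullPotential hd h g x = φ.pull (conv (newton d) (ψ.push g)) x := rfl

lemma greenForm_push_push (hd : 3 ≤ d) {φ ψ : ConfEmb d} (h : Disjoint φ.image ψ.image)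
    (f g : Test d) :
    greenForm d (φ.push f) (ψ.push g) = pairing d f (pullPotential hd h g) := by
  rw [greenForm_eq, integral_push_mul]
  symm
  exact pairing_eq_integral f fun _ => rfl

end ConfEmb

end Covariance

end

end ConformalDisk

/-! ### The quantization isomorphism and the operad algebra -/

namespace ConformalDisk

noncomputable section

section Quantization

variable {d : ℕ}

/-- Moving Lh out of exp(∂_G) produces the contraction with G(Lh, ·) = ∫ h(·), which cancels the
contraction term of Δ^BV. -/
lemma expContract₂_bv (hd : 3 ≤ d) (F : PolyAlg (Test d)) (h : Test d) :
    expContract₂ (greenForm d) (bv d (F ⊗ₜ h)) =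
      -(mulRange (testL d) (expContract₂ (greenForm d) F ⊗ₜ h)) := by
  have hB : ∀ f g, greenForm d f g = greenForm d g f := greenForm_comm
  have hL : greenForm d (testL d h) = testPairing d h := by
    ext f
    exact greenForm_testL hd h f
  rw [bv_tmul, expContract₂_add _ hB, ← neg_one_smul ℝ, expContract₂_smul _ hB, mul_comm F,
    expContract₂_ι_mul _ hB, expContract₂_contract _ hB, hL, mulRange_tmul, mul_comm _ (_ : PolyAlg _)]
  module

/-- The conjugated differential is precomposed with the bijection -exp(∂_G) ⊗ id, which does not
affect its range. -/
lemma map_range_bv (hd : 3 ≤ d) :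
    (LinearMap.range (bv d)).map (expContract₂Equiv (greenForm d) greenForm_comm).toLinearMap =
      LinearMap.range (mulRange (testL d)) := by
  set e := expContract₂Equiv (greenForm d) greenForm_comm with he
  have h : e.toLinearMap ∘ₗ bv d =
      mulRange (testL d) ∘ₗ ((e.trans (LinearEquiv.neg ℝ)).rTensor (Test d)).toLinearMap := by
    refine TensorProduct.ext' fun F h => ?_
    refine (expContract₂_bv hd F h).trans ?_
    change _ = mulRange (testL d) ((-(expContract₂ (greenForm d) F)) ⊗ₜ h)
    rw [TensorProduct.neg_tmul, map_neg]
  rw [← LinearMap.range_comp, h, LinearMap.range_comp, LinearEquiv.range, Submodule.map_top]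

/-- The quantization isomorphism induced by `exp(∂_{G_d})`. -/
def greenQuantization (hd : 3 ≤ d) : FCL d ≃ₗ[ℝ] PolyAlg (Scl d) :=
  (Submodule.Quotient.equiv _ _ (expContract₂Equiv (greenForm d) greenForm_comm)
    (map_range_bv hd)).trans
    ((Submodule.quotEquivOfEq _ _ (ker_polyMap_mkQ (testL d)).symm).trans
      ((polyMap (LinearMap.range (testL d)).mkQ).toLinearMap.quotKerEquivOfSurjective
        (polyMap_surjective _ (Submodule.mkQ_surjective _))))

lemma isGreenQuantization (hd : 3 ≤ d) : IsGreenQuantization (greenQuantization hd) :=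
  fun _ => rfl

/-! ### Functoriality of W_φ -/

namespace ConfEmb

/-- The conformal factor is extracted by choice, so its value is pinned down by uniqueness; the same
applies to composites and round balls. -/
lemma factor_id (hd : 1 ≤ d) (x : disk d) : (ConfEmb.id d).factor x = 1 := by
  refine ((ConfEmb.id d).factor_unique hd x 1 one_pos fun v w => ?_).symm
  have h : (ConfEmb.id d).ext =ᶠ[𝓝 (x : Eu d)] _root_.id :=
    Filter.eventually_of_mem ((disk d).isOpen.mem_nhds x.2)
      fun y hy => zeroExt_apply _ (⟨y, hy⟩ : disk d)
  rw [h.fderiv_eq]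
  simp

lemma factor_comp (hd : 1 ≤ d) (φ ψ : ConfEmb d) (x : disk d) :
    (φ.comp ψ).factor x = φ.factor (ψ x) * ψ.factor x := by
  refine ((φ.comp ψ).factor_unique hd x _ (mul_pos (φ.factor_pos _) (ψ.factor_pos x))
    fun v w => ?_).symm
  rw [show fderiv ℝ (φ.comp ψ).ext x = _ from fderiv_comp_ext φ ψ x,
    ContinuousLinearMap.comp_apply, ContinuousLinearMap.comp_apply, φ.inner_fderiv, ψ.inner_fderiv]
  ring

lemma push_id (hd : 1 ≤ d) : (ConfEmb.id d).push = LinearMap.id := by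
  refine LinearMap.ext fun f => ?_
  refine (push_ext _ (fun x => ?_) fun y hy => ?_).symm
  · rw [factor_id hd, Real.one_rpow, one_mul]
    rfl
  · exact test_eq_zero f fun hy' => hy ⟨⟨y, hy'⟩, rfl⟩

lemma push_comp (hd : 1 ≤ d) (φ ψ : ConfEmb d) : (φ.comp ψ).push = φ.push ∘ₗ ψ.push := by
  refine LinearMap.ext fun f => ?_
  refine (push_ext _ (fun x => ?_) fun y hy => ?_).symm
  · refine (φ.push_apply (ψ.push f) (ψ x)).trans ?_
    rw [push_apply, factor_comp hd, Real.mul_rpow (φ.factor_pos _).le (ψ.factor_pos x).le]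
    ring
  · by_cases h : y ∈ φ.image
    · obtain ⟨z, rfl⟩ := h
      refine (φ.push_apply (ψ.push f) z).trans ?_
      rw [push_eq_zero ψ f, mul_zero]
      rintro ⟨x, hx⟩
      exact hy ⟨x, congrArg (fun z => (φ z : Eu d)) (Subtype.ext hx)⟩
    · exact φ.push_eq_zero (ψ.push f) h

end ConfEmb

lemma CEemb.disjoint_image {n : ℕ} (φ : CEemb d n) {i j : Fin n} (h : i ≠ j) :
    Disjoint (φ i).image (φ j).image := by
  rw [Set.disjoint_left]
  rintro _ ⟨x, rfl⟩ ⟨y, hy⟩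
  exact Set.disjoint_left.1 (φ.disjoint h) ⟨x, rfl⟩ ⟨y, Subtype.ext hy⟩

/-- The multilinear map `(F₁, …, Fₙ) ↦ W_{φ₁}(F₁) ⋯ W_{φₙ}(Fₙ)`. -/
def pushProd {n : ℕ} (φ : CEemb d n) :
    MultilinearMap ℝ (fun _ : Fin n => PolyAlg (Test d)) (PolyAlg (Test d)) :=
  (MultilinearMap.mkPiAlgebra ℝ (Fin n) (PolyAlg (Test d))).compLinearMap
    fun i => (polyMap (φ i).push).toLinearMap

lemma pushProd_apply {n : ℕ} (φ : CEemb d n) (F : Fin n → PolyAlg (Test d)) :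
    pushProd φ F = ∏ i, polyMap (φ i).push (F i) := by
  simp [pushProd]

/-- A product of observables with disjoint supports, one of which is in the range of `Δ^BV`, is in
the range of `Δ^BV`. -/
lemma polyMap_push_bv_mul_mem (hd : 3 ≤ d) (φ : ConfEmb d) {P : PolyAlg (Test d)}
    (hP : ∀ h' : Test d, tsupport h' ⊆ φ.image → contract (testPairing d h') P = 0)
    (t : PolyAlg (Test d) ⊗[ℝ] Test d) :
    polyMap φ.push (bv d t) * P ∈ LinearMap.range (bv d) := by
  induction t using TensorProduct.induction_on with
  | zero => simp
  | add a b ha hb =>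
    rw [map_add, map_add, add_mul]
    exact add_mem ha hb
  | tmul A h =>
    obtain ⟨h', hL, hs, hh⟩ := φ.push_testL hd h
    -- By the Leibniz rule the contraction with h' could also hit P, but that term vanishes by
    -- hypothesis; on W_φ(A) it is W_φ of the contraction of A with h.
    refine ⟨(polyMap φ.push A * P) ⊗ₜ h', ?_⟩
    have e : testPairing d h' ∘ₗ φ.push = testPairing d h := by
      ext f
      exact φ.testPairing_push hh f
    rw [bv_tmul, bv_tmul, contract_mul, hP h' hs, contract_polyMap, e, hL, map_add, map_neg,
      map_mul, polyMap_ι]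
    ring

lemma pushProd_mem (hd : 3 ≤ d) {n : ℕ} (φ : CEemb d n) (i : Fin n)
    (F : Fin n → PolyAlg (Test d)) (hF : F i ∈ LinearMap.range (bv d)) :
    pushProd φ F ∈ LinearMap.range (bv d) := by
  classical
  obtain ⟨t, ht⟩ := hF
  rw [pushProd_apply, ← Finset.mul_prod_erase _ _ (Finset.mem_univ i), ← ht]
  refine polyMap_push_bv_mul_mem hd (φ i) (fun h' hs => ?_) t
  refine Finset.prod_induction _ (fun P => contract (testPairing d h') P = 0) (fun a b ha hb => ?_)
    (contract_one _) fun j hj => ?_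
  · rw [contract_mul, ha, hb, mul_zero, mul_zero, add_zero]
  · have e : testPairing d h' ∘ₗ (φ j).push = 0 := by
      ext f
      exact ConfEmb.testPairing_push_of_disjoint
        (φ.disjoint_image (Finset.ne_of_mem_erase hj).symm) hs f
    rw [contract_polyMap, e, map_zero, LinearMap.zero_apply, map_zero]

/-- The operations on the observables of the disk. -/
def factorizationProduct (n : ℕ) (φ : CEemb d n) :
    MultilinearMap ℝ (fun _ : Fin n => FCL d) (FCL d) :=
  ((LinearMap.range (bv d)).mkQ.compMultilinearMap (pushProd φ)).compLinearMap fun _ =>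
    ((LinearMap.range (bv d)).mkQ.exists_rightInverse_of_surjective
      (LinearMap.range_eq_top.2 (Submodule.mkQ_surjective _))).choose

lemma isFactorizationProduct (hd : 3 ≤ d) :
    IsFactorizationProduct (factorizationProduct (d := d)) := by
  intro n φ F
  have hs := ((LinearMap.range (bv d)).mkQ.exists_rightInverse_of_surjective
      (LinearMap.range_eq_top.2 (Submodule.mkQ_surjective _))).choose_spec
  rw [← pushProd_apply]
  -- The operation was defined by means of a chosen linear section of the quotient map; its
  -- representatives differ from the F i by elements of the range of Δ^BV, which do not matter.
  refine multilinear_eq_of_sub_mem (LinearMap.range (bv d))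
    ((LinearMap.range (bv d)).mkQ.compMultilinearMap (pushProd φ)) (fun i x hx => ?_) _ F
    fun i => ?_
  · exact (Submodule.Quotient.mk_eq_zero _).2 (pushProd_mem hd φ i x hx)
  · rw [← Submodule.Quotient.eq]
    exact LinearMap.congr_fun hs ((LinearMap.range (bv d)).mkQ (F i))

/-- Decomposition of a product along the insertion of a block of `m` factors in place of the
`i`-th factor. -/
lemma prod_eq_prod_of_block {M : Type*} [CommMonoid M] {n m : ℕ} (i : Fin (n + 1))
    (a : Fin (n + m) → M) (b : Fin (n + 1) → M)
    (h₁ : ∀ (k : ℕ) (hk : k < i.1), a ⟨k, by omega⟩ = b ⟨k, by omega⟩)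
    (h₂ : ∏ l : Fin m, a ⟨i.1 + l.1, by omega⟩ = b i)
    (h₃ : ∀ (k : ℕ) (hk : i.1 < k) (hk' : k < n + 1), a ⟨k + m - 1, by omega⟩ = b ⟨k, hk'⟩) :
    ∏ k, a k = ∏ j, b j := by
  obtain ⟨i, hi⟩ := i
  obtain ⟨p, rfl⟩ : ∃ p, n = i + p := ⟨n - i, by omega⟩
  -- Passing to sequences on ℕ, padded by 1, allows the products to be split into the ranges before,
  -- in and after the block.
  let a' : ℕ → M := fun k => if h : k < i + p + m then a ⟨k, h⟩ else 1
  let b' : ℕ → M := fun k => if h : k < i + p + 1 then b ⟨k, h⟩ else 1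
  have ha : ∀ k (h : k < i + p + m), a' k = a ⟨k, h⟩ := fun k h => dif_pos h
  have hb : ∀ k (h : k < i + p + 1), b' k = b ⟨k, h⟩ := fun k h => dif_pos h
  have ea : ∏ k, a k = ∏ k ∈ Finset.range (i + p + m), a' k := by
    rw [← Fin.prod_univ_eq_prod_range]
    exact Finset.prod_congr rfl fun k _ => (ha k k.2).symm
  have eb : ∏ k, b k = ∏ k ∈ Finset.range (i + p + 1), b' k := by
    rw [← Fin.prod_univ_eq_prod_range]
    exact Finset.prod_congr rfl fun k _ => (hb k k.2).symm
  have em : ∏ l ∈ Finset.range m, a' (i + l) = b' i := by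
    rw [← Fin.prod_univ_eq_prod_range (fun l => a' (i + l))]
    rw [hb i hi, ← h₂]
    exact Finset.prod_congr rfl fun l _ => ha _ _
  rw [ea, eb, show i + p + m = i + m + p by omega, show i + p + 1 = i + 1 + p by omega,
    Finset.prod_range_add, Finset.prod_range_add, Finset.prod_range_add, Finset.prod_range_add, em,
    Finset.prod_range_one, add_zero]
  congr 1
  · congr 1
    refine Finset.prod_congr rfl fun k hk => ?_
    have hk' := Finset.mem_range.1 hk
    rw [ha k (by omega), hb k (by omega)]
    exact h₁ k hk'
  · refine Finset.prod_congr rfl fun k hk => ?_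
    have hk' := Finset.mem_range.1 hk
    have e := h₃ (i + 1 + k) (by dsimp only; omega) (by omega)
    rw [ha (i + m + k) (by omega), hb (i + 1 + k) (by omega), ← e]
    congr 2
    omega

lemma isCEAlgebra_of_isFactorizationProduct (hd : 1 ≤ d)
    {m : ∀ n, CEemb d n → MultilinearMap ℝ (fun _ : Fin n => FCL d) (FCL d)}
    (hm : IsFactorizationProduct m) : IsCEAlgebra m where
  unit x := by
    obtain ⟨F, rfl⟩ := Submodule.mkQ_surjective _ x
    have h := hm 1 (CEemb.unit d) ![F]
    rw [Fin.prod_univ_one] at h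
    have e : (fun i => (LinearMap.range (bv d)).mkQ ((![F] : Fin 1 → _) i)) =
        ![(LinearMap.range (bv d)).mkQ F] := by
      ext i
      rw [Subsingleton.elim i 0]
      rfl
    rw [← e, h]
    congr 1
    change polyMap (ConfEmb.id d).push F = F
    rw [ConfEmb.push_id hd, polyMap_id_apply]
  comp n k φ i ψ x := by
    choose F hF using fun j => Submodule.mkQ_surjective (LinearMap.range (bv d)) (x j)
    obtain rfl : (fun j => (LinearMap.range (bv d)).mkQ (F j)) = x := funext hF
    -- Representatives of the inputs of the outer operation: in slot i, the product which represents
    -- the inner operation.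
    let G : Fin (n + 1) → PolyAlg (Test d) := fun j =>
      if h₁ : j.1 < i.1 then F ⟨j.1, by omega⟩
      else if h₂ : j.1 = i.1 then ∏ l, polyMap (ψ l).push (F ⟨i.1 + l.1, by omega⟩)
      else F ⟨j.1 + k - 1, by omega⟩
    have hG : (fun j : Fin (n + 1) =>
        if h₁ : j.1 < i.1 then (LinearMap.range (bv d)).mkQ (F ⟨j.1, by omega⟩)
        else if h₂ : j.1 = i.1 then
          m k ψ fun l => (LinearMap.range (bv d)).mkQ (F ⟨i.1 + l.1, by omega⟩)
        else (LinearMap.range (bv d)).mkQ (F ⟨j.1 + k - 1, by omega⟩)) =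
        fun j => (LinearMap.range (bv d)).mkQ (G j) := by
      ext j
      simp only [G]
      split_ifs with h₁ h₂
      · rfl
      · exact hm k ψ fun l => F ⟨i.1 + l.1, by omega⟩
      · rfl
    rw [hm, hG, hm]
    congr 1
    refine prod_eq_prod_of_block i _ _ (fun j hj => ?_) ?_ fun j hj hj' => ?_
    · simp only [CEemb.comp, G, dif_pos hj]
    · simp only [CEemb.comp, G, lt_irrefl, dif_neg, dif_pos, not_false_eq_true, map_prod]
      refine Finset.prod_congr rfl fun l _ => ?_
      have h₁ : ¬ i.1 + l.1 < i.1 := by omega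
      have h₂ : i.1 + l.1 < i.1 + k := by omega
      simp only [dif_neg h₁, dif_pos h₂, add_tsub_cancel_left]
      rw [ConfEmb.push_comp hd, ← polyMap_comp_apply]
    · have h₁ : ¬ j + k - 1 < i.1 := by omega
      have h₂ : ¬ j + k - 1 < i.1 + k := by omega
      have h₃ : ¬ j < i.1 := by omega
      have h₄ : ¬ j = i.1 := by omega
      have h₅ : j + k - 1 + 1 - k = j := by omega
      simp only [CEemb.comp, G, dif_neg h₁, dif_neg h₂, dif_neg h₃, dif_neg h₄, h₅]
  equivariant n φ σ x := by
    choose F hF using fun j => Submodule.mkQ_surjective (LinearMap.range (bv d)) (x j)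
    obtain rfl : (fun j => (LinearMap.range (bv d)).mkQ (F j)) = x := funext hF
    rw [hm, hm]
    congr 1
    exact Equiv.prod_comp σ fun i => polyMap (φ i).push (F i)

lemma IsCEAlgebra.transport {A B : Type*} [AddCommGroup A] [Module ℝ A] [AddCommGroup B]
    [Module ℝ B] {ρ : ∀ n, CEemb d n → MultilinearMap ℝ (fun _ : Fin n => A) A}
    (h : IsCEAlgebra ρ) (e : A ≃ₗ[ℝ] B) :
    IsCEAlgebra fun n φ => e.toLinearMap.compMultilinearMap
      ((ρ n φ).compLinearMap fun _ => e.symm.toLinearMap) where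
  unit x := by
    refine Eq.trans ?_ (e.apply_symm_apply x)
    refine congrArg e (Eq.trans ?_ (h.unit (e.symm x)))
    refine congrArg (ρ 1 (CEemb.unit d)) ?_
    ext i
    rw [Subsingleton.elim i 0]
    rfl
  comp n m φ i ψ x := by
    refine congrArg e ((h.comp n m φ i ψ fun j => e.symm (x j)).trans ?_)
    refine congrArg (ρ (n + 1) φ) ?_
    ext j
    dsimp only
    split_ifs with h₁ h₂
    · rfl
    · exact (e.symm_apply_apply _).symm
    · rfl
  equivariant n φ σ x := congrArg e (h.equivariant n φ σ fun j => e.symm (x j))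

lemma isCEAlgebra_rhoH (hd : 1 ≤ d) (T : Scl d ≃ₗ[ℝ] HDual d) (Ψ : FCL d ≃ₗ[ℝ] PolyAlg (Scl d))
    {m : ∀ n, CEemb d n → MultilinearMap ℝ (fun _ : Fin n => FCL d) (FCL d)}
    (hm : IsFactorizationProduct m) : IsCEAlgebra (rhoH T Ψ m) :=
  (isCEAlgebra_of_isFactorizationProduct hd hm).transport (Ψ.trans (polyEquiv T))

end Quantization

end

end ConformalDisk

/-! ### The explicit description of the operations -/

namespace ConformalDisk

noncomputable section

section Operations

variable {d : ℕ}

lemma quantization_mkQ (hd : 3 ≤ d) (F : PolyAlg (Test d)) :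
    (greenQuantization hd).trans (polyEquiv (harmonicPairing hd))
      ((LinearMap.range (bv d)).mkQ F) =
      polyMap (pairing d) (expContract₂ (greenForm d) F) :=
  polyMap_comp_apply (harmonicPairing hd).toLinearMap (LinearMap.range (testL d)).mkQ
    (expContract₂ (greenForm d) F)

lemma exists_quantization_eq (hd : 3 ≤ d) (x : PolyAlg (HDual d)) :
    ∃ F : PolyAlg (Test d), polyMap (pairing d) (expContract₂ (greenForm d) F) = x := by
  obtain ⟨y, rfl⟩ := polyMap_surjective _ (pairing_surjective hd) x
  obtain ⟨F, rfl⟩ := (expContract₂Equiv (greenForm d) greenForm_comm).surjective y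
  exact ⟨F, rfl⟩

/-- The operations `ρ^H` for the isomorphisms constructed above. -/
abbrev harmOperation (hd : 3 ≤ d) (n : ℕ) (φ : CEemb d n) :
    MultilinearMap ℝ (fun _ : Fin n => PolyAlg (HDual d)) (PolyAlg (HDual d)) :=
  rhoH (harmonicPairing hd) (greenQuantization hd) factorizationProduct n φ

/-- The working formula: every element of P(H'(𝔻)) has the form used for the inputs, so the
operations can be computed in P(C_c^∞(𝔻)). -/
lemma harmOperation_apply (hd : 3 ≤ d) (n : ℕ) (φ : CEemb d n) (F : Fin n → PolyAlg (Test d)) :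
    harmOperation hd n φ (fun i => polyMap (pairing d) (expContract₂ (greenForm d) (F i))) =
      polyMap (pairing d) (expContract₂ (greenForm d) (∏ i, polyMap (φ i).push (F i))) := by
  rw [← quantization_mkQ hd, ← isFactorizationProduct hd]
  refine congrArg ((greenQuantization hd).trans (polyEquiv (harmonicPairing hd)))
    (congrArg (factorizationProduct n φ) (funext fun i => ?_))
  dsimp only
  rw [← quantization_mkQ hd]
  exact LinearEquiv.symm_apply_apply _ _

/-- W_φ preserves the Green form, so exp(∂_G) commutes with P(W_φ) and no quantum correction
appears. -/
lemma harmOperation_one (hd : 3 ≤ d) (φ : CEemb d 1) (F : PolyAlg (HDual d)) :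
    harmOperation hd 1 φ ![F] = polyMap (transpose ((φ 0).pullHarm hd)) F := by
  obtain ⟨X, rfl⟩ := exists_quantization_eq hd F
  have h := harmOperation_apply hd 1 φ ![X]
  have e : (fun i => polyMap (pairing d) (expContract₂ (greenForm d) ((![X] : Fin 1 → _) i))) =
      ![polyMap (pairing d) (expContract₂ (greenForm d) X)] := by
    ext i
    rw [Subsingleton.elim i 0]
    rfl
  rw [e, Fin.prod_univ_one] at h
  have hp : pairing d ∘ₗ (φ 0).push = transpose ((φ 0).pullHarm hd) ∘ₗ pairing d :=
    LinearMap.ext ((φ 0).pairing_push hd)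
  rw [h, Matrix.cons_val_zero, expContract₂_polyMap _ _ greenForm_comm _ greenForm_comm
    ((φ 0).greenForm_push hd), polyMap_comp_apply, polyMap_comp_apply, hp]

/-- Linear observables are fixed by exp(∂_G), and a product of two acquires exactly one contraction.
By disjointness of the images, the contraction is f paired with a harmonic function. -/
lemma harmOperation_two (hd : 3 ≤ d) (φ : CEemb d 2) (f g : Test d) :
    harmOperation hd 2 φ ![obs (pairing d f), obs (pairing d g)] =
      obs (transpose ((φ 0).pullHarm hd) (pairing d f)) *
        obs (transpose ((φ 1).pullHarm hd) (pairing d g)) +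
      algebraMap ℝ _ (pairing d f
        (ConfEmb.pullPotential hd (φ.disjoint_image (zero_ne_one : (0 : Fin 2) ≠ 1)) g)) := by
  have h := harmOperation_apply hd 2 φ ![SymmetricAlgebra.ι ℝ _ f, SymmetricAlgebra.ι ℝ _ g]
  have e : (fun i => polyMap (pairing d) (expContract₂ (greenForm d)
      ((![SymmetricAlgebra.ι ℝ _ f, SymmetricAlgebra.ι ℝ _ g] : Fin 2 → _) i))) =
      ![obs (pairing d f), obs (pairing d g)] := by
    ext i
    fin_cases i
    · exact (congrArg _ (expContract₂_ι _ greenForm_comm f)).trans (polyMap_ι _ f)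
    · exact (congrArg _ (expContract₂_ι _ greenForm_comm g)).trans (polyMap_ι _ g)
  rw [e, Fin.prod_univ_two] at h
  rw [h, Matrix.cons_val_zero, Matrix.cons_val_one, Matrix.cons_val_zero, polyMap_ι, polyMap_ι,
    expContract₂_ι_mul_ι _ greenForm_comm, map_add, map_mul, polyMap_ι, polyMap_ι,
    AlgHom.commutes, ConfEmb.pairing_push hd, ConfEmb.pairing_push hd,
    ConfEmb.greenForm_push_push hd (φ.disjoint_image (zero_ne_one : (0 : Fin 2) ≠ 1))]

lemma harmOperation_one_dirac (hd : 3 ≤ d) (φ : CEemb d 1) (a : disk d) :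
    harmOperation hd 1 φ ![obs (dirac a)] =
      ((φ 0).factor a ^ (((d : ℝ) - 2) / 2)) • obs (dirac (φ 0 a)) := by
  rw [harmOperation_one, obs, polyMap_ι, ConfEmb.transpose_pullHarm_dirac, map_smul]

/-- With f and g representing δ_a and δ_b, the contraction is evaluated one variable at a time: f
evaluates the pulled-back potential at a, and this value is g paired with the pulled-back kernel,
evaluated at b. -/
lemma harmOperation_two_dirac (hd : 3 ≤ d) (φ : CEemb d 2) (a b : disk d) :
    harmOperation hd 2 φ ![obs (dirac a), obs (dirac b)] =
      ((φ 0).factor a ^ (((d : ℝ) - 2) / 2) * (φ 1).factor b ^ (((d : ℝ) - 2) / 2)) •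
          (obs (dirac (φ 0 a)) * obs (dirac (φ 1 b))) +
        algebraMap ℝ (PolyAlg (HDual d))
          ((φ 0).factor a ^ (((d : ℝ) - 2) / 2) * (φ 1).factor b ^ (((d : ℝ) - 2) / 2) /
            (((d : ℝ) - 2) * sphereVol d *
              ‖(φ 0 a : Eu d) - (φ 1 b : Eu d)‖ ^ (d - 2))) := by
  obtain ⟨f, hf⟩ := pairing_surjective hd (dirac a)
  obtain ⟨g, hg⟩ := pairing_surjective hd (dirac b)
  have hz : (φ 0 a : Eu d) ∉ (φ 1).image := fun h => Set.disjoint_left.1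
    (φ.disjoint_image (zero_ne_one : (0 : Fin 2) ≠ 1)) ((φ 0).mem_image a) h
  have h := harmOperation_two hd φ f g
  rw [hf, hg, ConfEmb.transpose_pullHarm_dirac, ConfEmb.transpose_pullHarm_dirac, dirac_apply,
    ConfEmb.pullPotential_apply, ConfEmb.pull_apply,
    ConfEmb.conv_newton_push_eq_pairing hd _ _ hz, hg, dirac_apply, ConfEmb.pullNewton_apply,
    ConfEmb.pull_apply] at h
  rw [h]
  congr 1
  · rw [obs, obs, map_smul, map_smul, smul_mul_smul_comm]
  · congr 1
    rw [newton]
    ring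

lemma dirDeriv_affine (v : Eu d) (c r : ℝ) (b : Eu d) (f : Eu d → ℝ) :
    dirDeriv v (fun x => c * f (r • x + b)) = fun x => c * r * dirDeriv v f (r • x + b) := by
  ext x
  have h1 : fderiv ℝ (fun x => f (r • x + b)) x = r • fderiv ℝ f (r • x + b) := by
    rw [fderiv_comp_smul (f := fun y => f (y + b)) , fderiv_comp_add_right]
  change fderiv ℝ (fun x => c • f (r • x + b)) x v = _
  rw [show fderiv ℝ (fun x => c • f (r • x + b)) = c • fderiv ℝ fun x => f (r • x + b) from
    fderiv_const_smul_field c, Pi.smul_apply, h1]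
  simp only [_root_.smul_apply, smul_eq_mul, dirDeriv]
  ring

lemma multiDeriv_affine (α : Fin d → ℕ) (c r : ℝ) (b : Eu d) (f : Eu d → ℝ) :
    multiDeriv α (fun x => c * f (r • x + b)) =
      fun x => c * r ^ (∑ i, α i) * multiDeriv α f (r • x + b) := by
  refine multiDeriv_induction (P := fun S m => ∀ (c : ℝ) (f : Eu d → ℝ),
    S (fun x => c * f (r • x + b)) = fun x => c * r ^ m * S f (r • x + b)) (fun c f => ?_)
    (fun S T m n hS hT c f => ?_) (fun i c f => ?_) α c f
  · simp
  · rw [Function.comp_apply, hT, hS]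
    ext x
    rw [Function.comp_apply]
    ring
  · rw [dirDeriv_affine, pow_one]

lemma multiDeriv_const_mul (α : Fin d → ℕ) (c : ℝ) (f : Eu d → ℝ) (x : Eu d) :
    multiDeriv α (fun x => c * f x) x = c * multiDeriv α f x := by
  have h := congrFun (multiDeriv_affine α c 1 0 f) x
  simpa using h

lemma diracDeriv_apply (α : Fin d → ℕ) (a : disk d) (u : Harm d) :
    diracDeriv α a u = (-1) ^ (∑ i, α i) * multiDeriv α (zeroExt u) a := rfl

lemma diracDeriv_diskZero_apply (α : Fin d → ℕ) {u : Harm d} {w : Eu d → ℝ} {c r : ℝ} {a : Eu d}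
    (h : ∀ x : disk d, u x = c * w (r • (x : Eu d) + a)) :
    diracDeriv α (diskZero d) u =
      c * r ^ (∑ i, α i) * ((-1) ^ (∑ i, α i) * multiDeriv α w a) := by
  have hu : Set.EqOn (zeroExt u) (fun x => c * w (r • x + a)) (disk d) := fun x hx =>
    (zeroExt_apply u ⟨x, hx⟩).trans (h ⟨x, hx⟩)
  rw [diracDeriv_apply, multiDeriv_congr (disk d).isOpen hu α (diskZero d).2, multiDeriv_affine]
  change _ * (_ * multiDeriv α w (r • 0 + a)) = _
  rw [smul_zero, zero_add]
  ring

/-! ### Round balls -/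

lemma fderiv_smul_add (r : ℝ) (a x : Eu d) :
    fderiv ℝ (fun x => r • x + a) x = r • ContinuousLinearMap.id ℝ (Eu d) :=
  HasFDerivAt.fderiv (((hasFDerivAt_id x).const_smul r).add_const a)

/-- The affine embedding `x ↦ r x + a` of the disk onto the ball `B_r(a)`. -/
def ballEmb (r : ℝ) (a : Eu d) (hr : 0 < r) (h : Metric.ball a r ⊆ Metric.ball 0 1) :
    ConfEmb d :=
  have hmem : ∀ x : disk d, r • (x : Eu d) + a ∈ disk d := fun x => h (by
    have hx : ‖(x : Eu d)‖ < 1 := mem_ball_zero_iff.1 x.2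
    rw [mem_ball_iff_norm, add_sub_cancel_right, norm_smul, Real.norm_of_nonneg hr.le]
    exact mul_lt_of_lt_one_right hr hx)
  have hE : Set.EqOn (zeroExt fun x : disk d => r • (x : Eu d) + a) (fun x => r • x + a)
      (disk d) := zeroExt_restrict fun x => r • x + a
  have hfd : ∀ x : disk d, fderiv ℝ (zeroExt fun x : disk d => r • (x : Eu d) + a) x =
      r • ContinuousLinearMap.id ℝ (Eu d) := fun x => by
    rw [Filter.EventuallyEq.fderiv_eq
      (Filter.eventually_of_mem ((disk d).isOpen.mem_nhds x.2) hE), fderiv_smul_add]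
  { toFun := fun x => ⟨r • (x : Eu d) + a, hmem x⟩
    isOpenEmbedding := by
      refine IsOpenEmbedding.of_comp _ (disk d).isOpen.isOpenEmbedding_subtypeVal ?_
      exact ((Homeomorph.smulOfNeZero r hr.ne').trans
        (Homeomorph.addRight a)).isOpenEmbedding.comp (disk d).isOpen.isOpenEmbedding_subtypeVal
    smooth := ((contDiff_const_smul r).add contDiff_const).contDiffOn.congr hE
    conformal := by
      refine ⟨fun _ => r, contDiffOn_const.congr fun x hx => zeroExt_apply _ (⟨x, hx⟩ : disk d),
        fun _ => hr, fun x v w => ?_⟩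
      rw [hfd]
      simp only [_root_.smul_apply, ContinuousLinearMap.id_apply, inner_smul_left, inner_smul_right,
        conj_trivial]
      ring
    orientation := fun x => by
      rw [hfd]
      change 0 < LinearMap.det (r • (LinearMap.id : Eu d →ₗ[ℝ] Eu d))
      rw [LinearMap.det_smul, LinearMap.det_id, mul_one]
      positivity }

lemma ballEmb_apply (r : ℝ) (a : Eu d) (hr : 0 < r) (h : Metric.ball a r ⊆ Metric.ball 0 1)
    (x : disk d) : (ballEmb r a hr h x : Eu d) = r • (x : Eu d) + a := rfl

lemma factor_ballEmb (hd : 1 ≤ d) (r : ℝ) (a : Eu d) (hr : 0 < r)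
    (h : Metric.ball a r ⊆ Metric.ball 0 1) (x : disk d) : (ballEmb r a hr h).factor x = r := by
  refine ((ballEmb r a hr h).factor_unique hd x r hr fun v w => ?_).symm
  have hE : (ballEmb r a hr h).ext =ᶠ[𝓝 (x : Eu d)] fun x => r • x + a :=
    Filter.eventually_of_mem ((disk d).isOpen.mem_nhds x.2) (zeroExt_restrict fun x => r • x + a)
  rw [hE.fderiv_eq, fderiv_smul_add]
  simp only [_root_.smul_apply, ContinuousLinearMap.id_apply, inner_smul_left, inner_smul_right,
    conj_trivial]
  ring

lemma image_ballEmb_subset (r : ℝ) (a : Eu d) (hr : 0 < r)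
    (h : Metric.ball a r ⊆ Metric.ball 0 1) : (ballEmb r a hr h).image ⊆ Metric.ball a r := by
  rintro _ ⟨x, rfl⟩
  have hx : ‖(x : Eu d)‖ < 1 := mem_ball_zero_iff.1 x.2
  dsimp only
  rw [ballEmb_apply, mem_ball_iff_norm, add_sub_cancel_right, norm_smul,
    Real.norm_of_nonneg hr.le]
  exact mul_lt_of_lt_one_right hr hx

/-- The embedding of two disjoint round balls. -/
def ballPair (r s : ℝ) (a b : Eu d) (hr : 0 < r) (hs : 0 < s)
    (hab : Disjoint (Metric.ball a r) (Metric.ball b s))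
    (ha : Metric.ball a r ⊆ Metric.ball 0 1) (hb : Metric.ball b s ⊆ Metric.ball 0 1) :
    CEemb d 2 where
  emb := ![ballEmb r a hr ha, ballEmb s b hs hb]
  disjoint := by
    have h : Disjoint (Set.range (ballEmb r a hr ha)) (Set.range (ballEmb s b hs hb)) := by
      rw [Set.disjoint_left]
      rintro _ ⟨x, rfl⟩ ⟨y, hy⟩
      exact Set.disjoint_left.1 hab (image_ballEmb_subset r a hr ha ⟨x, rfl⟩)
        (image_ballEmb_subset s b hs hb ⟨y, congrArg Subtype.val hy⟩)
    intro i j hij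
    fin_cases i <;> fin_cases j
    · exact absurd rfl hij
    · exact h
    · exact h.symm
    · exact absurd rfl hij

lemma transpose_pullHarm_ballEmb (hd : 3 ≤ d) (r : ℝ) (a : disk d) (hr : 0 < r)
    (h : Metric.ball (a : Eu d) r ⊆ Metric.ball 0 1) (α : Fin d → ℕ) :
    transpose ((ballEmb r (a : Eu d) hr h).pullHarm hd) (diracDeriv α (diskZero d)) =
      (r ^ (((d : ℝ) - 2) / 2) * r ^ (∑ i, α i)) • diracDeriv α a := by
  ext u
  change diracDeriv α (diskZero d) ((ballEmb r (a : Eu d) hr h).pullHarm hd u) = _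
  refine (diracDeriv_diskZero_apply α (w := zeroExt u) (c := r ^ (((d : ℝ) - 2) / 2)) (r := r)
    (a := a) fun x => ?_).trans rfl
  rw [ConfEmb.pullHarm_apply, factor_ballEmb (by omega), ← zeroExt_apply u, ballEmb_apply]

lemma harmOperation_ballPair (hd : 3 ≤ d) (r s : ℝ) (a b : disk d) (hr : 0 < r) (hs : 0 < s)
    (hab : Disjoint (Metric.ball (a : Eu d) r) (Metric.ball (b : Eu d) s))
    (ha : Metric.ball (a : Eu d) r ⊆ Metric.ball 0 1)
    (hb : Metric.ball (b : Eu d) s ⊆ Metric.ball 0 1) (α β : Fin d → ℕ) :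
    harmOperation hd 2 (ballPair r s a b hr hs hab ha hb)
        ![obs (diracDeriv α (diskZero d)), obs (diracDeriv β (diskZero d))] =
      (r ^ (((∑ i, α i : ℕ) : ℝ) + ((d : ℝ) - 2) / 2) *
          s ^ (((∑ i, β i : ℕ) : ℝ) + ((d : ℝ) - 2) / 2)) •
        (obs (diracDeriv α a) * obs (diracDeriv β b) +
          algebraMap ℝ (PolyAlg (HDual d))
            ((-1) ^ ((∑ i, α i) + ∑ i, β i) *
              multiDeriv α (fun x => multiDeriv β (fun y => green d x y) b) a)) := by
  obtain ⟨f, hf⟩ := pairing_surjective hd (diracDeriv α (diskZero d))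
  obtain ⟨g, hg⟩ := pairing_surjective hd (diracDeriv β (diskZero d))
  set φ := ballEmb r (a : Eu d) hr ha with hφ
  set ψ := ballEmb s (b : Eu d) hs hb with hψ
  have hd1 : 1 ≤ d := by omega
  have hdis : Disjoint φ.image ψ.image :=
    hab.mono (image_ballEmb_subset r _ hr ha) (image_ballEmb_subset s _ hs hb)
  have h := harmOperation_two hd (ballPair r s a b hr hs hab ha hb) f g
  change _ = obs (transpose (φ.pullHarm hd) (pairing d f)) *
    obs (transpose (ψ.pullHarm hd) (pairing d g)) +
      algebraMap ℝ _ (pairing d f (ConfEmb.pullPotential hd hdis g)) at h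
  -- The inner variable is evaluated first, for all z in the open set φ(𝔻) and not just at z = a, so
  -- that ∂^α can afterwards be applied in z.
  have hpot : Set.EqOn (conv (newton d) (ψ.push g)) (fun z =>
      (s ^ (((d : ℝ) - 2) / 2) * s ^ (∑ i, β i) * (-1) ^ (∑ i, β i)) *
        multiDeriv β (fun y => green d z y) b) φ.image := fun z hz => by
    have hz' : z ∉ ψ.image := fun hz' => Set.disjoint_left.1 hdis hz hz'
    rw [ψ.conv_newton_push_eq_pairing hd z hz', hg,
      diracDeriv_diskZero_apply β (w := fun y => green d z y) (c := s ^ (((d : ℝ) - 2) / 2))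
        (r := s) (a := (b : Eu d)) fun x => ?_]
    · ring
    · rw [ConfEmb.pullNewton_apply, ConfEmb.pull_apply, factor_ballEmb hd1, ballEmb_apply,
        green_eq_newton]
  have hmem : (a : Eu d) ∈ φ.image := ⟨diskZero d, by
    change r • (0 : Eu d) + a = a
    rw [smul_zero, zero_add]⟩
  -- Since multiple derivatives are local, the potential may be replaced by its expression near a;
  -- the signs and powers of r come from f, those of s from g.
  have hval : pairing d f (ConfEmb.pullPotential hd hdis g) =
      r ^ (((d : ℝ) - 2) / 2) * r ^ (∑ i, α i) * ((-1) ^ (∑ i, α i) *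
        ((s ^ (((d : ℝ) - 2) / 2) * s ^ (∑ i, β i) * (-1) ^ (∑ i, β i)) *
          multiDeriv α (fun x => multiDeriv β (fun y => green d x y) b) a)) := by
    rw [hf, diracDeriv_diskZero_apply α (w := conv (newton d) (ψ.push g))
      (c := r ^ (((d : ℝ) - 2) / 2)) (r := r) (a := (a : Eu d)) fun x => ?_,
      multiDeriv_congr φ.isOpen_image hpot α hmem, multiDeriv_const_mul]
    rw [ConfEmb.pullPotential_apply, ConfEmb.pull_apply, factor_ballEmb hd1, ballEmb_apply]
  rw [hf, hg, transpose_pullHarm_ballEmb, transpose_pullHarm_ballEmb, ← hf, hval, hf] at h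
  rw [h, Real.rpow_add hr, Real.rpow_add hs, Real.rpow_natCast, Real.rpow_natCast, smul_add,
    obs, obs, map_smul, map_smul, smul_mul_smul_comm]
  congr 1
  · congr 1
    ring
  · rw [Algebra.smul_def, ← map_mul]
    congr 1
    ring

end Operations

end

end ConformalDisk

/-- The explicit description of the algebra `(P(H'(𝔻)), ρ^H)` over the operad of conformal disk
embeddings, for `d ≥ 3`. The isomorphisms `T`, `Ψ` and the operations `m`, from which `ρ^H` is
built, are uniquely determined by the first three clauses. -/
theorem mainTheorem8 (d : ℕ) (hd : 3 ≤ d) :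
    ∃ (T : Scl d ≃ₗ[ℝ] HDual d) (Ψ : FCL d ≃ₗ[ℝ] PolyAlg (Scl d))
      (m : ∀ n, CEemb d n → MultilinearMap ℝ (fun _ : Fin n => FCL d) (FCL d)),
      IsHarmonicPairing T ∧ IsGreenQuantization Ψ ∧ IsFactorizationProduct m ∧
      IsCEAlgebra (rhoH T Ψ m) ∧
      -- unary operations
      (∀ φ : CEemb d 1, ∃ R : Harm d →L[ℝ] Harm d,
        (∀ (u : Harm d) (x : disk d),
          R u x = (φ 0).factor x ^ (((d : ℝ) - 2) / 2) * u (φ 0 x)) ∧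
        ∀ F : PolyAlg (HDual d), rhoH T Ψ m 1 φ ![F] = polyMap (transpose R) F) ∧
      (∀ (φ : CEemb d 1) (a : disk d),
        rhoH T Ψ m 1 φ ![obs (dirac a)] =
          ((φ 0).factor a ^ (((d : ℝ) - 2) / 2)) • obs (dirac (φ 0 a))) ∧
      -- binary operations on point evaluations
      (∀ (φ : CEemb d 2) (a b : disk d),
        rhoH T Ψ m 2 φ ![obs (dirac a), obs (dirac b)] =
          ((φ 0).factor a ^ (((d : ℝ) - 2) / 2) * (φ 1).factor b ^ (((d : ℝ) - 2) / 2)) •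
              (obs (dirac (φ 0 a)) * obs (dirac (φ 1 b))) +
            algebraMap ℝ (PolyAlg (HDual d))
              ((φ 0).factor a ^ (((d : ℝ) - 2) / 2) * (φ 1).factor b ^ (((d : ℝ) - 2) / 2) /
                (((d : ℝ) - 2) * sphereVol d *
                  ‖(φ 0 a : Eu d) - (φ 1 b : Eu d)‖ ^ (d - 2)))) ∧
      -- binary operations on derivatives of the evaluation at the centre, for round balls
      (∀ (r s : ℝ) (a b : disk d), 0 < r → r < 1 → 0 < s → s < 1 →
        Disjoint (Metric.ball (a : Eu d) r) (Metric.ball (b : Eu d) s) →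
        Metric.ball (a : Eu d) r ⊆ Metric.ball 0 1 →
        Metric.ball (b : Eu d) s ⊆ Metric.ball 0 1 →
        ∃ φ : CEemb d 2,
          (∀ x, (φ 0 x : Eu d) = r • (x : Eu d) + (a : Eu d)) ∧
          (∀ x, (φ 1 x : Eu d) = s • (x : Eu d) + (b : Eu d)) ∧
          ∀ α β : Fin d → ℕ,
            rhoH T Ψ m 2 φ ![obs (diracDeriv α (diskZero d)), obs (diracDeriv β (diskZero d))] =
              (r ^ (((∑ i, α i : ℕ) : ℝ) + ((d : ℝ) - 2) / 2) *
                  s ^ (((∑ i, β i : ℕ) : ℝ) + ((d : ℝ) - 2) / 2)) •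
                (obs (diracDeriv α a) * obs (diracDeriv β b) +
                  algebraMap ℝ (PolyAlg (HDual d))
                    ((-1) ^ ((∑ i, α i) + ∑ i, β i) *
                      multiDeriv α (fun x => multiDeriv β (fun y => green d x y) b) a))) := by
  exact ⟨harmonicPairing hd, greenQuantization hd, factorizationProduct, isHarmonicPairing hd,
    isGreenQuantization hd, isFactorizationProduct hd,
    isCEAlgebra_rhoH (by omega) _ _ (isFactorizationProduct hd),
    fun φ => ⟨(φ 0).pullHarm hd, (φ 0).pullHarm_apply hd, harmOperation_one hd φ⟩,
    harmOperation_one_dirac hd, harmOperation_two_dirac hd,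
    fun r s a b hr _ hs _ hab ha hb => ⟨ballPair r s a b hr hs hab ha hb, fun _ => rfl,
      fun _ => rfl, harmOperation_ballPair hd r s a b hr hs hab ha hb⟩⟩
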